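/- Theorem 1.1. For N ≥ 0 let $\mathrm{LP}_N$ be the set of link patterns with N links, i.e. non-crossing partitions of $\{1,\dots,2N\}$ into pairs, written $\beta=\{\{a_1,b_1\},\dots,\{a_N,b_N\}\}$ with $a_1<\dots<a_N$ and $a_r<b_r$, and let $\mathfrak X_{2N}=\{(x_1,\dots,x_{2N})\in\mathbb R^{2N}: x_1<\dots<x_{2N}\}$. For $\beta\in\mathrm{LP}_N$ and $\boldsymbol x\in\mathfrak X_{2N}$ put $$\mathcal F_\beta(\boldsymbol x)=\prod_{1\le i<j\le 2N}(x_j-x_i)^{1/4}\int_{x_{a_1}}^{x_{b_1}}\!\!du_1\cdots\int_{x_{a_N}}^{x_{b_N}}\!\!du_N\ \prod_{1\le r<s\le N}(u_s-u_r)\prod_{r=1}^N\prod_{k=1}^{2N}(u_r-x_k)^{-1/2}\in\mathbb C,$$ where the integrals run along the real line, passing the points $x_k$ from above: the branch of the integrand is the one that is positive when $x_{a_r}<u_r<x_{a_r+1}$ for all $r$, continued analytically through the upper half-plane in each $u_r$. In particular $\mathcal F_\emptyset\equiv 1$ for $\emptyset\in\mathrm{LP}_0$. Then the following hold. (PDE)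 For every $N$ and $\beta\in\mathrm{LP}_N$, $\mathcal F_\beta$ is twice continuously differentiable on $\mathfrak X_{2N}$, and for all $j\in\{1,\dots,2N\}$ $$\Big[4\,\partial_{x_j}^2+\sum_{i\ne j}\Big(\frac{2}{x_i-x_j}\,\partial_{x_i}+\frac{1/4}{(x_i-x_j)^2}\Big)\Big]\mathcal F_\beta(\boldsymbol x)=0 ,\qquad \boldsymbol x\in\mathfrak X_{2N}.$$ (COV) For every $\beta\in\mathrm{LP}_N$, $\boldsymbol x\in\mathfrak X_{2N}$ and every Möbius map $\varphi(z)=\frac{az+b}{cz+d}$ of the upper half-plane ($a,b,c,d\in\mathbb R$, $ad-bc>0$), finite at $x_1,\dots,x_{2N}$ and such that $\varphi(x_1)<\dots<\varphi(x_{2N})$, $$\mathcal F_\beta(x_1,\dots,x_{2N})=\prod_{i=1}^{2N}\varphi'(x_i)^{-1/8}\;\mathcal F_\beta(\varphi(x_1),\dots,\varphi(x_{2N})).$$ (POS) For every $\beta\in\mathrm{LP}_N$ and $\boldsymbol x\in\mathfrak X_{2N}$, $\mathcal F_\beta(\boldsymbol x)$ is real and $\mathcal F_\beta(\boldsymbol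 x)>0$. (ASY) Let $N\ge1$, $\beta\in\mathrm{LP}_N$, $j\in\{1,\dots,2N-1\}$, $\boldsymbol x\in\mathfrak X_{2N}$, $\ddot{\boldsymbol x}_j=(x_1,\dots,x_{j-1},x_{j+2},\dots,x_{2N})$ and $\xi\in(x_{j-1},x_{j+2})$, where $x_0=-\infty$ and $x_{2N+1}=+\infty$. As $x_j,x_{j+1}\to\xi$ jointly with $x_j<x_{j+1}$, the other $x_i$ being fixed, $$\frac{\mathcal F_\beta(\boldsymbol x)}{(x_{j+1}-x_j)^{1/4}}\to\pi\,\mathcal F_{\beta/\{j,j+1\}}(\ddot{\boldsymbol x}_j)\quad\text{if }\{j,j+1\}\in\beta,$$ $$\frac{\mathcal F_\beta(\boldsymbol x)}{(x_{j+1}-x_j)^{1/4}\,|\log(x_{j+1}-x_j)|}\to\mathcal F_{\wp_j(\beta)/\{j,j+1\}}(\ddot{\boldsymbol x}_j)\quad\text{if }\{j,j+1\}\notin\beta.$$ Here, if $\ell_1,\ell_2$ are the partners of $j,j+1$ in $\beta$, then $\wp_j(\beta)\in\mathrm{LP}_N$ is obtained from $\beta$ by replacing the links $\{j,\ell_1\},\{j+1,\ell_2\}$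 by $\{j,j+1\},\{\ell_1,\ell_2\}$ (and $\wp_j(\beta)=\beta$ if $\{j,j+1\}\in\beta$), and $\,\cdot\,/\{j,j+1\}$ removes the link $\{j,j+1\}$ and relabels the remaining indices increasingly by $1,\dots,2N-2$. (LIN) For every $N$, the functions $\mathcal F_\beta$, $\beta\in\mathrm{LP}_N$, on $\mathfrak X_{2N}$ are linearly independent over $\mathbb C$. -/

import Mathlib

open Set Filter Topology MeasureTheory
open scoped ContDiff

noncomputable section

/-- A link pattern with `N` links: a non-crossing partition of `2N` ordered points into pairs,
encoded by the fixed-point-free involution `pair` that sends each point to its partner. -/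
@[ext]
structure LinkPattern (N : ℕ) where
  pair : Fin (2 * N) → Fin (2 * N)
  pair_pair : ∀ i, pair (pair i) = i
  pair_ne : ∀ i, pair i ≠ i
  noncrossing : ∀ i k, ¬ (i < k ∧ k < pair i ∧ pair i < pair k)

/-- The point with index `j` among `2(n+1)` points (indices count from `0`); it has a right neighbour. -/
def lo {n : ℕ} (j : Fin (2 * n + 1)) : Fin (2 * (n + 1)) := ⟨j, by omega⟩

/-- The point with index `j + 1`, the right neighbour of `lo j`. -/
def hi {n : ℕ} (j : Fin (2 * n + 1)) : Fin (2 * (n + 1)) := ⟨j + 1, by omega⟩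

/-- The increasing enumeration of the points other than `lo j` and `hi j`; so `x ∘ skip j` is the
tuple `x` with these two entries omitted. -/
def skip {n : ℕ} (j : Fin (2 * n + 1)) (i : Fin (2 * n)) : Fin (2 * (n + 1)) :=
  ⟨if (i : ℕ) < j then i else i + 2, by split_ifs <;> omega⟩

/-- The inverse relabeling of `skip j`. -/
def unskip {n : ℕ} (j : Fin (2 * n + 1)) (k : Fin (2 * (n + 1))) (h₁ : k ≠ lo j)
    (h₂ : k ≠ hi j) : Fin (2 * n) :=
  ⟨if (k : ℕ) < j then k else k - 2, by
    simp only [ne_eq, Fin.ext_iff, lo, hi] at h₁ h₂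
    split_ifs <;> omega⟩

lemma skip_ne_lo {n : ℕ} (j : Fin (2 * n + 1)) (i : Fin (2 * n)) : skip j i ≠ lo j := by
  simp only [ne_eq, Fin.ext_iff, lo, skip]; split_ifs <;> omega

lemma skip_ne_hi {n : ℕ} (j : Fin (2 * n + 1)) (i : Fin (2 * n)) : skip j i ≠ hi j := by
  simp only [ne_eq, Fin.ext_iff, hi, skip]; split_ifs <;> omega

lemma skip_unskip {n : ℕ} (j : Fin (2 * n + 1)) (k : Fin (2 * (n + 1))) (h₁ : k ≠ lo j)
    (h₂ : k ≠ hi j) : skip j (unskip j k h₁ h₂) = k := by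
  simp only [ne_eq, Fin.ext_iff, lo, hi] at h₁ h₂
  simp only [Fin.ext_iff, skip, unskip]; split_ifs <;> omega

lemma skip_lt_skip {n : ℕ} (j : Fin (2 * n + 1)) (i k : Fin (2 * n)) :
    skip j i < skip j k ↔ i < k := by
  simp only [Fin.lt_def, skip]; split_ifs <;> omega

lemma skip_injective {n : ℕ} (j : Fin (2 * n + 1)) : Function.Injective (skip j) := by
  intro i k h
  simp only [Fin.ext_iff, skip] at h ⊢
  split_ifs at h <;> omega

lemma noncrossing_sep {m : ℕ} (p : Fin m → Fin m) (pp : ∀ i, p (p i) = i)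
  (nc : ∀ i k, ¬ (i < k ∧ k < p i ∧ p i < p k)) (i c : Fin m) 
    (h3 : p c ≠ i) (h4 : p c ≠ p i) :
  ((i < c ∧ c < p i) ∨ (p i < c ∧ c < i)) → ((i < p c ∧ p c < p i) ∨ (p i < p c ∧ p c < i)) := by
  have n1 := nc i c
  have n2 := nc (p i) c
  have n3 := nc (p c) i
  have n4 := nc (p c) (p i)
  simp only [pp] at n1 n2 n3 n4
  simp only [Fin.ext_iff, Fin.lt_def, ne_eq] at *
  omega

lemma noncrossing_tie {m : ℕ} (p : Fin m → Fin m) (pp : ∀ i, p (p i) = i)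
  (nc : ∀ i k, ¬ (i < k ∧ k < p i ∧ p i < p k)) (l h : Fin m) (hl : (h:ℕ) = l + 1)
  (t : Fin m → Fin m) (ht : ∀ k, t k = if k = l then h
  else if k = h then l
  else if k = p l then p h
  else if k = p h then p l
  else p k) (i k : Fin m) : ¬ (i < k ∧ k < t i ∧ t i < t k) := by
  have ht' : ∀ c, (c = l ∧ t c = h) ∨ (c = h ∧ t c = l) ∨ (c = p l ∧ t c = p h) ∨
      (c = p h ∧ t c = p l) ∨ (c ≠ l ∧ c ≠ h ∧ c ≠ p l ∧ c ≠ p h ∧ t c = p c) := by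
    intro c
    rw [ht]
    split_ifs <;> simp_all
  have main : ∀ c, c ≠ l → c ≠ h → c ≠ p l → c ≠ p h →
      (((p l < c ∧ c < p h) ∨ (p h < c ∧ c < p l)) ↔
      ((p l < p c ∧ p c < p h) ∨ (p h < p c ∧ p c < p l))) := by
    intro c h1 h2 h3 h4
    have g1 : p c ≠ l := fun e => h3 (by rw [← e, pp])
    have g2 : p c ≠ h := fun e => h4 (by rw [← e, pp])
    have g3 : p c ≠ p l := fun e => h1 (by rw [← pp c, e, pp])
    have g4 : p c ≠ p h := fun e => h2 (by rw [← pp c, e, pp])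
    have s1 := noncrossing_sep p pp nc l c g1 g3
    have s2 := noncrossing_sep p pp nc h c g2 g4
    have s3 := noncrossing_sep p pp nc l (p c) (by rwa [pp]) (by rwa [pp])
    have s4 := noncrossing_sep p pp nc h (p c) (by rwa [pp]) (by rwa [pp])
    rw [pp] at s3 s4
    simp only [Fin.ext_iff, Fin.lt_def, ne_eq] at *
    omega
  rcases ht' i with ⟨e, f⟩ | ⟨e, f⟩ | ⟨e, f⟩ | ⟨e, f⟩ | ⟨e1, e2, e3, e4, f⟩ <;>
  rcases ht' k with ⟨e', f'⟩ | ⟨e', f'⟩ | ⟨e', f'⟩ | ⟨e', f'⟩ | ⟨e1', e2', e3', e4', f'⟩ <;>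
  rw [f, f']
  case inr.inr.inr.inr.inr.inr.inr.inr => exact nc i k
  all_goals clear ht' ht f f' nc pp t
  all_goals try (clear main; simp only [Fin.ext_iff, Fin.lt_def, ne_eq] at *; omega)
  all_goals first | have m1 := main k ‹_› ‹_› ‹_› ‹_› | have m1 := main i ‹_› ‹_› ‹_› ‹_›
  all_goals clear main; simp only [Fin.ext_iff, Fin.lt_def, ne_eq] at *
  all_goals try omega

namespace LinkPattern

/-- The left endpoints of the links of `β`. -/
def leftEnds {N : ℕ} (β : LinkPattern N) : Finset (Fin (2 * N)) :=
  Finset.univ.filter fun i => i < β.pair i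

lemma card_leftEnds {N : ℕ} (β : LinkPattern N) : β.leftEnds.card = N := by
  have hinj : Function.Injective β.pair := fun i k h => by
    rw [← β.pair_pair i, h, β.pair_pair]
  have hc : β.leftEndsᶜ = β.leftEnds.image β.pair := by
    ext i
    simp only [leftEnds, Finset.mem_compl, Finset.mem_filter, Finset.mem_univ, true_and,
      Finset.mem_image, not_lt]
    constructor
    · intro h
      exact ⟨β.pair i, by rw [β.pair_pair]; exact lt_of_le_of_ne h (β.pair_ne i), β.pair_pair i⟩
    · rintro ⟨k, hk, rfl⟩
      rw [β.pair_pair]; exact hk.le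
  have h1 : β.leftEndsᶜ.card = β.leftEnds.card := by
    rw [hc, Finset.card_image_of_injective _ hinj]
  have h2 := Finset.card_add_card_compl β.leftEnds
  rw [h1, Fintype.card_fin] at h2
  omega

/-- The left endpoints `a₁ < a₂ < ⋯ < a_N` of the links, in increasing order. -/
def a {N : ℕ} (β : LinkPattern N) (r : Fin N) : Fin (2 * N) :=
  β.leftEnds.orderEmbOfFin β.card_leftEnds r

/-- The right endpoint `b_r` of the link whose left endpoint is `a_r`. -/
def b {N : ℕ} (β : LinkPattern N) (r : Fin N) : Fin (2 * N) := β.pair (β.a r)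

/-- `β / {j, j+1}`: remove the link `{j, j+1}` from `β` and relabel the remaining points. -/
def removeLink {n : ℕ} (β : LinkPattern (n + 1)) (j : Fin (2 * n + 1))
    (h : β.pair (lo j) = hi j) : LinkPattern n :=
  have h₁ : ∀ i, β.pair (skip j i) ≠ lo j := fun i e => by
    apply skip_ne_hi j i; rw [← h, ← e, β.pair_pair]
  have h₂ : ∀ i, β.pair (skip j i) ≠ hi j := fun i e => by
    apply skip_ne_lo j i; rw [← β.pair_pair (skip j i), e, ← h, β.pair_pair]
  { pair := fun i => unskip j (β.pair (skip j i)) (h₁ i) (h₂ i)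
    pair_pair := fun i => by
      apply skip_injective j
      simp only [skip_unskip, β.pair_pair]
    pair_ne := fun i e => by
      have := congrArg (skip j) e
      rw [skip_unskip] at this
      exact β.pair_ne _ this
    noncrossing := fun i k => by
      rw [← skip_lt_skip j, ← skip_lt_skip j, ← skip_lt_skip j, skip_unskip, skip_unskip]
      exact β.noncrossing _ _ }

/-- The partner map of `℘_j(β)`: the points `j` and `j+1` become partners, and so do their former
partners; all other links of `β` are kept. -/
def tiePair {n : ℕ} (β : LinkPattern (n + 1)) (j : Fin (2 * n + 1)) (k : Fin (2 * (n + 1))) :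
    Fin (2 * (n + 1)) :=
  if k = lo j then hi j
  else if k = hi j then lo j
  else if k = β.pair (lo j) then β.pair (hi j)
  else if k = β.pair (hi j) then β.pair (lo j)
  else β.pair k

lemma lo_ne_hi {n : ℕ} (j : Fin (2 * n + 1)) : lo j ≠ hi j := by
  simp [Fin.ext_iff, lo, hi]

/-- The tying operation `℘_j`. -/
def tie {n : ℕ} (β : LinkPattern (n + 1)) (j : Fin (2 * n + 1)) : LinkPattern (n + 1) where
  pair := β.tiePair j
  pair_pair := fun i => by
    have := β.pair_pair; have := β.pair_ne; have := lo_ne_hi j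
    unfold tiePair; grind
  pair_ne := fun i => by
    have := β.pair_pair; have := β.pair_ne; have := lo_ne_hi j
    unfold tiePair; grind
  noncrossing := noncrossing_tie β.pair β.pair_pair β.noncrossing (lo j) (hi j) rfl _
    fun _ => rfl

lemma tie_pair_lo {n : ℕ} (β : LinkPattern (n + 1)) (j : Fin (2 * n + 1)) :
    (β.tie j).pair (lo j) = hi j := by
  simp [tie, tiePair]

end LinkPattern

/-- The chamber `𝔛_{2N} = {x₁ < x₂ < ⋯ < x_{2N}}`. -/
def chamber (N : ℕ) : Set (Fin (2 * N) → ℝ) := {x | StrictMono x}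

/-- The branch `f_β(x; u)` of the multivalued Coulomb gas integrand
`∏_{i<j} (x_j - x_i)^{1/4} ∏_{r<s} (u_s - u_r) ∏_{r,i} (u_r - x_i)^{-1/2}`
for `u_r` in the closed upper half-plane minus the points `x_i`.

There, the principal branch of `z ↦ z^{-1/2}` (argument in `(-π, π]`) is analytic in the interior
and, on the negative real axis, equal to its boundary value from above; so this is the analytic
continuation through the upper half-plane. The constant phase (one factor `i` for each `r` and each
point to the right of `x_{a_r}`) normalizes the branch to be positive when
`x_{a_r} < u_r < x_{a_r + 1}` for all `r`; see `integrand_pos`. -/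
def integrand {N : ℕ} (β : LinkPattern N) (x : Fin (2 * N) → ℝ) (u : Fin N → ℂ) : ℂ :=
  (∏ r, Complex.I ^ (Finset.Ioi (β.a r)).card) *
    ((∏ i, ∏ j ∈ Finset.Ioi i, (x j - x i) ^ (1 / 4 : ℝ) : ℝ) : ℂ) *
    (∏ r, ∏ s ∈ Finset.Ioi r, (u s - u r)) *
    ∏ r, ∏ i, (u r - (x i : ℂ)) ^ (-1 / 2 : ℂ)

/-- The Coulomb gas integral `F_β(x) = ∫_{x_{a_1}}^{x_{b_1}} du_1 ⋯ ∫_{x_{a_N}}^{x_{b_N}} du_N f_β(x; u)`,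
the contours running along the real line from above. -/
def coulombGas {N : ℕ} (β : LinkPattern N) (x : Fin (2 * N) → ℝ) : ℂ :=
  ∫ u in Set.univ.pi fun r => Set.Ioo (x (β.a r)) (x (β.b r)), integrand β x fun r => (u r : ℂ)

/-- The normalization of the branch: it is positive when `x_{a_r} < u_r < x_{a_r + 1}` for all `r`. -/
lemma integrand_pos {N : ℕ} (β : LinkPattern N) {x : Fin (2 * N) → ℝ} (hx : x ∈ chamber N)
    (u : Fin N → ℝ) (hl : ∀ r, x (β.a r) < u r) (hr : ∀ r k, β.a r < k → u r < x k) :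
    ∃ c : ℝ, 0 < c ∧ integrand β x (fun r => (u r : ℂ)) = c := by
  have ha : StrictMono β.a := (β.leftEnds.orderEmbOfFin β.card_leftEnds).strictMono
  have key : ∀ r i, ((u r : ℂ) - (x i : ℂ)) ^ (-1 / 2 : ℂ) =
      (if β.a r < i then -Complex.I else 1) * ((|u r - x i| ^ (-1 / 2 : ℝ) : ℝ) : ℂ) := by
    intro r i
    have e : (-1 / 2 : ℂ) = ((-1 / 2 : ℝ) : ℂ) := by norm_num
    split_ifs with h
    · have h1 : u r - x i < 0 := sub_neg.2 (hr r i h)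
      rw [← Complex.ofReal_sub, Complex.ofReal_cpow_of_nonpos h1.le, abs_of_neg h1,
        ← Complex.ofReal_neg, e, ← Complex.ofReal_cpow (by linarith), mul_comm]
      congr 1
      rw [show (Real.pi : ℂ) * Complex.I * ((-1 / 2 : ℝ) : ℂ) = -(Real.pi / 2 * Complex.I) by
        push_cast; ring, Complex.exp_neg, Complex.exp_pi_div_two_mul_I, Complex.inv_I]
    · have h1 : 0 < u r - x i :=
        sub_pos.2 ((hx.monotone (not_lt.1 h)).trans_lt (hl r))
      rw [abs_of_pos h1, one_mul, ← Complex.ofReal_sub, e, ← Complex.ofReal_cpow h1.le]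
  have hne : ∀ r i, 0 < |u r - x i| := by
    intro r i
    rw [abs_pos, sub_ne_zero]
    rcases lt_or_ge (β.a r) i with h | h
    · exact (hr r i h).ne
    · exact ((hx.monotone h).trans_lt (hl r)).ne'
  refine ⟨(∏ i, ∏ j ∈ Finset.Ioi i, (x j - x i) ^ (1 / 4 : ℝ)) *
    (∏ r, ∏ s ∈ Finset.Ioi r, (u s - u r)) * ∏ r, ∏ i, |u r - x i| ^ (-1 / 2 : ℝ), ?_, ?_⟩
  · refine mul_pos (mul_pos ?_ ?_) ?_
    · exact Finset.prod_pos fun i _ => Finset.prod_pos fun j hj =>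
        Real.rpow_pos_of_pos (sub_pos.2 (hx (Finset.mem_Ioi.1 hj))) _
    · exact Finset.prod_pos fun r _ => Finset.prod_pos fun s hs =>
        sub_pos.2 ((hr r _ (ha (Finset.mem_Ioi.1 hs))).trans (hl s))
    · exact Finset.prod_pos fun r _ => Finset.prod_pos fun i _ => Real.rpow_pos_of_pos (hne r i) _
  · have hph : ∀ r, (∏ i, if β.a r < i then -Complex.I else 1) =
        (-Complex.I) ^ (Finset.Ioi (β.a r)).card := by
      intro r
      rw [Finset.prod_ite, Finset.prod_const, Finset.prod_const_one, mul_one]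
      congr 2
      ext i; simp
    have hone : (∏ r, Complex.I ^ (Finset.Ioi (β.a r)).card) *
        (∏ r, (-Complex.I) ^ (Finset.Ioi (β.a r)).card) = 1 := by
      rw [← Finset.prod_mul_distrib]
      exact Finset.prod_eq_one fun r _ => by rw [← mul_pow]; simp
    simp only [integrand, key, Finset.prod_mul_distrib, hph]
    push_cast
    linear_combination ((∏ i, ∏ j ∈ Finset.Ioi i, (((x j - x i) ^ (1 / 4 : ℝ) : ℝ) : ℂ)) *
      (∏ r, ∏ s ∈ Finset.Ioi r, ((u s : ℂ) - u r)) *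
      ∏ r, ∏ i, ((|u r - x i| ^ (-1 / 2 : ℝ) : ℝ) : ℂ)) * hone

/-- The Coulomb gas function of the empty link pattern is the constant `1`. -/
lemma coulombGas_zero (β : LinkPattern 0) (x : Fin (2 * 0) → ℝ) : coulombGas β x = 1 := by
  have : IsEmpty (Fin (2 * 0)) := inferInstanceAs (IsEmpty (Fin 0))
  have h : (Set.univ.pi fun r : Fin 0 => Set.Ioo (x (β.a r)) (x (β.b r))) = Set.univ := by
    ext; simp
  rw [coulombGas, h]
  simp [integrand, Measure.real, volume_pi]

/-- The partial derivative `∂F/∂x_i`. -/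
def partialDeriv {m : ℕ} (i : Fin m) (F : (Fin m → ℝ) → ℂ) (x : Fin m → ℝ) : ℂ :=
  fderiv ℝ F x (Pi.single i 1)

/-- The Möbius map `t ↦ (a t + b) / (c t + d)` on the real line. -/
def mobius (a b c d t : ℝ) : ℝ := (a * t + b) / (c * t + d)

/-- The tuple `x` with its consecutive entries `x_j, x_{j+1}` replaced by `p.1, p.2`. -/
def setPair {n : ℕ} (x : Fin (2 * (n + 1)) → ℝ) (j : Fin (2 * n + 1)) (p : ℝ × ℝ) :
    Fin (2 * (n + 1)) → ℝ :=
  Function.update (Function.update x (lo j) p.1) (hi j) p.2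

end

noncomputable section

namespace LinkPattern

variable {N n : ℕ}

lemma a_strictMono (β : LinkPattern N) : StrictMono β.a :=
  (β.leftEnds.orderEmbOfFin β.card_leftEnds).strictMono

lemma range_a (β : LinkPattern N) : Set.range β.a = {i | i < β.pair i} := by
  have h := Finset.range_orderEmbOfFin β.leftEnds β.card_leftEnds
  have : (Set.range β.a) = (β.leftEnds : Set _) := h
  rw [this]; ext i; simp [leftEnds]

lemma a_lt_b (β : LinkPattern N) (r : Fin N) : β.a r < β.b r := by
  have : β.a r ∈ Set.range β.a := ⟨r, rfl⟩
  rw [range_a] at this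
  exact this

lemma exists_a_eq (β : LinkPattern N) {i : Fin (2 * N)} (h : i < β.pair i) : ∃ r, β.a r = i := by
  have : i ∈ Set.range β.a := by rw [range_a]; exact h
  exact this

lemma pair_injective (β : LinkPattern N) : Function.Injective β.pair := fun i k h => by
  rw [← β.pair_pair i, h, β.pair_pair]

lemma pair_eq_iff (β : LinkPattern N) {i k : Fin (2 * N)} : β.pair i = k ↔ i = β.pair k :=
  ⟨fun h => by rw [← h, β.pair_pair], fun h => by rw [h, β.pair_pair]⟩

/-- A sum over all points is a sum over the links of the contributions of both ends. -/
lemma sum_eq_sum_links {M : Type*} [AddCommMonoid M] (β : LinkPattern N) (f : Fin (2 * N) → M) :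
    ∑ k, f k = ∑ r, (f (β.a r) + f (β.b r)) := by
  have h1 : ∀ g : Fin (2 * N) → M, ∑ r, g (β.a r) = ∑ k ∈ β.leftEnds, g k := by
    intro g
    have hm : Finset.univ.map ⟨β.a, β.a_strictMono.injective⟩ = β.leftEnds :=
      Finset.map_orderEmbOfFin_univ β.leftEnds β.card_leftEnds
    rw [← hm, Finset.sum_map]
    rfl
  have h2 : ∑ r, f (β.b r) = ∑ k ∈ β.leftEnds, f (β.pair k) := h1 fun k => f (β.pair k)
  rw [Finset.sum_add_distrib, h1, h2,
    ← Finset.sum_add_sum_compl β.leftEnds f]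
  congr 1
  refine Finset.sum_bij' (fun k _ => β.pair k) (fun k _ => β.pair k) ?_ ?_ ?_ ?_ ?_
  · intro k hk
    simp only [leftEnds, Finset.mem_compl, Finset.mem_filter, Finset.mem_univ, true_and] at hk ⊢
    rw [β.pair_pair]; exact lt_of_le_of_ne (not_lt.1 hk) (β.pair_ne k)
  · intro k hk
    simp only [leftEnds, Finset.mem_compl, Finset.mem_filter, Finset.mem_univ, true_and] at hk ⊢
    rw [β.pair_pair]; exact not_lt.2 hk.le
  · simp [β.pair_pair]
  · simp [β.pair_pair]
  · simp [β.pair_pair]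

/-- The link whose left end is last joins two neighbours. -/
lemma exists_last_link (β : LinkPattern (n + 1)) :
    ∃ j : Fin (2 * n + 1), β.a (Fin.last n) = lo j ∧ β.pair (lo j) = hi j := by
  have hab := β.a_lt_b (Fin.last n)
  set i := β.a (Fin.last n) with hi'
  change i < β.pair i at hab
  have hlt : (i : ℕ) < 2 * n + 1 := by
    have := (β.pair i).isLt; rw [Fin.lt_def] at hab; omega
  refine ⟨⟨i, hlt⟩, by simp [lo], ?_⟩
  have hlo : lo (⟨i, hlt⟩ : Fin (2 * n + 1)) = i := by simp [lo]
  rw [hlo]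
  set k := hi (⟨i, hlt⟩ : Fin (2 * n + 1)) with hk
  have hkv : (k : ℕ) = i + 1 := rfl
  by_contra hne
  have hik : i < k := by rw [Fin.lt_def]; omega
  have hkp : k < β.pair i := by
    rw [Fin.lt_def] at hab ⊢; rw [Fin.ext_iff] at hne; omega
  rcases lt_or_gt_of_ne (β.pair_ne k) with h | h
  · have h1 : β.pair k ≠ i := fun e => by
      rw [← e, β.pair_pair] at hkp; exact lt_irrefl _ hkp
    have h2 : β.pair k < i := by
      rw [Fin.lt_def] at h ⊢; rw [Ne, Fin.ext_iff] at h1; omega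
    exact β.noncrossing (β.pair k) i ⟨h2, by rwa [β.pair_pair], by rwa [β.pair_pair]⟩
  · obtain ⟨r, hr⟩ := β.exists_a_eq h
    have : β.a r ≤ i := β.a_strictMono.monotone (Fin.le_last r)
    rw [hr] at this
    exact absurd hik (not_lt.2 this)

lemma skip_removeLink_pair (β : LinkPattern (n + 1)) (j : Fin (2 * n + 1))
    (h : β.pair (lo j) = hi j) (i : Fin (2 * n)) :
    skip j ((β.removeLink j h).pair i) = β.pair (skip j i) := by
  simp only [removeLink, skip_unskip]

end LinkPattern

lemma skip_strictMono {n : ℕ} (j : Fin (2 * n + 1)) : StrictMono (skip j) := fun i k h =>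
  (skip_lt_skip j i k).2 h

lemma exists_skip {n : ℕ} (j : Fin (2 * n + 1)) {k : Fin (2 * (n + 1))} (h₁ : k ≠ lo j)
    (h₂ : k ≠ hi j) : ∃ i, k = skip j i := ⟨unskip j k h₁ h₂, (skip_unskip j k h₁ h₂).symm⟩

namespace LinkPattern

variable {N n : ℕ}

lemma a_removeLink (β : LinkPattern (n + 1)) (j : Fin (2 * n + 1))
    (h : β.pair (lo j) = hi j) (ρ : Fin (n + 1)) (hρ : β.a ρ = lo j) (r : Fin n) :
    β.a (ρ.succAbove r) = skip j ((β.removeLink j h).a r) := by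
  have h1 : StrictMono (fun r => β.a (ρ.succAbove r)) :=
    β.a_strictMono.comp (Fin.strictMono_succAbove ρ)
  have h2 : StrictMono (fun r => skip j ((β.removeLink j h).a r)) :=
    (skip_strictMono j).comp (a_strictMono _)
  have h3 : Set.range (fun r => β.a (ρ.succAbove r)) =
      Set.range (fun r => skip j ((β.removeLink j h).a r)) := by
    apply Set.eq_of_subset_of_ncard_le
    · rintro _ ⟨r, rfl⟩
      have hlt := β.a_lt_b (ρ.succAbove r)
      change _ < β.pair _ at hlt
      have n1 : β.a (ρ.succAbove r) ≠ lo j := fun e =>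
        Fin.succAbove_ne ρ r (β.a_strictMono.injective (e.trans hρ.symm))
      have n2 : β.a (ρ.succAbove r) ≠ hi j := fun e => by
        rw [e, ← h, β.pair_pair, h] at hlt
        simp only [Fin.lt_def, lo, hi] at hlt; omega
      obtain ⟨i, hi⟩ := exists_skip j n1 n2
      have : i < (β.removeLink j h).pair i := by
        rw [← skip_lt_skip j, skip_removeLink_pair, ← hi]; exact hlt
      obtain ⟨s, hs⟩ := exists_a_eq _ this
      exact ⟨s, by simp only [hs, hi]⟩
    · rw [← Set.image_univ, ← Set.image_univ, Set.ncard_image_of_injective _ h1.injective,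
        Set.ncard_image_of_injective _ h2.injective]
    · exact Set.toFinite _
  exact congrFun ((h1.range_inj h2).1 h3) r

lemma b_removeLink (β : LinkPattern (n + 1)) (j : Fin (2 * n + 1))
    (h : β.pair (lo j) = hi j) (ρ : Fin (n + 1)) (hρ : β.a ρ = lo j) (r : Fin n) :
    β.b (ρ.succAbove r) = skip j ((β.removeLink j h).b r) := by
  rw [b, a_removeLink β j h ρ hρ, ← skip_removeLink_pair β j h]; rfl

lemma skip_val_mod_two (j : Fin (2 * n + 1)) (i : Fin (2 * n)) :
    (skip j i : ℕ) % 2 = (i : ℕ) % 2 := by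
  simp only [skip]; split_ifs <;> omega

/-- Partners have opposite parity. -/
lemma pair_mod_two : ∀ {N : ℕ} (β : LinkPattern N) (i : Fin (2 * N)),
    (β.pair i : ℕ) % 2 ≠ (i : ℕ) % 2
  | 0, _, i => absurd i.isLt (by omega)
  | n + 1, β, i => by
    obtain ⟨j, -, h⟩ := β.exists_last_link
    by_cases h1 : i = lo j
    · rw [h1, h]; simp only [lo, hi]; omega
    by_cases h2 : i = hi j
    · rw [h2, ← h, β.pair_pair, h]; simp only [lo, hi]; omega
    obtain ⟨k, rfl⟩ := exists_skip j h1 h2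
    rw [← skip_removeLink_pair β j h, skip_val_mod_two, skip_val_mod_two]
    exact pair_mod_two _ k

end LinkPattern

lemma univ_eq_insert_skip {n : ℕ} (j : Fin (2 * n + 1)) :
    (Finset.univ : Finset (Fin (2 * (n + 1)))) =
      insert (lo j) (insert (hi j) (Finset.univ.map ⟨skip j, skip_injective j⟩)) := by
  ext k
  simp only [Finset.mem_univ, Finset.mem_insert, Finset.mem_map, Function.Embedding.coeFn_mk,
    true_and, true_iff]
  by_cases h1 : k = lo j
  · exact Or.inl h1
  by_cases h2 : k = hi j
  · exact Or.inr (Or.inl h2)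
  obtain ⟨i, rfl⟩ := exists_skip j h1 h2
  exact Or.inr (Or.inr ⟨i, rfl⟩)

/-- The points of `A`, relabeled by `skip j`. -/
def skipSet {n : ℕ} (j : Fin (2 * n + 1)) (A : Finset (Fin (2 * n))) :
    Finset (Fin (2 * (n + 1))) := A.map ⟨skip j, skip_injective j⟩

lemma mem_skipSet {n : ℕ} (j : Fin (2 * n + 1)) (A : Finset (Fin (2 * n))) (i : Fin (2 * n)) :
    skip j i ∈ skipSet j A ↔ i ∈ A := by
  simp only [skipSet, Finset.mem_map, Function.Embedding.coeFn_mk]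
  exact ⟨fun ⟨k, hk, e⟩ => skip_injective j e ▸ hk, fun h => ⟨i, h, rfl⟩⟩

lemma lo_notMem_skipSet {n : ℕ} (j : Fin (2 * n + 1)) (A : Finset (Fin (2 * n))) :
    lo j ∉ skipSet j A := by
  simp only [skipSet, Finset.mem_map, not_exists, not_and, Function.Embedding.coeFn_mk]
  exact fun i _ => skip_ne_lo j i

lemma hi_notMem_skipSet {n : ℕ} (j : Fin (2 * n + 1)) (A : Finset (Fin (2 * n))) :
    hi j ∉ skipSet j A := by
  simp only [skipSet, Finset.mem_map, not_exists, not_and, Function.Embedding.coeFn_mk]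
  exact fun i _ => skip_ne_hi j i

lemma prod_lo_hi_skip {n : ℕ} {M : Type*} [CommMonoid M] (j : Fin (2 * n + 1))
    (f : Fin (2 * (n + 1)) → M) : ∏ k, f k = f (lo j) * (f (hi j) * ∏ i, f (skip j i)) := by
  have h2 := hi_notMem_skipSet j Finset.univ
  have h1 := lo_notMem_skipSet j Finset.univ
  unfold skipSet at h1 h2
  rw [univ_eq_insert_skip j, Finset.prod_insert, Finset.prod_insert h2, Finset.prod_map]
  · rfl
  · simp only [Finset.mem_insert, h1, or_false]; exact LinkPattern.lo_ne_hi j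

lemma sum_lo_hi_skip {n : ℕ} {M : Type*} [AddCommMonoid M] (j : Fin (2 * n + 1))
    (f : Fin (2 * (n + 1)) → M) : ∑ k, f k = f (lo j) + (f (hi j) + ∑ i, f (skip j i)) := by
  exact prod_lo_hi_skip (M := Multiplicative M) j f

lemma sum_finset_lo_hi_skip {n : ℕ} {M : Type*} [AddCommMonoid M] (j : Fin (2 * n + 1))
    (f : Finset (Fin (2 * (n + 1))) → M) :
    ∑ A, f A = ∑ A : Finset (Fin (2 * n)), (f (skipSet j A) + f (insert (hi j) (skipSet j A)) +
      (f (insert (lo j) (skipSet j A)) + f (insert (lo j) (insert (hi j) (skipSet j A))))) := by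
  have h2 := hi_notMem_skipSet j Finset.univ
  have h1 := lo_notMem_skipSet j Finset.univ
  unfold skipSet at h1 h2
  have key : ∀ g : Finset (Fin (2 * (n + 1))) → M,
      ∑ A ∈ (Finset.univ.map ⟨skip j, skip_injective j⟩).powerset, g A =
        ∑ A : Finset (Fin (2 * n)), g (skipSet j A) := by
    intro g
    symm
    refine Finset.sum_bij (fun A _ => skipSet j A) ?_ ?_ ?_ ?_
    · intro A _
      rw [Finset.mem_powerset]
      exact Finset.map_subset_map.2 (Finset.subset_univ A)
    · intro A _ B _ e
      exact Finset.map_injective _ e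
    · intro B hB
      rw [Finset.mem_powerset] at hB
      obtain ⟨A, -, rfl⟩ := Finset.subset_map_iff.1 hB
      exact ⟨A, Finset.mem_univ _, rfl⟩
    · intro A _; rfl
  rw [← Finset.powerset_univ, univ_eq_insert_skip j, Finset.sum_powerset_insert,
    Finset.sum_powerset_insert h2, Finset.sum_powerset_insert h2, key, key, key, key]
  · simp only [Finset.sum_add_distrib]
  · simp only [Finset.mem_insert, h1, or_false]; exact LinkPattern.lo_ne_hi j

namespace LinkPattern

variable {N n : ℕ}

/-- The contribution of the point `k` to `LinkPattern.spin`. -/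
def linkWeight (β : LinkPattern N) (A : Finset (Fin (2 * N))) (k : Fin (2 * N)) : ℂ :=
  if k ∈ A ↔ β.pair k ∈ A then 0 else if k ∈ A ∧ β.pair k < k then -Complex.I else 1

/-- The coefficient of `A` in the expansion of `β` as a spin chain state: it vanishes unless `A`
contains exactly one end of each link, and each right end in `A` contributes a factor `-i`. -/
def spin (β : LinkPattern N) (A : Finset (Fin (2 * N))) : ℂ := ∏ k, β.linkWeight A k

lemma spin_eq_zero (β : LinkPattern N) {A : Finset (Fin (2 * N))} (k : Fin (2 * N))
    (h : k ∈ A ↔ β.pair k ∈ A) : β.spin A = 0 :=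
  Finset.prod_eq_zero (Finset.mem_univ k) (by rw [linkWeight, if_pos h])

lemma spin_removeLink_aux (β : LinkPattern (n + 1)) (j : Fin (2 * n + 1))
    (h : β.pair (lo j) = hi j) {A : Finset (Fin (2 * n))} {B : Finset (Fin (2 * (n + 1)))}
    (hB : ∀ i, skip j i ∈ B ↔ i ∈ A) :
    β.spin B = β.linkWeight B (lo j) * (β.linkWeight B (hi j) * (β.removeLink j h).spin A) := by
  rw [spin, prod_lo_hi_skip j]
  congr 2
  refine Finset.prod_congr rfl fun i _ => ?_
  simp only [linkWeight, ← skip_removeLink_pair β j h, hB, skip_lt_skip]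

lemma spin_insert_lo (β : LinkPattern (n + 1)) (j : Fin (2 * n + 1))
    (h : β.pair (lo j) = hi j) (A : Finset (Fin (2 * n))) :
    β.spin (insert (lo j) (skipSet j A)) = (β.removeLink j h).spin A := by
  have h' : β.pair (hi j) = lo j := by rw [← h, β.pair_pair]
  have := lo_ne_hi j
  rw [spin_removeLink_aux β j h (A := A)
    (fun i => by simp [mem_skipSet, skip_ne_lo])]
  have hlt : ¬ hi j < lo j := by simp [Fin.lt_def, lo, hi]
  simp [linkWeight, h, h', hi_notMem_skipSet, this.symm, hlt]

lemma spin_insert_hi (β : LinkPattern (n + 1)) (j : Fin (2 * n + 1))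
    (h : β.pair (lo j) = hi j) (A : Finset (Fin (2 * n))) :
    β.spin (insert (hi j) (skipSet j A)) = -Complex.I * (β.removeLink j h).spin A := by
  have h' : β.pair (hi j) = lo j := by rw [← h, β.pair_pair]
  have := lo_ne_hi j
  rw [spin_removeLink_aux β j h (A := A)
    (fun i => by simp [mem_skipSet, skip_ne_hi])]
  have hlt : lo j < hi j := by simp [Fin.lt_def, lo, hi]
  simp [linkWeight, h, h', lo_notMem_skipSet, this, hlt]

/-- The exchange relation: resolving the points `j, j+1` of a link pattern not containing the link
`{j, j+1}` ties the partners of `j` and `j+1`. -/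
lemma spin_exchange (β : LinkPattern (n + 1)) (j : Fin (2 * n + 1))
    (h : β.pair (lo j) ≠ hi j) (A : Finset (Fin (2 * n))) :
    β.spin (insert (lo j) (skipSet j A)) - Complex.I * β.spin (insert (hi j) (skipSet j A)) =
      -Complex.I * ((β.tie j).removeLink j (β.tie_pair_lo j)).spin A := by
  have hlh := lo_ne_hi j
  have e1 : β.pair (lo j) ≠ lo j := β.pair_ne _
  have e2 : β.pair (hi j) ≠ hi j := β.pair_ne _
  have e3 : β.pair (hi j) ≠ lo j := fun e => h (by rw [← e, β.pair_pair])
  obtain ⟨i₁, h₁⟩ := exists_skip j e1 h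
  obtain ⟨i₂, h₂⟩ := exists_skip j e3 e2
  have hne : i₂ ≠ i₁ := fun e => hlh (β.pair_injective (by rw [h₁, h₂, e]))
  have h₁' : β.pair (skip j i₁) = lo j := by rw [← h₁, β.pair_pair]
  have h₂' : β.pair (skip j i₂) = hi j := by rw [← h₂, β.pair_pair]
  set γ := (β.tie j).removeLink j (β.tie_pair_lo j) with hγ
  have hγp : ∀ i, skip j (γ.pair i) = β.tiePair j (skip j i) := fun i =>
    skip_removeLink_pair (β.tie j) j (β.tie_pair_lo j) i
  have g₁ : γ.pair i₁ = i₂ := by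
    apply skip_injective j
    rw [hγp, tiePair, if_neg (skip_ne_lo j _), if_neg (skip_ne_hi j _), if_pos h₁.symm, h₂]
  have g₂ : γ.pair i₂ = i₁ := by rw [← g₁, γ.pair_pair]
  have gr : ∀ i, i ≠ i₁ → i ≠ i₂ → skip j (γ.pair i) = β.pair (skip j i) := by
    intro i hi1 hi2
    rw [hγp, tiePair, if_neg (skip_ne_lo j _), if_neg (skip_ne_hi j _), if_neg, if_neg]
    · rw [h₂]; exact fun e => hi2 (skip_injective j e)
    · rw [h₁]; exact fun e => hi1 (skip_injective j e)
  have split : ∀ f : Fin (2 * n) → ℂ,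
      ∏ i, f i = f i₁ * (f i₂ * ∏ i ∈ (Finset.univ.erase i₁).erase i₂, f i) := by
    intro f
    rw [Finset.mul_prod_erase _ f (Finset.mem_erase.2 ⟨hne, Finset.mem_univ _⟩),
      Finset.mul_prod_erase _ f (Finset.mem_univ _)]
  have rest : ∀ B : Finset (Fin (2 * (n + 1))), (∀ i, skip j i ∈ B ↔ i ∈ A) →
      ∏ i ∈ (Finset.univ.erase i₁).erase i₂, β.linkWeight B (skip j i) =
        ∏ i ∈ (Finset.univ.erase i₁).erase i₂, γ.linkWeight A i := by
    intro B hB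
    refine Finset.prod_congr rfl fun i hi => ?_
    simp only [Finset.mem_erase, Finset.mem_univ, and_true] at hi
    simp only [linkWeight, ← gr i hi.2 hi.1, hB, skip_lt_skip]
  have m1 : ∀ i, skip j i ∈ insert (lo j) (skipSet j A) ↔ i ∈ A := fun i => by
    simp [mem_skipSet, skip_ne_lo]
  have m2 : ∀ i, skip j i ∈ insert (hi j) (skipSet j A) ↔ i ∈ A := fun i => by
    simp [mem_skipSet, skip_ne_hi]
  rw [spin, spin, spin, prod_lo_hi_skip j, prod_lo_hi_skip j, split, split, split, rest _ m1,
    rest _ m2]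
  set R := ∏ i ∈ (Finset.univ.erase i₁).erase i₂, γ.linkWeight A i
  have nc1 := β.noncrossing (skip j i₂) (lo j)
  have nc2 := β.noncrossing (skip j i₂) (skip j i₁)
  have nc3 := β.noncrossing (skip j i₁) (skip j i₂)
  have nc4 := β.noncrossing (lo j) (hi j)
  have nc5 := β.noncrossing (hi j) (lo j)
  rw [h₁, h₂'] at nc1
  rw [h₁', h₂'] at nc2
  rw [h₁', h₂'] at nc3
  rw [h₁, h₂] at nc4
  have v1 : (lo j : ℕ) = j := rfl
  have v2 : (hi j : ℕ) = j + 1 := rfl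
  have w1 := skip_ne_lo j i₁
  have w2 := skip_ne_hi j i₁
  have w3 := skip_ne_lo j i₂
  have w4 := skip_ne_hi j i₂
  have w5 := skip_lt_skip j i₂ i₁
  have w6 := skip_lt_skip j i₁ i₂
  simp only [linkWeight, h₁, h₂, h₁', h₂', g₁, g₂, m1, m2]
  simp only [Finset.mem_insert, hlh.symm, hlh, hi_notMem_skipSet, lo_notMem_skipSet,
    or_self, or_false, true_and, false_and, if_false, true_iff, false_iff, iff_true, iff_false]
  have order : (skip j i₁ < lo j ∧ ¬ lo j < skip j i₁ ∧ ¬ skip j i₂ < hi j ∧ hi j < skip j i₂ ∧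
        ¬ i₂ < i₁ ∧ i₁ < i₂) ∨
      (skip j i₁ < lo j ∧ ¬ lo j < skip j i₁ ∧ skip j i₂ < hi j ∧ ¬ hi j < skip j i₂ ∧
        i₂ < i₁ ∧ ¬ i₁ < i₂) ∨
      (¬ skip j i₁ < lo j ∧ lo j < skip j i₁ ∧ ¬ skip j i₂ < hi j ∧ hi j < skip j i₂ ∧
        i₂ < i₁ ∧ ¬ i₁ < i₂) := by
    rw [← w5, ← w6]
    simp only [Fin.lt_def, Fin.ext_iff, Ne] at *
    omega
  clear_value R γ
  by_cases k1 : i₁ ∈ A <;> by_cases k2 : i₂ ∈ A <;>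
    rcases order with ⟨o1, o2, o3, o4, o5, o6⟩ | ⟨o1, o2, o3, o4, o5, o6⟩ |
      ⟨o1, o2, o3, o4, o5, o6⟩ <;>
    simp [k1, k2, o1, o2, o3, o4, o5, o6]

end LinkPattern

section Alternating

variable {M : Type*} [AddCommGroup M] [Module ℂ M]

/-- The value of an alternating map at the vectors `V k`, `k ∈ A`, listed in increasing order. -/
def sortedEval {m N : ℕ} (Φ : M [⋀^Fin N]→ₗ[ℂ] ℂ) (V : Fin m → M) (A : Finset (Fin m)) : ℂ :=
  if h : A.card = N then Φ fun r => V (A.orderEmbOfFin h r) else 0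

lemma strictMono_insertNth {α : Type*} [Preorder α] {n : ℕ} {κ : Fin n → α}
    (hκ : StrictMono κ) (t : α)
    (q : Fin (n + 1)) (h₁ : ∀ r : Fin n, r.castSucc < q → κ r < t)
    (h₂ : ∀ r : Fin n, q ≤ r.castSucc → t < κ r) :
    StrictMono (q.insertNth t κ : Fin (n + 1) → α) := by
  intro r s hrs
  induction r using Fin.succAboveCases q with
  | x =>
    induction s using Fin.succAboveCases q with
    | x => exact absurd hrs (lt_irrefl _)
    | p s =>
      rw [Fin.insertNth_apply_same, Fin.insertNth_apply_succAbove]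
      exact h₂ s (Fin.lt_succAbove_iff_le_castSucc q s |>.1 hrs)
  | p r =>
    induction s using Fin.succAboveCases q with
    | x =>
      rw [Fin.insertNth_apply_same, Fin.insertNth_apply_succAbove]
      exact h₁ r (Fin.succAbove_lt_iff_castSucc_lt q r |>.1 hrs)
    | p s =>
      rw [Fin.insertNth_apply_succAbove, Fin.insertNth_apply_succAbove]
      exact hκ (Fin.succAbove_lt_succAbove_iff.1 hrs)

/-- The number of entries of a strictly increasing tuple below a threshold cuts the tuple. -/
lemma exists_cut {n : ℕ} {κ : Fin n → ℕ} (hκ : StrictMono κ) (c : ℕ) :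
    ∃ q : Fin (n + 1), ∀ r : Fin n, r.castSucc < q ↔ κ r < c := by
  induction n with
  | zero => exact ⟨0, fun r => r.elim0⟩
  | succ n ih =>
    by_cases h : κ (Fin.last n) < c
    · refine ⟨Fin.last _, fun r => ⟨fun _ => ?_, fun _ => Fin.castSucc_lt_last r⟩⟩
      have := hκ.monotone (Fin.le_last r)
      omega
    · obtain ⟨q, hq⟩ := ih (hκ.comp Fin.strictMono_castSucc)
      refine ⟨q.castSucc, fun r => ?_⟩
      induction r using Fin.lastCases with
      | last =>
        constructor
        · intro h'
          exact absurd h' (not_lt.2 (Fin.castSucc_le_castSucc_iff.2 (Fin.le_last q)))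
        · intro h'; exact absurd h' h
      | cast r => rw [Fin.castSucc_lt_castSucc_iff]; exact hq r

lemma sortedEval_insert {n : ℕ} (Φ : M [⋀^Fin (n + 1)]→ₗ[ℂ] ℂ) (V : Fin (2 * (n + 1)) → M)
    (j : Fin (2 * n + 1)) {t : Fin (2 * (n + 1))} (ht : t = lo j ∨ t = hi j)
    (A : Finset (Fin (2 * n))) :
    (-Complex.I) ^ (∑ k ∈ insert t (skipSet j A), (k : ℕ)) *
        sortedEval Φ V (insert t (skipSet j A)) =
      (-1) ^ n * (-Complex.I) ^ (t : ℕ) *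
        ((-Complex.I) ^ (∑ k ∈ A, (k : ℕ)) *
          sortedEval (Φ.curryLeft (V t)) (fun i => V (skip j i)) A) := by
  have htn : t ∉ skipSet j A := by
    rcases ht with rfl | rfl
    · exact lo_notMem_skipSet j A
    · exact hi_notMem_skipSet j A
  have hc : (insert t (skipSet j A)).card = A.card + 1 := by
    rw [Finset.card_insert_of_notMem htn, skipSet, Finset.card_map]
  by_cases hA : A.card = n
  swap
  · rw [sortedEval, dif_neg (by omega), sortedEval, dif_neg hA]; simp
  have hA' : (insert t (skipSet j A)).card = n + 1 := by omega
  rw [sortedEval, dif_pos hA', sortedEval, dif_pos hA]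
  set κ := A.orderEmbOfFin hA with hκ
  obtain ⟨q, hq⟩ := exists_cut (κ := fun r => (κ r : ℕ)) (fun r s h => κ.strictMono h) (j : ℕ)
  have ht' : (t : ℕ) = j ∨ (t : ℕ) = j + 1 := by
    rcases ht with rfl | rfl
    · exact Or.inl rfl
    · exact Or.inr rfl
  have hmono : StrictMono (q.insertNth t (fun r => skip j (κ r)) : Fin (n + 1) → _) := by
    refine strictMono_insertNth ((skip_strictMono j).comp κ.strictMono) t q ?_ ?_
    · intro r hr
      have := (hq r).1 hr
      simp only [Function.comp, Fin.lt_def, skip, if_pos this]; omega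
    · intro r hr
      have : ¬ ((κ r : ℕ) < j) := fun h => absurd ((hq r).2 h) (not_lt.2 hr)
      simp only [Function.comp, Fin.lt_def, skip, if_neg this]; omega
  have hs : (q.insertNth t (fun r => skip j (κ r)) : Fin (n + 1) → _) =
      (insert t (skipSet j A)).orderEmbOfFin hA' := by
    refine Finset.orderEmbOfFin_unique hA' (fun r => ?_) hmono
    induction r using Fin.succAboveCases q with
    | x => rw [Fin.insertNth_apply_same]; exact Finset.mem_insert_self _ _
    | p r =>
      rw [Fin.insertNth_apply_succAbove]
      refine Finset.mem_insert_of_mem ((mem_skipSet j A _).2 ?_)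
      exact Finset.orderEmbOfFin_mem A hA r
  have hV : (fun r => V ((insert t (skipSet j A)).orderEmbOfFin hA' r)) =
      (q.insertNth (V t) (fun r => V (skip j (κ r))) : Fin (n + 1) → M) := by
    rw [← hs]
    funext r
    induction r using Fin.succAboveCases q with
    | x => simp
    | p r => simp
  rw [hV, AlternatingMap.map_insertNth]
  have hsum : ∑ k ∈ insert t (skipSet j A), (k : ℕ) =
      t + ∑ k ∈ A, (k : ℕ) + 2 * (A.filter fun k : Fin (2 * n) => ¬ (k : ℕ) < j).card := by
    rw [Finset.sum_insert htn, skipSet, Finset.sum_map, Finset.card_filter, Finset.mul_sum,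
      add_assoc, ← Finset.sum_add_distrib]
    congr 1
    refine Finset.sum_congr rfl fun k _ => ?_
    simp only [Function.Embedding.coeFn_mk, skip]
    split_ifs <;> omega
  have hcard : (A.filter fun k : Fin (2 * n) => ¬ (k : ℕ) < j).card + q = n := by
    have hq' : (A.filter fun k : Fin (2 * n) => (k : ℕ) < j).card = q := by
      have hAm : A = Finset.univ.map κ.toEmbedding := (Finset.map_orderEmbOfFin_univ A hA).symm
      rw [hAm, Finset.filter_map, Finset.card_map]
      have : (Finset.univ.filter ((fun k : Fin (2 * n) => (k : ℕ) < j) ∘ κ.toEmbedding)) =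
          Finset.univ.filter fun r : Fin n => (r : ℕ) < q := by
        ext r
        simp only [Finset.mem_filter, Finset.mem_univ, true_and, Function.comp]
        exact (hq r).symm
      rw [this, Fin.card_filter_val_lt]
      exact min_eq_right (by omega)
    have := Finset.card_filter_add_card_filter_not (s := A)
      (fun k : Fin (2 * n) => (k : ℕ) < j)
    omega
  have hI : (-Complex.I) ^ 2 = (-1 : ℂ) := by simp
  rw [hsum, pow_add, pow_add, pow_mul, hI]
  have hsign : (-1 : ℂ) ^ n = (-1) ^ (A.filter fun k : Fin (2 * n) => ¬ (k : ℕ) < j).card * (-1) ^ (q : ℕ) := by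
    rw [← pow_add, hcard]
  have hcl : Φ.curryLeft (V t) (fun r => V (skip j (κ r))) =
      Φ (Matrix.vecCons (V t) fun r => V (skip j (κ r))) := rfl
  rw [hsign, hcl, zsmul_eq_mul]
  push_cast
  ring

lemma map_eq_curryLeft {n : ℕ} (Φ : M [⋀^Fin (n + 1)]→ₗ[ℂ] ℂ) (v : Fin (n + 1) → M)
    (ρ : Fin (n + 1)) :
    Φ v = (-1) ^ (ρ : ℕ) * Φ.curryLeft (v ρ) fun r => v (ρ.succAbove r) := by
  conv_lhs => rw [← Fin.insertNth_self_removeNth ρ v]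
  rw [AlternatingMap.map_insertNth, zsmul_eq_mul]
  push_cast
  rfl

/-- An alternating map evaluated at the differences along the links of `β`, expanded over choices
of one end of each link. -/
theorem LinkPattern.alternating_expansion : ∀ {N : ℕ} (Φ : M [⋀^Fin N]→ₗ[ℂ] ℂ)
    (V : Fin (2 * N) → M) (β : LinkPattern N),
    (∏ r, (-Complex.I) ^ (β.a r : ℕ)) * Φ (fun r => V (β.b r) - V (β.a r)) =
      (-1) ^ N * ∑ A, β.spin A * ((-Complex.I) ^ (∑ k ∈ A, (k : ℕ)) * sortedEval Φ V A)
  | 0, Φ, V, β => by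
    have : IsEmpty (Fin (2 * 0)) := inferInstanceAs (IsEmpty (Fin 0))
    rw [Fintype.sum_eq_single (∅ : Finset (Fin (2 * 0)))
      (fun A hA => absurd (Finset.eq_empty_of_isEmpty A) hA)]
    have h1 : β.spin ∅ = 1 := by rw [LinkPattern.spin]; exact Fintype.prod_empty _
    rw [h1, sortedEval, dif_pos Finset.card_empty]
    simp only [Finset.univ_eq_empty, Finset.prod_empty, Finset.sum_empty, pow_zero, one_mul]
    congr 1
    exact Subsingleton.elim _ _
  | n + 1, Φ, V, β => by
    obtain ⟨j, hj, h⟩ := β.exists_last_link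
    have hb : β.b (Fin.last n) = hi j := by rw [LinkPattern.b, hj, h]
    rw [map_eq_curryLeft Φ _ (Fin.last n), hb, hj, map_sub, AlternatingMap.sub_apply]
    simp only [β.a_removeLink j h _ hj, β.b_removeLink j h _ hj]
    have hphase : (∏ r, (-Complex.I) ^ (β.a r : ℕ)) =
        (∏ r, (-Complex.I) ^ ((β.removeLink j h).a r : ℕ)) * (-Complex.I) ^ (j : ℕ) := by
      rw [Fin.prod_univ_castSucc, hj]
      congr 1
      refine Finset.prod_congr rfl fun r _ => ?_
      have h1 := β.a_removeLink j h _ hj r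
      rw [Fin.succAbove_last] at h1
      have h2 : β.a r.castSucc < lo j := by rw [← hj]; exact β.a_strictMono (Fin.castSucc_lt_last r)
      rw [h1] at h2 ⊢
      simp only [Fin.lt_def, lo, skip] at h2 ⊢
      split_ifs at h2 ⊢ with h3
      · rfl
      · omega
    have ih : ∀ x : M, _ := fun x => LinkPattern.alternating_expansion (Φ.curryLeft x)
      (fun i => V (skip j i)) (β.removeLink j h)
    have ih1 := ih (V (lo j))
    have ih2 := ih (V (hi j))
    have hlh := LinkPattern.lo_ne_hi j
    have h' : β.pair (hi j) = lo j := by rw [← h, β.pair_pair]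
    rw [sum_finset_lo_hi_skip j]
    have z1 : ∀ A, β.spin (skipSet j A) = 0 := fun A => β.spin_eq_zero (lo j) (by
      simp [h, lo_notMem_skipSet, hi_notMem_skipSet])
    have z2 : ∀ A, β.spin (insert (lo j) (insert (hi j) (skipSet j A))) = 0 := fun A =>
      β.spin_eq_zero (lo j) (by simp [h])
    simp only [z1, z2, zero_mul, zero_add, add_zero, sortedEval_insert Φ V j (Or.inl rfl),
      sortedEval_insert Φ V j (Or.inr rfl), β.spin_insert_lo j h, β.spin_insert_hi j h]
    rw [Finset.sum_add_distrib, hphase]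
    have hlo : ((lo j : Fin _) : ℕ) = j := rfl
    have hhi : ((hi j : Fin _) : ℕ) = j + 1 := rfl
    rw [hlo, hhi]
    have s1 : ∀ x c : ℂ, ∀ f g : Finset (Fin (2 * n)) → ℂ,
        ∑ A, x * f A * (c * g A) = x * c * ∑ A, f A * g A := fun x c f g => by
      rw [Finset.mul_sum]; exact Finset.sum_congr rfl fun _ _ => by ring
    have s2 : ∀ c : ℂ, ∀ f g : Finset (Fin (2 * n)) → ℂ,
        ∑ A, f A * (c * g A) = c * ∑ A, f A * g A := fun c f g => by
      rw [Finset.mul_sum]; exact Finset.sum_congr rfl fun _ _ => by ring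
    rw [s1, s2]
    have hI : Complex.I * Complex.I = -1 := Complex.I_mul_I
    have hn : ((-1 : ℂ) ^ n) * (-1) ^ n = 1 := by rw [← mul_pow]; simp
    simp only [Fin.val_last, pow_succ]
    linear_combination (-1 : ℂ) ^ n * (-Complex.I) ^ (j : ℕ) * (ih2 - ih1) + (-1 : ℂ) ^ n *
      (-1) ^ n * (-Complex.I) ^ (j : ℕ) * (∑ A, (β.removeLink j h).spin A *
        ((-Complex.I) ^ (∑ k ∈ A, (k : ℕ)) *
          sortedEval (Φ.curryLeft (V (hi j))) (fun i => V (skip j i)) A)) * hI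

/-- If the vectors at two neighbouring points that are not linked agree, the alternating map
evaluated along `β` reduces to the pattern where these points are tied and removed. -/
theorem LinkPattern.alternating_tie {n : ℕ} (Φ : M [⋀^Fin (n + 1)]→ₗ[ℂ] ℂ)
    (V : Fin (2 * (n + 1)) → M) (β : LinkPattern (n + 1)) (j : Fin (2 * n + 1))
    (h : β.pair (lo j) ≠ hi j) (hV : V (lo j) = V (hi j))
    (h0 : ∀ κ : Fin (n + 1) → Fin (2 * n), Φ (fun r => V (skip j (κ r))) = 0) :
    (∏ r, (-Complex.I) ^ (β.a r : ℕ)) * Φ (fun r => V (β.b r) - V (β.a r)) =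
      (-1) ^ n * Complex.I * (-Complex.I) ^ (j : ℕ) *
        ((∏ r, (-Complex.I) ^ (((β.tie j).removeLink j (β.tie_pair_lo j)).a r : ℕ)) *
        Φ.curryLeft (V (lo j)) fun r =>
          V (skip j (((β.tie j).removeLink j (β.tie_pair_lo j)).b r)) -
            V (skip j (((β.tie j).removeLink j (β.tie_pair_lo j)).a r))) := by
  rw [LinkPattern.alternating_expansion,
    LinkPattern.alternating_expansion (Φ.curryLeft (V (lo j))) (fun i => V (skip j i)),
    sum_finset_lo_hi_skip j]
  have z1 : ∀ A, sortedEval Φ V (skipSet j A) = 0 := by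
    intro A
    rw [sortedEval]
    split_ifs with hA
    · have : ∀ r, ∃ i, (skipSet j A).orderEmbOfFin hA r = skip j i := by
        intro r
        have hm := Finset.orderEmbOfFin_mem (skipSet j A) hA r
        exact exists_skip j (fun e => lo_notMem_skipSet j A (e ▸ hm))
          (fun e => hi_notMem_skipSet j A (e ▸ hm))
      choose κ hκ using this
      simp only [hκ]
      exact h0 κ
    · rfl
  have z2 : ∀ A, sortedEval Φ V (insert (lo j) (insert (hi j) (skipSet j A))) = 0 := by
    intro A
    rw [sortedEval]
    split_ifs with hA
    · set e := (insert (lo j) (insert (hi j) (skipSet j A))).orderEmbOfFin hA with he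
      have hr : Set.range e = ↑(insert (lo j) (insert (hi j) (skipSet j A))) :=
        Finset.range_orderEmbOfFin _ hA
      have h1 : lo j ∈ Set.range e := by rw [hr]; simp
      have h2 : hi j ∈ Set.range e := by rw [hr]; simp
      obtain ⟨r, hr⟩ := h1
      obtain ⟨s, hs⟩ := h2
      refine Φ.map_eq_zero_of_eq _ (i := r) (j := s) ?_ ?_
      · simp only [hr, hs, hV]
      · rintro rfl; exact LinkPattern.lo_ne_hi j (hr.symm.trans hs)
    · rfl
  simp only [z1, z2, mul_zero, zero_add, add_zero, sortedEval_insert Φ V j (Or.inl rfl),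
    sortedEval_insert Φ V j (Or.inr rfl)]
  rw [← hV, Finset.mul_sum, Finset.mul_sum, Finset.mul_sum]
  refine Finset.sum_congr rfl fun A _ => ?_
  have hx := β.spin_exchange j h A
  have hlo : ((lo j : Fin _) : ℕ) = j := rfl
  have hhi : ((hi j : Fin _) : ℕ) = j + 1 := rfl
  rw [hlo, hhi]
  generalize sortedEval (Φ.curryLeft (V (lo j))) (fun i => V (skip j i)) A = S
  have hn : ((-1 : ℂ) ^ n) * (-1) ^ n = 1 := by rw [← mul_pow]; simp
  simp only [pow_succ]
  linear_combination (-1 : ℂ) ^ n * (-1) ^ n * (-1) * (-Complex.I) ^ (j : ℕ) *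
    (-Complex.I) ^ (∑ k ∈ A, (k : ℕ)) * S * hx

end Alternating

section Positivity

open scoped ComplexOrder

variable {M : Type*} [AddCommGroup M] [Module ℂ M]

lemma curryLeft_update_self {n : ℕ} (Φ : M [⋀^Fin (n + 1)]→ₗ[ℂ] ℂ) (x : M) (w : Fin n → M)
    (r : Fin n) : Φ.curryLeft x (Function.update w r x) = 0 := by
  refine Φ.map_eq_zero_of_eq (Matrix.vecCons x (Function.update w r x)) (i := 0) (j := r.succ)
    ?_ (Fin.succ_ne_zero r).symm
  simp

lemma curryLeft_add_smul {n : ℕ} (Φ : M [⋀^Fin (n + 1)]→ₗ[ℂ] ℂ) (x : M) (w : Fin n → M)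
    (c : Fin n → ℂ) : Φ.curryLeft x (fun r => w r + c r • x) = Φ.curryLeft x w := by
  have key : ∀ s : Finset (Fin n),
      Φ.curryLeft x (fun r => if r ∈ s then w r + c r • x else w r) = Φ.curryLeft x w := by
    intro s
    induction s using Finset.induction_on with
    | empty => simp
    | insert a s ha ih =>
      have : (fun r => if r ∈ insert a s then w r + c r • x else w r) =
          Function.update (fun r => if r ∈ s then w r + c r • x else w r) a (w a + c a • x) := by
        funext r
        by_cases hr : r = a
        · subst hr; simp
        · simp [hr]
      have h2 : Function.update (fun r => if r ∈ s then w r + c r • x else w r) a (w a) =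
          fun r => if r ∈ s then w r + c r • x else w r := by
        rw [Function.update_eq_self_iff]; simp [ha]
      rw [this, AlternatingMap.map_update_add, AlternatingMap.map_update_smul,
        curryLeft_update_self, smul_zero, add_zero, h2, ih]
  simpa using key Finset.univ

/-- The vectors attached to the gaps after removal of the link `{j, j+1}`. -/
def mergeGap (j : ℕ) (e : ℕ → M) (k : ℕ) : M :=
  if k + 1 < j then e k else if k + 1 = j then e k + -e (k + 2) else -e (k + 2)

lemma sum_mergeGap (j : ℕ) (e : ℕ → M) {a : ℕ} (ha : a < j) (b : ℕ) :
    ∃ c : ℂ, ∑ k ∈ Finset.Ico a (if b < j then b else b + 2), Complex.I ^ (k - a) • e k =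
      ∑ k ∈ Finset.Ico a b, Complex.I ^ (k - a) • mergeGap j e k + c • e j := by
  by_cases hb : b < j
  · refine ⟨0, ?_⟩
    rw [if_pos hb, zero_smul, add_zero]
    refine Finset.sum_congr rfl fun k hk => ?_
    rw [Finset.mem_Ico] at hk
    rw [mergeGap, if_pos (by omega)]
  · obtain ⟨i, rfl⟩ : ∃ i, j = i + 1 := ⟨j - 1, by omega⟩
    refine ⟨Complex.I ^ (i + 1 - a), ?_⟩
    rw [if_neg hb, ← Finset.sum_Ico_consecutive _ (show a ≤ i by omega) (show i ≤ b + 2 by omega),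
      ← Finset.sum_Ico_consecutive _ (show a ≤ i by omega) (show i ≤ b by omega),
      Finset.sum_eq_sum_Ico_succ_bot (show i < b + 2 by omega),
      Finset.sum_eq_sum_Ico_succ_bot (show i + 1 < b + 2 by omega),
      Finset.sum_eq_sum_Ico_succ_bot (show i + 1 + 1 < b + 2 by omega),
      Finset.sum_eq_sum_Ico_succ_bot (show i < b by omega)]
    have h1 : ∑ k ∈ Finset.Ico a i, Complex.I ^ (k - a) • mergeGap (i + 1) e k =
        ∑ k ∈ Finset.Ico a i, Complex.I ^ (k - a) • e k := by
      refine Finset.sum_congr rfl fun k hk => ?_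
      rw [Finset.mem_Ico] at hk
      rw [mergeGap, if_pos (by omega)]
    have hI : ∀ k, a ≤ k → Complex.I ^ (k + 2 - a) = -Complex.I ^ (k - a) := by
      intro k hk
      rw [show k + 2 - a = k - a + 2 by omega, pow_add, Complex.I_sq]; ring
    have h2 : ∑ k ∈ Finset.Ico (i + 1 + 1 + 1) (b + 2), Complex.I ^ (k - a) • e k =
        ∑ k ∈ Finset.Ico (i + 1) b, Complex.I ^ (k - a) • mergeGap (i + 1) e k := by
      rw [show i + 1 + 1 + 1 = i + 1 + 2 by omega, ← Finset.sum_Ico_add' _ (i + 1) b 2]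
      refine Finset.sum_congr rfl fun k hk => ?_
      rw [Finset.mem_Ico] at hk
      rw [mergeGap, if_neg (by omega), if_neg (by omega), hI k (by omega), neg_smul, smul_neg]
    rw [h1, h2, mergeGap, if_neg (by omega), if_pos rfl, show i + 1 + 1 = i + 2 by omega,
      hI i (by omega), neg_smul, smul_add, smul_neg]
    abel

lemma curryLeft_threshold_pos {n : ℕ} (Φ : M [⋀^Fin (n + 1)]→ₗ[ℂ] ℂ) (e : ℕ → M)
    (h : ∀ κ : Fin (n + 1) → ℕ, StrictMono κ → (∀ r, κ r < 2 * (n + 1) - 1) →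
      0 < Φ fun r => e (κ r)) {j c : ℕ} (hj : j < 2 * n + 1) (hc : c ≤ j) (hc' : j ≤ c + 1)
    {κ : Fin n → ℕ} (hκ : StrictMono κ) (hκn : ∀ r, κ r < 2 * n - 1) :
    0 < (-1) ^ n * Φ.curryLeft (e j) fun r => if κ r < c then e (κ r) else -e (κ r + 2) := by
  obtain ⟨q, hq⟩ := exists_cut hκ c
  set κ' : Fin n → ℕ := fun r => if κ r < c then κ r else κ r + 2 with hκ'
  have hmono : StrictMono κ' := by
    intro r s hrs
    have := hκ hrs
    simp only [hκ']
    split_ifs <;> omega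
  have hins : StrictMono (q.insertNth j κ' : Fin (n + 1) → ℕ) := by
    refine strictMono_insertNth hmono j q ?_ ?_
    · intro r hr
      have := (hq r).1 hr
      simp only [hκ', if_pos this]; omega
    · intro r hr
      have : ¬ (κ r < c) := fun h => absurd ((hq r).2 h) (not_lt.2 hr)
      simp only [hκ', if_neg this]; omega
  have hpos := h _ hins (by
    intro r
    induction r using Fin.succAboveCases q with
    | x => rw [Fin.insertNth_apply_same]; omega
    | p r =>
      rw [Fin.insertNth_apply_succAbove]
      have := hκn r
      simp only [hκ']
      split_ifs <;> omega)
  have h1 : (fun r => e ((q.insertNth j κ' : Fin (n + 1) → ℕ) r)) =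
      (q.insertNth (e j) fun r => e (κ' r) : Fin (n + 1) → M) := by
    funext r
    induction r using Fin.succAboveCases q with
    | x => simp
    | p r => simp
  have h2 : (fun r => if κ r < c then e (κ r) else -e (κ r + 2)) =
      fun r => (if κ r < c then (1 : ℂ) else -1) • e (κ' r) := by
    funext r
    simp only [hκ']
    split_ifs <;> simp
  have h3 : ∏ r, (if κ r < c then (1 : ℂ) else -1) = (-1) ^ (n - q) := by
    rw [Finset.prod_ite, Finset.prod_const_one, one_mul, Finset.prod_const]
    congr 1
    have e1 := Finset.card_filter_add_card_filter_not (s := (Finset.univ : Finset (Fin n)))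
      (fun r => κ r < c)
    have e2 : (Finset.univ.filter fun r => κ r < c) =
        Finset.univ.filter fun r : Fin n => (r : ℕ) < q := by
      ext r
      simp only [Finset.mem_filter, Finset.mem_univ, true_and]
      exact (hq r).symm
    rw [e2, Fin.card_filter_val_lt, Finset.card_univ, Fintype.card_fin] at e1
    have := min_eq_right (show (q : ℕ) ≤ n by omega)
    omega
  rw [h1, AlternatingMap.map_insertNth, zsmul_eq_mul] at hpos
  rw [h2, AlternatingMap.map_smul_univ, h3, smul_eq_mul]
  have h4 : (-1 : ℂ) ^ n * (-1) ^ (n - (q : ℕ)) = (-1) ^ (q : ℕ) := by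
    have hqn : (q : ℕ) ≤ n := q.is_le
    rw [← pow_add, show n + (n - (q : ℕ)) = 2 * (n - q) + q by omega, pow_add, pow_mul]
    simp
  rw [← mul_assoc, h4]
  push_cast at hpos
  exact hpos

/-- If an alternating map is positive on increasing tuples of the vectors `e k`, then it is
positive on the rows `∑ i^{k - a_r} e k`, the sum running over the gaps under the link `r`. -/
theorem LinkPattern.alternating_pos : ∀ {N : ℕ} (Φ : M [⋀^Fin N]→ₗ[ℂ] ℂ) (e : ℕ → M)
    (_ : ∀ κ : Fin N → ℕ, StrictMono κ → (∀ r, κ r < 2 * N - 1) → 0 < Φ fun r => e (κ r))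
    (β : LinkPattern N),
    0 < Φ fun r => ∑ k ∈ Finset.Ico (β.a r : ℕ) (β.b r), Complex.I ^ (k - (β.a r : ℕ)) • e k
  | 0, Φ, e, h, β => by
    have := h (fun r => r.elim0) (fun r => r.elim0) (fun r => r.elim0)
    rwa [Subsingleton.elim (fun r => ∑ k ∈ Finset.Ico (β.a r : ℕ) (β.b r),
      Complex.I ^ (k - (β.a r : ℕ)) • e k) fun r : Fin 0 => e (r.elim0)]
  | n + 1, Φ, e, h, β => by
    obtain ⟨j, hj, hl⟩ := β.exists_last_link
    have hb : β.b (Fin.last n) = hi j := by rw [LinkPattern.b, hj, hl]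
    rw [map_eq_curryLeft Φ _ (Fin.last n)]
    have hlast : ∑ k ∈ Finset.Ico (β.a (Fin.last n) : ℕ) (β.b (Fin.last n)),
        Complex.I ^ (k - (β.a (Fin.last n) : ℕ)) • e k = e j := by
      rw [hb, hj]; simp [lo, hi]
    set β' := β.removeLink j hl with hβ'
    have hrow : ∀ r : Fin n, ∃ c : ℂ,
        ∑ k ∈ Finset.Ico (β.a ((Fin.last n).succAbove r) : ℕ) (β.b ((Fin.last n).succAbove r)),
          Complex.I ^ (k - (β.a ((Fin.last n).succAbove r) : ℕ)) • e k =
        ∑ k ∈ Finset.Ico (β'.a r : ℕ) (β'.b r),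
          Complex.I ^ (k - (β'.a r : ℕ)) • mergeGap j e k + c • e j := by
      intro r
      have h1 := β.a_removeLink j hl _ hj r
      have h2 : β.a ((Fin.last n).succAbove r) < lo j := by
        rw [← hj, Fin.succAbove_last]; exact β.a_strictMono (Fin.castSucc_lt_last r)
      have ha : (β'.a r : ℕ) < j := by
        rw [h1] at h2
        simp only [Fin.lt_def, lo, skip] at h2
        split_ifs at h2 with h3
        · exact h3
        · omega
      obtain ⟨c, hc⟩ := sum_mergeGap (j : ℕ) e ha (β'.b r)
      refine ⟨c, ?_⟩
      rw [← hc, h1, β.b_removeLink j hl _ hj r]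
      simp only [skip, ← hβ', if_pos ha]
    choose c hc using hrow
    rw [hlast]
    simp only [hc]
    rw [curryLeft_add_smul, Fin.val_last]
    have hsm : ∀ w, (-1) ^ n * Φ.curryLeft (e j) w = ((-1 : ℂ) ^ n • Φ.curryLeft (e j)) w :=
      fun w => rfl
    rw [hsm]
    refine LinkPattern.alternating_pos _ (mergeGap j e) (fun κ hκ hκn => ?_) β'
    rw [← hsm]
    by_cases hex : ∃ r, κ r + 1 = j
    · obtain ⟨r, hr⟩ := hex
      have hw : ∀ c, c ≤ (j : ℕ) → (j : ℕ) ≤ c + 1 →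
          (fun s => if κ s < c then e (κ s) else -e (κ s + 2)) =
          Function.update (fun s => mergeGap j e (κ s)) r
            (if κ r < c then e (κ r) else -e (κ r + 2)) := by
        intro c hc1 hc2
        funext s
        by_cases hs : s = r
        · subst hs; simp
        · rw [Function.update_of_ne hs, mergeGap]
          have : κ s ≠ κ r := fun e => hs (hκ.injective e)
          split_ifs <;> first | rfl | omega
      have hself : (fun s => mergeGap j e (κ s)) =
          Function.update (fun s => mergeGap j e (κ s)) r (e (κ r) + -e (κ r + 2)) := by
        symm
        rw [Function.update_eq_self_iff, mergeGap, if_neg (by omega), if_pos hr]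
      have p1 := curryLeft_threshold_pos Φ e h j.isLt (c := j) le_rfl (by omega) hκ hκn
      have p2 := curryLeft_threshold_pos Φ e h j.isLt (c := κ r) (by omega) (by omega) hκ hκn
      rw [hw _ le_rfl (by omega), if_pos (by omega)] at p1
      rw [hw _ (by omega) (by omega), if_neg (by omega)] at p2
      rw [hself, AlternatingMap.map_update_add, mul_add]
      exact add_pos p1 p2
    · have p1 := curryLeft_threshold_pos Φ e h j.isLt (c := j) le_rfl (by omega) hκ hκn
      have hw : (fun s => if κ s < (j : ℕ) then e (κ s) else -e (κ s + 2)) =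
          fun s => mergeGap j e (κ s) := by
        funext s
        have : κ s + 1 ≠ j := fun h => hex ⟨s, h⟩
        rw [mergeGap]
        split_ifs <;> first | rfl | omega
      rwa [hw] at p1

end Positivity

section Independence

namespace LinkPattern

variable {N n : ℕ}

lemma pair_ext_injective : Function.Injective (LinkPattern.pair : LinkPattern N → _) :=
  fun _ _ h => LinkPattern.ext h

instance : Finite (LinkPattern N) := Finite.of_injective _ pair_ext_injective

instance : Fintype (LinkPattern N) := Fintype.ofFinite _

/-- A link pattern is determined by its left ends. -/
lemma eq_of_a_eq : ∀ {N : ℕ} (β β' : LinkPattern N), β.a = β'.a → β = β'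
  | 0, β, β', _ => by
    ext i; exact absurd i.isLt (by omega)
  | n + 1, β, β', h => by
    obtain ⟨j, hj, hl⟩ := β.exists_last_link
    obtain ⟨j', hj', hl'⟩ := β'.exists_last_link
    have hjj : j = j' := by
      rw [h, hj'] at hj
      simp only [lo, Fin.mk.injEq] at hj
      exact Fin.ext hj.symm
    subst hjj
    have ih := eq_of_a_eq (β.removeLink j hl) (β'.removeLink j hl') (by
      funext r
      apply skip_injective j
      rw [← β.a_removeLink j hl _ hj, ← β'.a_removeLink j hl' _ hj', h])
    ext1
    funext k
    by_cases h1 : k = lo j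
    · rw [h1, hl, hl']
    by_cases h2 : k = hi j
    · rw [h2, β.pair_eq_iff.2 hl.symm, β'.pair_eq_iff.2 hl'.symm]
    obtain ⟨i, rfl⟩ := exists_skip j h1 h2
    rw [← skip_removeLink_pair β j hl, ← skip_removeLink_pair β' j hl', ih]

lemma mem_leftEnds_a (β : LinkPattern N) (r : Fin N) : β.a r ∈ β.leftEnds :=
  Finset.orderEmbOfFin_mem _ _ r

lemma spin_leftEnds (β : LinkPattern N) : β.spin β.leftEnds = 1 := by
  refine Finset.prod_eq_one fun k _ => ?_
  have := β.pair_ne k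
  simp only [linkWeight, leftEnds, Finset.mem_filter, Finset.mem_univ, true_and, β.pair_pair]
  rw [if_neg, if_neg]
  · exact fun h => lt_asymm h.1 h.2
  · intro h
    rcases lt_or_gt_of_ne this with h1 | h1
    · exact lt_asymm (h.2 h1) h1
    · exact lt_asymm (h.1 h1) h1

lemma mem_iff_of_spin_ne_zero {β : LinkPattern N} {A : Finset (Fin (2 * N))} (h : β.spin A ≠ 0)
    (k : Fin (2 * N)) : k ∈ A ↔ β.pair k ∉ A := by
  by_contra hc
  exact h (β.spin_eq_zero k (by tauto))

lemma sum_mem_eq (β : LinkPattern N) (A : Finset (Fin (2 * N))) (f : Fin (2 * N) → ℕ) :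
    ∑ k ∈ A, f k = ∑ r, ((if β.a r ∈ A then f (β.a r) else 0) +
      if β.b r ∈ A then f (β.b r) else 0) := by
  rw [← β.sum_eq_sum_links fun k => if k ∈ A then f k else 0, ← Finset.sum_filter]
  congr 1
  ext k; simp

lemma card_of_spin_ne_zero {β : LinkPattern N} {A : Finset (Fin (2 * N))} (h : β.spin A ≠ 0) :
    A.card = N := by
  rw [Finset.card_eq_sum_ones, β.sum_mem_eq A]
  have : ∀ r, ((if β.a r ∈ A then 1 else 0) + if β.b r ∈ A then 1 else 0) = 1 := by
    intro r
    have := mem_iff_of_spin_ne_zero h (β.a r)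
    change _ ↔ β.b r ∉ A at this
    by_cases h1 : β.a r ∈ A <;> by_cases h2 : β.b r ∈ A <;> simp_all
  simp [this]

lemma sum_leftEnds (β : LinkPattern N) :
    ∑ k ∈ β.leftEnds, (k : ℕ) = ∑ r, (β.a r : ℕ) := by
  rw [β.sum_mem_eq]
  refine Finset.sum_congr rfl fun r _ => ?_
  have h2 := mem_iff_of_spin_ne_zero (β := β) (A := β.leftEnds) (by rw [spin_leftEnds]; simp)
    (β.a r)
  change _ ↔ β.b r ∉ _ at h2
  have h1 := β.mem_leftEnds_a r
  rw [if_pos h1, if_neg (h2.1 h1), add_zero]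

lemma sum_leftEnds_le {β : LinkPattern N} {A : Finset (Fin (2 * N))} (h : β.spin A ≠ 0) :
    ∑ k ∈ β.leftEnds, (k : ℕ) ≤ ∑ k ∈ A, (k : ℕ) ∧
      (∑ k ∈ A, (k : ℕ) ≤ ∑ k ∈ β.leftEnds, (k : ℕ) → A = β.leftEnds) := by
  have key : ∀ r, (β.a r : ℕ) ≤ ((if β.a r ∈ A then (β.a r : ℕ) else 0) +
      if β.b r ∈ A then (β.b r : ℕ) else 0) ∧
      (β.a r ∉ A → (β.a r : ℕ) < ((if β.a r ∈ A then (β.a r : ℕ) else 0) +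
      if β.b r ∈ A then (β.b r : ℕ) else 0)) := by
    intro r
    have h1 := mem_iff_of_spin_ne_zero h (β.a r)
    change _ ↔ β.b r ∉ A at h1
    have h2 : (β.a r : ℕ) < β.b r := β.a_lt_b r
    by_cases h3 : β.a r ∈ A
    · simp [h3]
    · have h4 : β.b r ∈ A := by tauto
      simp only [h3, h4, if_true, if_false]
      omega
  rw [β.sum_mem_eq A, sum_leftEnds]
  refine ⟨Finset.sum_le_sum fun r _ => (key r).1, fun hle => ?_⟩
  have hmem : ∀ r, β.a r ∈ A := by
    intro r
    by_contra hr
    exact absurd hle (not_le.2 (Finset.sum_lt_sum (fun r _ => (key r).1)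
      ⟨r, Finset.mem_univ _, (key r).2 hr⟩))
  symm
  apply Finset.eq_of_subset_of_card_le
  · intro k hk
    simp only [leftEnds, Finset.mem_filter, Finset.mem_univ, true_and] at hk
    obtain ⟨r, rfl⟩ := β.exists_a_eq hk
    exact hmem r
  · rw [card_of_spin_ne_zero h, β.card_leftEnds]

/-- The spin chain states of the link patterns are linearly independent. -/
theorem spin_independent (c : LinkPattern N → ℂ) (h : ∀ A, ∑ β, c β * β.spin A = 0) : c = 0 := by
  by_contra hc
  obtain ⟨β₀, hβ₀⟩ := Function.ne_iff.1 hc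
  obtain ⟨β, hβ, hmin⟩ := Finset.exists_min_image (Finset.univ.filter fun β => c β ≠ 0)
    (fun β : LinkPattern N => ∑ k ∈ β.leftEnds, (k : ℕ)) ⟨β₀, by simpa using hβ₀⟩
  simp only [Finset.mem_filter, Finset.mem_univ, true_and] at hβ hmin
  have := h β.leftEnds
  rw [Finset.sum_eq_single β, spin_leftEnds, mul_one] at this
  · exact hβ this
  · intro β' _ hne
    by_contra h0
    have hc' : c β' ≠ 0 := left_ne_zero_of_mul h0
    have hs : β'.spin β.leftEnds ≠ 0 := right_ne_zero_of_mul h0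
    have e := (sum_leftEnds_le hs).2 (hmin β' hc')
    apply hne
    apply eq_of_a_eq
    funext r
    simp only [a, e]
  · intro h; exact absurd (Finset.mem_univ _) h

/-- A state antisymmetric under all exchanges of neighbours is a multiple of `A ↦ (-i)^{∑ A}`. -/
lemma exists_eq_pow_of_exchange {v : Finset (Fin (2 * (n + 1))) → ℂ}
    (h : ∀ j A, v (insert (lo j) (skipSet j A)) = Complex.I * v (insert (hi j) (skipSet j A))) :
    ∃ μ : ℂ, ∀ A, A.card = n + 1 → v A = μ * (-Complex.I) ^ (∑ k ∈ A, (k : ℕ)) := by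
  set A₀ : Finset (Fin (2 * (n + 1))) := Finset.univ.filter fun k => (k : ℕ) < n + 1 with hA₀
  have hI0 : (-Complex.I) ≠ 0 := by simp
  refine ⟨v A₀ / (-Complex.I) ^ (∑ k ∈ A₀, (k : ℕ)), fun A => ?_⟩
  induction hs : ∑ k ∈ A, (k : ℕ) using Nat.strong_induction_on generalizing A with
  | _ s ih =>
    intro hA
    by_cases hex : ∃ j : Fin (2 * n + 1), hi j ∈ A ∧ lo j ∉ A
    · obtain ⟨j, hhi, hlo⟩ := hex
      obtain ⟨B, hB⟩ : ∃ B, A = insert (hi j) (skipSet j B) := by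
        refine ⟨Finset.univ.filter fun i => skip j i ∈ A, ?_⟩
        ext k
        by_cases h1 : k = lo j
        · subst h1
          simp [hlo, lo_notMem_skipSet, lo_ne_hi]
        by_cases h2 : k = hi j
        · subst h2; simp [hhi]
        obtain ⟨i, rfl⟩ := exists_skip j h1 h2
        simp [mem_skipSet, skip_ne_hi]
      have c1 : (insert (lo j) (skipSet j B)).card = n + 1 := by
        refine Eq.trans ?_ hA
        rw [hB, Finset.card_insert_of_notMem (lo_notMem_skipSet j B),
          Finset.card_insert_of_notMem (hi_notMem_skipSet j B)]
      have s1 : ∑ k ∈ A, (k : ℕ) = ∑ k ∈ insert (lo j) (skipSet j B), (k : ℕ) + 1 := by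
        rw [hB, Finset.sum_insert (lo_notMem_skipSet j B),
          Finset.sum_insert (hi_notMem_skipSet j B)]
        simp only [lo, hi]; ring
      have e := ih _ (by omega) _ rfl c1
      rw [h j B, ← hB] at e
      have : v A = -Complex.I * (Complex.I * v A) := by
        rw [← mul_assoc]; simp
      rw [this, e, ← hs, s1, pow_succ]; ring
    · have hlow : ∀ m, ∀ i k : Fin (2 * (n + 1)), (k : ℕ) = i + m → k ∈ A → i ∈ A := by
        intro m
        induction m with
        | zero => intro i k e hk; rwa [show i = k from Fin.ext (by omega)]
        | succ m ihm =>
          intro i k e hk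
          have hk' : (k : ℕ) - 1 < 2 * n + 1 := by omega
          by_contra hi'
          have e2 : hi (⟨k - 1, hk'⟩ : Fin (2 * n + 1)) = k := by
            apply Fin.ext; simp only [hi]; omega
          refine hex ⟨⟨k - 1, hk'⟩, by rwa [e2], fun hl => hi' (ihm i _ ?_ hl)⟩
          simp only [lo]; omega
      have : A = A₀ := by
        have hsub : A ⊆ A₀ := by
          intro k hk
          simp only [hA₀, Finset.mem_filter, Finset.mem_univ, true_and]
          have : (Finset.univ.filter fun i : Fin (2 * (n + 1)) => (i : ℕ) < k + 1) ⊆ A := by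
            intro i hi
            simp only [Finset.mem_filter, Finset.mem_univ, true_and] at hi
            exact hlow (k - i) i k (by omega) hk
          have hcard := Finset.card_le_card this
          rw [Fin.card_filter_val_lt, hA] at hcard
          have := k.isLt
          omega
        apply Finset.eq_of_subset_of_card_le hsub
        rw [hA, hA₀, Fin.card_filter_val_lt]
        omega
      rw [← hs, this, div_mul_cancel₀ _ (pow_ne_zero _ hI0)]

/-- For at least two links, no nonzero combination of the states of the link patterns is
antisymmetric under all exchanges of neighbours. -/
theorem eq_zero_of_exchange (hn : 0 < n) (c : LinkPattern (n + 1) → ℂ)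
    (h : ∀ j A, ∑ β, c β * β.spin (insert (lo j) (skipSet j A)) =
      Complex.I * ∑ β, c β * β.spin (insert (hi j) (skipSet j A))) : c = 0 := by
  apply spin_independent
  obtain ⟨μ, hμ⟩ := exists_eq_pow_of_exchange (v := fun A => ∑ β, c β * β.spin A) h
  set B : Finset (Fin (2 * (n + 1))) := Finset.univ.filter fun k => (k : ℕ) < n - 1 with hB
  set K : Finset (Fin (2 * (n + 1))) := Finset.univ.filter fun k => ¬ (k : ℕ) < n - 1 with hK
  have hBc : B.card = n - 1 := by rw [hB, Fin.card_filter_val_lt]; omega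
  have hKc : K.card = n + 3 := by
    have := Finset.card_filter_add_card_filter_not
      (s := (Finset.univ : Finset (Fin (2 * (n + 1))))) (fun k => (k : ℕ) < n - 1)
    rw [Finset.card_univ, Fintype.card_fin, ← hB, ← hK] at this
    omega
  have hKB : ∀ k ∈ K, k ∉ B := fun k hk hk' => by
    simp only [hB, hK, Finset.mem_filter] at hk hk'
    exact hk.2 hk'.2
  let f : (Finset (Fin (2 * (n + 1))) → ℂ) → ℂ := fun w =>
    ∑ k ∈ K, ∑ l ∈ K, if k = l then 0 else
      (-Complex.I) ^ (k : ℕ) * ((-Complex.I) ^ (l : ℕ) * w (insert k (insert l B)))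
  have hf0 : ∀ β : LinkPattern (n + 1), f β.spin = 0 := by
    intro β
    obtain ⟨j, hj, hl⟩ := β.exists_last_link
    have hl' : β.pair (hi j) = lo j := by rw [← hl, β.pair_pair]
    have hjn : n ≤ (j : ℕ) := by
      have : ∀ r : Fin (n + 1), (r : ℕ) ≤ β.a r := fun r => by
        have h1 := StrictMono.le_apply (f := fun m : ℕ => if hm : m < n + 1 then
          (β.a ⟨m, hm⟩ : ℕ) else 2 * (n + 1) + m) (x := (r : ℕ)) (by
            intro x y hxy
            simp only
            split_ifs with h1 h2 h2
            · exact β.a_strictMono (Fin.mk_lt_mk.2 hxy)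
            · have := (β.a ⟨x, h1⟩).isLt; omega
            · omega
            · omega)
        rwa [dif_pos r.isLt] at h1
      have h2 := this (Fin.last n)
      rw [hj] at h2
      simpa [lo] using h2
    have hloB : lo j ∉ B := by simp [hB, lo]; omega
    have hhiB : hi j ∉ B := by simp [hB, hi]; omega
    have hloK : lo j ∈ K := by simp [hK, lo]; omega
    have hhiK : hi j ∈ K := by simp [hK, hi]; omega
    have hne := lo_ne_hi j
    have hiff : ∀ S, lo j ∉ S → hi j ∉ S → β.spin S = 0 := fun S h1 h2 =>
      β.spin_eq_zero (lo j) (by rw [hl]; simp [h1, h2])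
    have hiff' : ∀ S, lo j ∈ S → hi j ∈ S → β.spin S = 0 := fun S h1 h2 =>
      β.spin_eq_zero (lo j) (by rw [hl]; simp [h1, h2])
    have hswap : ∀ S, lo j ∉ S → hi j ∉ S →
        β.spin (insert (hi j) S) = -Complex.I * β.spin (insert (lo j) S) := by
      intro S h1 h2
      have : S = skipSet j (Finset.univ.filter fun i => skip j i ∈ S) := by
        ext k
        by_cases e1 : k = lo j
        · subst e1; simp [h1, lo_notMem_skipSet]
        by_cases e2 : k = hi j
        · subst e2; simp [h2, hi_notMem_skipSet]
        obtain ⟨i, rfl⟩ := exists_skip j e1 e2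
        simp [mem_skipSet]
      rw [this, spin_insert_hi β j hl, spin_insert_lo β j hl]
    set K' := (K.erase (lo j)).erase (hi j) with hK'
    have hsplit : ∀ g : Fin (2 * (n + 1)) → ℂ,
        ∑ k ∈ K, g k = g (lo j) + (g (hi j) + ∑ k ∈ K', g k) := by
      intro g
      rw [Finset.add_sum_erase _ g (Finset.mem_erase.2 ⟨hne.symm, hhiK⟩),
        Finset.add_sum_erase _ g hloK]
    have hmem : ∀ k ∈ K', k ≠ lo j ∧ k ≠ hi j := fun k hk => by
      simp only [hK', Finset.mem_erase] at hk
      exact ⟨hk.2.1, hk.1⟩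
    have hpow : (-Complex.I) ^ ((hi j : Fin _) : ℕ) =
        -Complex.I * (-Complex.I) ^ ((lo j : Fin _) : ℕ) := by
      simp only [lo, hi, pow_succ]; ring
    have hcancel : ∀ k ∈ K', (-Complex.I) ^ ((hi j : Fin _) : ℕ) *
        ((-Complex.I) ^ (k : ℕ) * β.spin (insert (hi j) (insert k B))) =
        - ((-Complex.I) ^ ((lo j : Fin _) : ℕ) *
        ((-Complex.I) ^ (k : ℕ) * β.spin (insert (lo j) (insert k B)))) := by
      intro k hk
      obtain ⟨k1, k2⟩ := hmem k hk
      rw [hswap _ (by simp [k1.symm, hloB]) (by simp [k2.symm, hhiB]), hpow]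
      linear_combination (-Complex.I) ^ ((lo j : Fin _) : ℕ) *
        (-Complex.I) ^ (k : ℕ) * β.spin (insert (lo j) (insert k B)) * Complex.I_mul_I
    simp only [f]
    rw [hsplit, hsplit, hsplit (fun l => if hi j = l then _ else _)]
    have t1 : ∀ k ∈ K', ∑ l ∈ K, (if k = l then 0 else (-Complex.I) ^ (k : ℕ) *
        ((-Complex.I) ^ (l : ℕ) * β.spin (insert k (insert l B)))) = 0 := by
      intro k hk
      obtain ⟨k1, k2⟩ := hmem k hk
      rw [hsplit, if_neg k1, if_neg k2, Finset.insert_comm k, Finset.insert_comm k,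
        mul_left_comm, mul_left_comm ((-Complex.I) ^ (k : ℕ)), hcancel k hk,
        Finset.sum_eq_zero, add_zero, add_neg_cancel]
      intro l hl
      obtain ⟨l1, l2⟩ := hmem l hl
      split_ifs
      · rfl
      · rw [hiff, mul_zero, mul_zero]
        · simp [k1.symm, l1.symm, hloB]
        · simp [k2.symm, l2.symm, hhiB]
    rw [Finset.sum_eq_zero t1, if_pos rfl, if_pos rfl, if_neg hne, if_neg hne.symm,
      hiff' _ (by simp) (by simp), hiff' _ (by simp) (by simp)]
    simp only [mul_zero, zero_add, add_zero]
    rw [← Finset.sum_add_distrib]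
    refine Finset.sum_eq_zero fun k hk => ?_
    obtain ⟨k1, k2⟩ := hmem k hk
    rw [if_neg k1.symm, if_neg k2.symm, hcancel k hk, add_neg_cancel]
  have hfv : f (fun A => ∑ β, c β * β.spin A) = 0 := by
    have : f (fun A => ∑ β, c β * β.spin A) = ∑ β, c β * f β.spin := by
      simp only [f, Finset.mul_sum]
      rw [Finset.sum_comm]
      conv_rhs => rw [Finset.sum_comm]
      rw [Finset.sum_comm]
      refine Finset.sum_congr rfl fun k _ => ?_
      conv_rhs => rw [Finset.sum_comm]
      refine Finset.sum_congr rfl fun l _ => ?_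
      split_ifs
      · simp
      · exact Finset.sum_congr rfl fun _ _ => by ring
    rw [this]
    simp [hf0]
  have hcardkl : ∀ k ∈ K, ∀ l ∈ K, k ≠ l → (insert k (insert l B)).card = n + 1 := by
    intro k hk l hl hkl
    rw [Finset.card_insert_of_notMem (by simp [hkl, hKB k hk]),
      Finset.card_insert_of_notMem (hKB l hl), hBc]
    omega
  have hval : f (fun A => ∑ β, c β * β.spin A) = μ * (-Complex.I) ^ (∑ k ∈ B, (k : ℕ)) *
      ((∑ k ∈ K, (-1 : ℂ) ^ (k : ℕ)) * (∑ k ∈ K, (-1 : ℂ) ^ (k : ℕ)) - K.card) := by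
    have hterm : ∀ k ∈ K, ∀ l ∈ K, (if k = l then 0 else
        (-Complex.I) ^ (k : ℕ) * ((-Complex.I) ^ (l : ℕ) *
          ∑ β, c β * β.spin (insert k (insert l B)))) =
        μ * (-Complex.I) ^ (∑ k ∈ B, (k : ℕ)) *
          ((-1 : ℂ) ^ (k : ℕ) * (-1 : ℂ) ^ (l : ℕ) - if k = l then 1 else 0) := by
      intro k hk l hl
      split_ifs with hkl
      · subst hkl; rw [← mul_pow]; simp
      · have := hμ _ (hcardkl k hk l hl hkl)
        rw [this, Finset.sum_insert (by simp [hkl, hKB k hk]), Finset.sum_insert (hKB l hl)]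
        have hsq : ∀ m : ℕ, (-Complex.I) ^ m * (-Complex.I) ^ m = (-1) ^ m := fun m => by
          rw [← mul_pow]; simp
        rw [← hsq, ← hsq, pow_add, pow_add]; ring
    have : f (fun A => ∑ β, c β * β.spin A) = ∑ k ∈ K, ∑ l ∈ K,
        μ * (-Complex.I) ^ (∑ k ∈ B, (k : ℕ)) *
          ((-1 : ℂ) ^ (k : ℕ) * (-1 : ℂ) ^ (l : ℕ) - if k = l then 1 else 0) :=
      Finset.sum_congr rfl fun k hk => Finset.sum_congr rfl fun l hl => hterm k hk l hl
    rw [this]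
    simp only [← Finset.mul_sum, Finset.sum_sub_distrib, Finset.sum_ite_eq]
    rw [Finset.sum_mul, ← Finset.sum_filter]
    simp [Finset.mul_sum]
  have hne : (∑ k ∈ K, (-1 : ℂ) ^ (k : ℕ)) * (∑ k ∈ K, (-1 : ℂ) ^ (k : ℕ)) - K.card ≠ 0 := by
    have e1 : ∑ k ∈ B, (-1 : ℂ) ^ (k : ℕ) = if Even (n - 1) then 0 else 1 := by
      rw [hB, Finset.sum_filter,
        Fin.sum_univ_eq_sum_range (fun k => if k < n - 1 then (-1 : ℂ) ^ k else 0),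
        ← Finset.sum_filter, ← neg_one_geom_sum]
      congr 1
      ext k; simp only [Finset.mem_filter, Finset.mem_range]; omega
    have e2 := Finset.sum_filter_add_sum_filter_not
      (Finset.univ : Finset (Fin (2 * (n + 1)))) (fun k => (k : ℕ) < n - 1)
      (fun k => (-1 : ℂ) ^ (k : ℕ))
    rw [← hB, ← hK, Fin.sum_univ_eq_sum_range (fun k => (-1 : ℂ) ^ k), neg_one_geom_sum,
      if_pos (even_two_mul _), e1] at e2
    rw [hKc]
    split_ifs at e2 with h1
    · rw [show ∑ k ∈ K, (-1 : ℂ) ^ (k : ℕ) = 0 by linear_combination e2]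
      simp only [mul_zero, zero_sub, neg_ne_zero, Nat.cast_ne_zero]; omega
    · rw [show ∑ k ∈ K, (-1 : ℂ) ^ (k : ℕ) = -1 by linear_combination e2]
      have : ((n + 2 : ℕ) : ℂ) ≠ 0 := Nat.cast_ne_zero.2 (by omega)
      intro h
      apply this
      push_cast at h ⊢
      linear_combination -h
  have hμ0 : μ = 0 := by
    rw [hval] at hfv
    rcases mul_eq_zero.1 hfv with h1 | h1
    · rcases mul_eq_zero.1 h1 with h2 | h2
      · exact h2
      · exact absurd h2 (pow_ne_zero _ (by simp))
    · exact absurd h1 hne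
  intro A
  by_cases hA : A.card = n + 1
  · have := hμ A hA
    rw [this, hμ0, zero_mul]
  · refine Finset.sum_eq_zero fun β _ => ?_
    by_contra h0
    exact hA (card_of_spin_ne_zero (right_ne_zero_of_mul h0))

end LinkPattern

end Independence

/-- The weight `∏_k (u - x_k)^{-1/2}` on the real line, approached from the upper half-plane. -/
def weight {m : ℕ} (x : Fin m → ℝ) (u : ℝ) : ℂ := ∏ i, ((u : ℂ) - (x i : ℂ)) ^ (-1 / 2 : ℂ)

/-- The absolute value of `weight`. -/
def absWeight {m : ℕ} (x : Fin m → ℝ) (u : ℝ) : ℝ := ∏ i, |u - x i| ^ (-1 / 2 : ℝ)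

lemma ofReal_cpow_neg_half (t : ℝ) : (t : ℂ) ^ (-1 / 2 : ℂ) =
    (if t < 0 then -Complex.I else 1) * ((|t| ^ (-1 / 2 : ℝ) : ℝ) : ℂ) := by
  have e : (-1 / 2 : ℂ) = ((-1 / 2 : ℝ) : ℂ) := by norm_num
  split_ifs with h
  · rw [Complex.ofReal_cpow_of_nonpos h.le, abs_of_neg h,
      ← Complex.ofReal_neg, e, ← Complex.ofReal_cpow (by linarith), mul_comm]
    congr 1
    rw [show (Real.pi : ℂ) * Complex.I * ((-1 / 2 : ℝ) : ℂ) = -(Real.pi / 2 * Complex.I) by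
      push_cast; ring, Complex.exp_neg, Complex.exp_pi_div_two_mul_I, Complex.inv_I]
  · rw [abs_of_nonneg (not_lt.1 h), one_mul, e, ← Complex.ofReal_cpow (not_lt.1 h)]

lemma weight_eq {m : ℕ} (x : Fin m → ℝ) (u : ℝ) :
    weight x u = (-Complex.I) ^ (Finset.univ.filter fun i => u < x i).card *
      (absWeight x u : ℂ) := by
  have key : ∀ i, ((u : ℂ) - (x i : ℂ)) ^ (-1 / 2 : ℂ) =
      (if u < x i then -Complex.I else 1) * ((|u - x i| ^ (-1 / 2 : ℝ) : ℝ) : ℂ) := by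
    intro i
    rw [← Complex.ofReal_sub, ofReal_cpow_neg_half]
    simp only [sub_neg]
  rw [weight, absWeight]
  simp only [key, Finset.prod_mul_distrib]
  rw [Finset.prod_ite, Finset.prod_const, Finset.prod_const_one, mul_one]
  push_cast; rfl

lemma norm_weight {m : ℕ} (x : Fin m → ℝ) (u : ℝ) : ‖weight x u‖ = absWeight x u := by
  have h0 : 0 ≤ absWeight x u :=
    Finset.prod_nonneg fun i _ => Real.rpow_nonneg (abs_nonneg _) _
  rw [weight_eq, norm_mul, norm_pow, norm_neg, Complex.norm_I, one_pow, one_mul,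
    Complex.norm_real, Real.norm_of_nonneg h0]

lemma measurable_weight {m : ℕ} (x : Fin m → ℝ) : Measurable (weight x) := by
  unfold weight
  fun_prop

lemma absWeight_le {m : ℕ} {x : Fin m → ℝ} (hx : Function.Injective x) :
    ∃ C : ℝ, 0 ≤ C ∧ ∀ u, absWeight x u ≤ C * (1 + ∑ i, |u - x i| ^ (-1 / 2 : ℝ)) := by
  obtain ⟨δ, hδ, hδx⟩ : ∃ δ > 0, ∀ i k, i ≠ k → δ ≤ |x i - x k| := by
    rcases isEmpty_or_nonempty {p : Fin m × Fin m // p.1 ≠ p.2} with he | he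
    · exact ⟨1, one_pos, fun i k hik => (he.false ⟨(i, k), hik⟩).elim⟩
    · obtain ⟨p, hp⟩ := Finite.exists_min fun p : {p : Fin m × Fin m // p.1 ≠ p.2} =>
        |x p.1.1 - x p.1.2|
      exact ⟨_, abs_pos.2 (sub_ne_zero.2 fun h => p.2 (hx h)), fun i k hik => hp ⟨(i, k), hik⟩⟩
  set D := max 1 ((δ / 2) ^ (-1 / 2 : ℝ)) with hD
  have hD1 : 1 ≤ D := le_max_left _ _
  have hnn : ∀ u i, 0 ≤ |u - x i| ^ (-1 / 2 : ℝ) := fun u i => Real.rpow_nonneg (abs_nonneg _) _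
  refine ⟨D ^ m, by positivity, fun u => ?_⟩
  rcases isEmpty_or_nonempty (Fin m) with he | he
  · rw [absWeight, Finset.univ_eq_empty, Finset.prod_empty, Finset.sum_empty, add_zero, mul_one]
    exact one_le_pow₀ hD1
  obtain ⟨i, hi⟩ := Finite.exists_min fun i => |u - x i|
  have hk : ∀ k ∈ Finset.univ.erase i, |u - x k| ^ (-1 / 2 : ℝ) ≤ D := by
    intro k hk
    have hne := (Finset.mem_erase.1 hk).1
    have h1 : δ / 2 ≤ |u - x k| := by
      have h2 := hδx k i hne
      have h3 : |x k - x i| ≤ |u - x k| + |u - x i| := by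
        rw [show x k - x i = -(u - x k) + (u - x i) by ring]
        exact (abs_add_le _ _).trans_eq (by rw [abs_neg])
      have := hi k
      linarith
    exact (Real.rpow_le_rpow_of_nonpos (by positivity) h1 (by norm_num)).trans (le_max_right _ _)
  have hprod : ∏ k ∈ Finset.univ.erase i, |u - x k| ^ (-1 / 2 : ℝ) ≤ D ^ m := by
    refine (Finset.prod_le_prod (fun k _ => hnn u k) hk).trans ?_
    rw [Finset.prod_const]
    refine pow_le_pow_right₀ hD1 ((Finset.card_le_univ _).trans_eq (Fintype.card_fin m))
  rw [absWeight, ← Finset.mul_prod_erase _ _ (Finset.mem_univ i), mul_comm]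
  refine mul_le_mul hprod ?_ (hnn u i) (by positivity)
  have := Finset.single_le_sum (f := fun k => |u - x k| ^ (-1 / 2 : ℝ)) (fun k _ => hnn u k)
    (Finset.mem_univ i)
  linarith

lemma intervalIntegrable_abs_rpow (c a b : ℝ) :
    IntervalIntegrable (fun u => |u - c| ^ (-1 / 2 : ℝ)) volume a b := by
  have h := (intervalIntegral.intervalIntegrable_cpow' (a := a - c) (b := b - c)
    (r := (-1 / 2 : ℂ)) (by norm_num)).comp_sub_right c
  simp only [sub_add_cancel] at h
  refine h.norm.congr_ae (Eventually.of_forall fun u => ?_)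
  simp only
  rw [ofReal_cpow_neg_half, norm_mul, Complex.norm_real,
    Real.norm_of_nonneg (Real.rpow_nonneg (abs_nonneg _) _)]
  split_ifs <;> simp

lemma intervalIntegrable_weight {m : ℕ} {x : Fin m → ℝ} (hx : Function.Injective x) (a b : ℝ) :
    IntervalIntegrable (weight x) volume a b := by
  obtain ⟨C, hC0, hC⟩ := absWeight_le hx
  have h : IntervalIntegrable (fun u => C * (1 + ∑ i, |u - x i| ^ (-1 / 2 : ℝ))) volume a b := by
    refine IntervalIntegrable.const_mul (IntervalIntegrable.add intervalIntegrable_const ?_) C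
    have := IntervalIntegrable.sum (μ := volume) (a := a) (b := b) Finset.univ
      (f := fun i u => |u - x i| ^ (-1 / 2 : ℝ)) fun i _ => intervalIntegrable_abs_rpow (x i) a b
    refine this.congr_ae (Eventually.of_forall fun u => ?_)
    simp
  refine h.mono_fun (measurable_weight x).aestronglyMeasurable (Eventually.of_forall fun u => ?_)
  simp only
  rw [norm_weight]
  exact (hC u).trans (le_abs_self _)

lemma intervalIntegrable_mul_weight {m : ℕ} {x : Fin m → ℝ} (hx : Function.Injective x)
    {g : ℝ → ℂ} (hg : Continuous g) (a b : ℝ) :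
    IntervalIntegrable (fun u => g u * weight x u) volume a b :=
  (intervalIntegrable_weight hx a b).continuousOn_mul hg.continuousOn

/-- The moment `∫ (u - c)^s ∏_k (u - x_k)^{-1/2} du` between the points `x_p` and `x_q`. -/
def moment {m : ℕ} (x : Fin m → ℝ) (c : ℝ) (s : ℕ) (p q : Fin m) : ℂ :=
  ∫ u in (x p)..(x q), ((u : ℂ) - c) ^ s * weight x u

lemma continuous_sub_pow (c : ℝ) (s : ℕ) : Continuous fun u : ℝ => ((u : ℂ) - c) ^ s := by
  fun_prop

lemma moment_add {m : ℕ} {x : Fin m → ℝ} (hx : Function.Injective x) (c : ℝ) (s : ℕ)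
    (p q r : Fin m) : moment x c s p q + moment x c s q r = moment x c s p r :=
  intervalIntegral.integral_add_adjacent_intervals
    (intervalIntegrable_mul_weight hx (continuous_sub_pow c s) _ _)
    (intervalIntegrable_mul_weight hx (continuous_sub_pow c s) _ _)

/-- Fubini's theorem for a determinant whose rows depend on separate variables. -/
lemma integral_pi_det {n : ℕ} (S : Fin n → Set ℝ) (g : Fin n → ℝ → ℂ)
    (hg : ∀ r s, IntegrableOn (g s) (S r)) :
    ∫ u in Set.univ.pi S, (Matrix.of fun r s : Fin n => g s (u r)).det =
      (Matrix.of fun r s => ∫ u in S r, g s u).det := by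
  have hvol : (volume : Measure (Fin n → ℝ)).restrict (Set.univ.pi S) =
      Measure.pi fun r => volume.restrict (S r) := by
    rw [volume_pi, Measure.restrict_pi_pi]
  rw [← Matrix.det_transpose (Matrix.of fun r s => ∫ u in S r, g s u), Matrix.det_apply']
  simp only [← Matrix.det_transpose (Matrix.of fun r s : Fin n => g s (_ : ℝ)), Matrix.det_apply',
    Matrix.transpose_apply, Matrix.of_apply]
  rw [hvol, integral_finsetSum]
  · refine Finset.sum_congr rfl fun σ _ => ?_
    rw [integral_const_mul]
    congr 1
    exact integral_fintype_prod_eq_prod (fun r => g (σ r))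
  · intro σ _
    exact (Integrable.fintype_prod (f := fun r => g (σ r)) fun r => hg r (σ r)).const_mul _

/-- The product of the differences `x_j - x_i` to the power `1/4`. -/
def vdmQuarter {m : ℕ} (x : Fin m → ℝ) : ℝ := ∏ i, ∏ j ∈ Finset.Ioi i, (x j - x i) ^ (1 / 4 : ℝ)

lemma integrand_eq_det {N : ℕ} (β : LinkPattern N) (x : Fin (2 * N) → ℝ) (c : ℝ) (u : Fin N → ℝ) :
    integrand β x (fun r => (u r : ℂ)) =
      ((∏ r, Complex.I ^ (Finset.Ioi (β.a r)).card) * (vdmQuarter x : ℂ)) *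
        (Matrix.of fun r s : Fin N => ((u r : ℂ) - c) ^ (s : ℕ) * weight x (u r)).det := by
  have h1 : (Matrix.of fun r s : Fin N => ((u r : ℂ) - c) ^ (s : ℕ) * weight x (u r)) =
      Matrix.of fun r s : Fin N => weight x (u r) *
        Matrix.vandermonde (fun r => (u r : ℂ) - c) r s := by
    ext r s; simp [Matrix.vandermonde_apply, mul_comm]
  rw [h1, Matrix.det_mul_column, Matrix.det_vandermonde]
  simp only [integrand, weight, sub_sub_sub_cancel_right, vdmQuarter]
  ring

/-- The Coulomb gas function as a determinant of moments. -/
theorem coulombGas_eq_det {N : ℕ} (β : LinkPattern N) {x : Fin (2 * N) → ℝ} (hx : x ∈ chamber N)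
    (c : ℝ) : coulombGas β x =
      ((∏ r, Complex.I ^ (Finset.Ioi (β.a r)).card) * (vdmQuarter x : ℂ)) *
        (Matrix.of fun r s : Fin N => moment x c s (β.a r) (β.b r)).det := by
  have hx' : StrictMono x := hx
  rw [coulombGas]
  simp only [integrand_eq_det β x c]
  rw [integral_const_mul,
    integral_pi_det _ (fun (s : Fin N) u => ((u : ℂ) - c) ^ (s : ℕ) * weight x u)]
  · congr 3
    ext r s
    rw [moment, intervalIntegral.integral_of_le (hx' (β.a_lt_b r)).le,
      integral_Ioc_eq_integral_Ioo]
  · intro r s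
    exact ((intervalIntegrable_iff_integrableOn_Ioo_of_le (hx' (β.a_lt_b r)).le).1
      (intervalIntegrable_mul_weight hx'.injective (continuous_sub_pow c s) _ _))

/-- The substitution `u = (p + q) / 2 - (q - p) / 2 * cos θ` resolves square root singularities at
both ends of an interval. -/
lemma integral_cos_substitution {p q : ℝ} (hpq : p < q) (g : ℝ → ℝ) :
    ∫ u in p..q, |u - p| ^ (-1 / 2 : ℝ) * |u - q| ^ (-1 / 2 : ℝ) * g u =
      ∫ θ in (0 : ℝ)..Real.pi, g ((p + q) / 2 - (q - p) / 2 * Real.cos θ) := by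
  set f : ℝ → ℝ := fun θ => (p + q) / 2 - (q - p) / 2 * Real.cos θ with hf
  have hy : 0 < (q - p) / 2 := by linarith
  have hder : ∀ θ ∈ Ioo 0 Real.pi, HasDerivWithinAt f ((q - p) / 2 * Real.sin θ) (Ioo 0 Real.pi) θ := by
    intro θ _
    have := ((Real.hasDerivAt_cos θ).const_mul ((q - p) / 2)).const_sub ((p + q) / 2)
    exact (this.congr_deriv (by ring)).hasDerivWithinAt
  have hinj : InjOn f (Ioo 0 Real.pi) := by
    intro θ hθ η hη h
    simp only [hf] at h
    have : Real.cos θ = Real.cos η := by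
      have : (q - p) / 2 * Real.cos θ = (q - p) / 2 * Real.cos η := by linarith
      exact mul_left_cancel₀ hy.ne' this
    exact Real.injOn_cos ⟨hθ.1.le, hθ.2.le⟩ ⟨hη.1.le, hη.2.le⟩ this
  have himg : f '' Ioo 0 Real.pi = Ioo p q := by
    ext u
    constructor
    · rintro ⟨θ, hθ, rfl⟩
      have h1 : Real.cos θ < 1 := by
        rw [← Real.cos_zero]
        exact Real.strictAntiOn_cos ⟨le_rfl, Real.pi_pos.le⟩ ⟨hθ.1.le, hθ.2.le⟩ hθ.1
      have h2 : -1 < Real.cos θ := by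
        rw [← Real.cos_pi]
        exact Real.strictAntiOn_cos ⟨hθ.1.le, hθ.2.le⟩ ⟨Real.pi_pos.le, le_rfl⟩ hθ.2
      simp only [hf]
      constructor <;> nlinarith
    · rintro ⟨h1, h2⟩
      set t := ((p + q) / 2 - u) / ((q - p) / 2) with ht
      have t1 : t < 1 := by rw [ht, div_lt_one hy]; linarith
      have t2 : -1 < t := by rw [ht, lt_div_iff₀ hy]; linarith
      refine ⟨Real.arccos t, ⟨Real.arccos_pos.2 t1, ?_⟩, ?_⟩
      · refine lt_of_le_of_ne (Real.arccos_le_pi t) fun h => ?_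
        rw [Real.arccos_eq_pi] at h; linarith
      · simp only [hf]
        rw [Real.cos_arccos t2.le t1.le, ht, mul_div_cancel₀ _ hy.ne']
        ring
  rw [intervalIntegral.integral_of_le hpq.le, integral_Ioc_eq_integral_Ioo, ← himg,
    integral_image_eq_integral_abs_deriv_smul measurableSet_Ioo hder hinj,
    intervalIntegral.integral_of_le Real.pi_pos.le, integral_Ioc_eq_integral_Ioo]
  refine setIntegral_congr_fun measurableSet_Ioo fun θ hθ => ?_
  have hs : 0 < Real.sin θ := Real.sin_pos_of_mem_Ioo hθ
  have e1 : |f θ - p| * |f θ - q| = ((q - p) / 2 * Real.sin θ) ^ 2 := by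
    rw [← abs_mul, ← abs_sq ((q - p) / 2 * Real.sin θ), ← abs_neg]
    congr 1
    simp only [hf]
    have := Real.sin_sq_add_cos_sq θ
    linear_combination -((q - p) / 2) ^ 2 * this
  have hp : 0 < (q - p) / 2 * Real.sin θ := by positivity
  simp only [smul_eq_mul]
  rw [← Real.mul_rpow (abs_nonneg _) (abs_nonneg _), e1, ← Real.rpow_natCast, ← Real.rpow_mul hp.le,
    abs_of_pos hp, show ((2 : ℕ) : ℝ) * (-1 / 2) = -1 by norm_num, Real.rpow_neg_one,
    ← mul_assoc, mul_inv_cancel₀ hp.ne', one_mul]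

/-- The point between `x_p` and `x_q` with angular parameter `θ`. -/
def gapPoint {m : ℕ} (x : Fin m → ℝ) (p q : Fin m) (θ : ℝ) : ℝ :=
  (x p + x q) / 2 - (x q - x p) / 2 * Real.cos θ

/-- The product of `|u - x_i|^{-1/2}` over all `i` other than `p, q`. -/
def restWeight {m : ℕ} (x : Fin m → ℝ) (p q : Fin m) (u : ℝ) : ℝ :=
  ∏ i ∈ (Finset.univ.erase p).erase q, |u - x i| ^ (-1 / 2 : ℝ)

/-- The moment of `|∏ (u - x_k)|^{-1/2}` between `x_p` and `x_q`, in the angular variable. -/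
def gapMoment {m : ℕ} (x : Fin m → ℝ) (c : ℝ) (s : ℕ) (p q : Fin m) : ℝ :=
  ∫ θ in (0 : ℝ)..Real.pi, (gapPoint x p q θ - c) ^ s * restWeight x p q (gapPoint x p q θ)

lemma absWeight_eq {m : ℕ} (x : Fin m → ℝ) {p q : Fin m} (hpq : p ≠ q) (u : ℝ) :
    absWeight x u = |u - x p| ^ (-1 / 2 : ℝ) * |u - x q| ^ (-1 / 2 : ℝ) * restWeight x p q u := by
  rw [absWeight, restWeight, mul_assoc, Finset.mul_prod_erase _ (fun i => |u - x i| ^ (-1 / 2 : ℝ))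
    (Finset.mem_erase.2 ⟨hpq.symm, Finset.mem_univ _⟩),
    Finset.mul_prod_erase _ (fun i => |u - x i| ^ (-1 / 2 : ℝ)) (Finset.mem_univ p)]

lemma integral_absWeight {m : ℕ} {x : Fin m → ℝ} {p q : Fin m} (hpq : x p < x q) (g : ℝ → ℝ) :
    ∫ u in (x p)..(x q), g u * absWeight x u =
      ∫ θ in (0 : ℝ)..Real.pi, g (gapPoint x p q θ) * restWeight x p q (gapPoint x p q θ) := by
  have hne : p ≠ q := fun h => by rw [h] at hpq; exact lt_irrefl _ hpq
  refine Eq.trans ?_ (integral_cos_substitution hpq fun u => g u * restWeight x p q u)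
  refine intervalIntegral.integral_congr fun u _ => ?_
  rw [absWeight_eq x hne]; ring

/-- Between consecutive points, the phase of the weight is constant. -/
lemma integral_gap {m : ℕ} {x : Fin m → ℝ} (hx : StrictMono x) {p q : Fin m}
    (hpq : (q : ℕ) = p + 1) (g : ℝ → ℝ) :
    ∫ u in (x p)..(x q), (g u : ℂ) * weight x u = (-Complex.I) ^ (Finset.Ioi p).card *
      ((∫ u in (x p)..(x q), g u * absWeight x u : ℝ) : ℂ) := by
  have hlt : x p < x q := hx (by rw [Fin.lt_def]; omega)
  rw [← intervalIntegral.integral_ofReal, ← intervalIntegral.integral_const_mul,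
    intervalIntegral.integral_of_le hlt.le, intervalIntegral.integral_of_le hlt.le,
    integral_Ioc_eq_integral_Ioo, integral_Ioc_eq_integral_Ioo]
  refine setIntegral_congr_fun measurableSet_Ioo fun u hu => ?_
  have : (Finset.univ.filter fun i => u < x i) = Finset.Ioi p := by
    ext i
    simp only [Finset.mem_filter, Finset.mem_univ, true_and, Finset.mem_Ioi]
    constructor
    · intro h
      exact hx.lt_iff_lt.1 (hu.1.trans h)
    · intro h
      refine hu.2.trans_le (hx.monotone ?_)
      rw [Fin.le_def]; rw [Fin.lt_def] at h; omega
  rw [weight_eq, this]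
  push_cast; ring

theorem moment_eq_gapMoment {m : ℕ} {x : Fin m → ℝ} (hx : StrictMono x) (c : ℝ) (s : ℕ)
    {p q : Fin m} (hpq : (q : ℕ) = p + 1) :
    moment x c s p q = (-Complex.I) ^ (Finset.Ioi p).card * (gapMoment x c s p q : ℂ) := by
  have h := integral_gap hx hpq fun u => (u - c) ^ s
  have hlt : x p < x q := hx (by rw [Fin.lt_def]; omega)
  rw [integral_absWeight hlt fun u => (u - c) ^ s] at h
  rw [moment, gapMoment, ← h]
  push_cast; rfl

section Parametric

variable {E F : Type} [NormedAddCommGroup E] [NormedSpace ℝ E] [FiniteDimensional ℝ E]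
  [NormedAddCommGroup F] [NormedSpace ℝ F]

lemma hasFDerivAt_parametric {U : Set E} (hU : IsOpen U) {H : E → ℝ → F}
    (hH : ContDiffOn ℝ ∞ (fun z : E × ℝ => H z.1 z.2) (U ×ˢ univ)) (a b : ℝ) {x : E} (hx : x ∈ U) :
    (∀ θ, HasFDerivAt (fun y => H y θ)
      ((fderiv ℝ (fun z : E × ℝ => H z.1 z.2) (x, θ)).comp (ContinuousLinearMap.inl ℝ E ℝ)) x) ∧
    Continuous (fun θ => (fderiv ℝ (fun z : E × ℝ => H z.1 z.2) (x, θ)).comp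
      (ContinuousLinearMap.inl ℝ E ℝ)) ∧
    HasFDerivAt (fun y => ∫ θ in a..b, H y θ) (∫ θ in a..b,
      (fderiv ℝ (fun z : E × ℝ => H z.1 z.2) (x, θ)).comp (ContinuousLinearMap.inl ℝ E ℝ)) x := by
  have hUo : IsOpen (U ×ˢ (univ : Set ℝ)) := hU.prod isOpen_univ
  have hdiff : ∀ y ∈ U, ∀ θ, HasFDerivAt (fun y => H y θ)
      ((fderiv ℝ (fun z : E × ℝ => H z.1 z.2) (y, θ)).comp (ContinuousLinearMap.inl ℝ E ℝ)) y := by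
    intro y hy θ
    have h1 : DifferentiableAt ℝ (fun z : E × ℝ => H z.1 z.2) (y, θ) :=
      (hH.differentiableOn (by simp)).differentiableAt (hUo.mem_nhds ⟨hy, mem_univ _⟩)
    exact h1.hasFDerivAt.comp y (hasFDerivAt_prodMk_left (𝕜 := ℝ) y θ)
  have hcont : ContinuousOn (fun z : E × ℝ => (fderiv ℝ (fun z : E × ℝ => H z.1 z.2) z).comp
      (ContinuousLinearMap.inl ℝ E ℝ)) (U ×ˢ univ) :=
    (hH.continuousOn_fderiv_of_isOpen hUo (by simp)).clm_comp continuousOn_const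
  have hcθ : ∀ y ∈ U, Continuous (fun θ => (fderiv ℝ (fun z : E × ℝ => H z.1 z.2) (y, θ)).comp
      (ContinuousLinearMap.inl ℝ E ℝ)) := by
    intro y hy
    exact hcont.comp_continuous (f := fun θ : ℝ => (y, θ)) (by fun_prop) fun θ => ⟨hy, mem_univ _⟩
  have hHθ : ∀ y ∈ U, Continuous (H y) := fun y hy =>
    hH.continuousOn.comp_continuous (f := fun θ : ℝ => (y, θ)) (by fun_prop)
      fun θ => ⟨hy, mem_univ _⟩
  refine ⟨hdiff x hx, hcθ x hx, ?_⟩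
  obtain ⟨K, hK, hKx, hKU⟩ := exists_compact_subset hU hx
  obtain ⟨C, hC⟩ := (hK.prod (isCompact_uIcc (a := a) (b := b))).exists_bound_of_continuousOn
    (hcont.mono (prod_mono hKU (subset_univ _)))
  refine hasFDerivAt_integral_of_dominated_of_fderiv_le''
    (bound := fun _ => C) (s := K) (F := fun y θ => H y θ)
    (F' := fun y θ => (fderiv ℝ (fun z : E × ℝ => H z.1 z.2) (y, θ)).comp
      (ContinuousLinearMap.inl ℝ E ℝ)) (mem_interior_iff_mem_nhds.1 hKx) ?_ ?_ ?_ ?_ ?_ ?_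
  · filter_upwards [hU.mem_nhds hx] with y hy
    exact (hHθ y hy).aestronglyMeasurable
  · exact (hHθ x hx).intervalIntegrable _ _
  · exact (hcθ x hx).aestronglyMeasurable
  · refine (ae_restrict_iff' measurableSet_uIoc).2 (Eventually.of_forall fun θ hθ y hy => ?_)
    exact hC (y, θ) ⟨hy, uIoc_subset_uIcc hθ⟩
  · exact intervalIntegrable_const
  · exact Eventually.of_forall fun θ y hy => hdiff y (hKU hy) θ

lemma contDiffOn_parametric {U : Set E} (hU : IsOpen U) (a b : ℝ) (n : ℕ) :
    ∀ {F : Type} [NormedAddCommGroup F] [NormedSpace ℝ F] {H : E → ℝ → F},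
    ContDiffOn ℝ ∞ (fun z : E × ℝ => H z.1 z.2) (U ×ˢ univ) →
    ContDiffOn ℝ n (fun y => ∫ θ in a..b, H y θ) U := by
  induction n with
  | zero =>
    intro F _ _ H hH
    refine contDiffOn_zero.2 fun y hy => ?_
    exact (hasFDerivAt_parametric hU hH a b hy).2.2.continuousAt.continuousWithinAt
  | succ n ih =>
    intro F _ _ H hH
    have hUo : IsOpen (U ×ˢ (univ : Set ℝ)) := hU.prod isOpen_univ
    refine (contDiffOn_succ_iff_fderiv_of_isOpen hU).2 ⟨fun y hy =>
      (hasFDerivAt_parametric hU hH a b hy).2.2.differentiableAt.differentiableWithinAt,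
      fun h => absurd h (WithTop.natCast_ne_top n), ?_⟩
    have hH' : ContDiffOn ℝ ∞ (fun z : E × ℝ =>
        (fderiv ℝ (fun z : E × ℝ => H z.1 z.2) (z.1, z.2)).comp (ContinuousLinearMap.inl ℝ E ℝ))
        (U ×ˢ univ) :=
      (hH.fderiv_of_isOpen hUo (m := ∞) (by simp)).clm_comp contDiffOn_const
    refine (ih (H := fun y θ => (fderiv ℝ (fun z : E × ℝ => H z.1 z.2) (y, θ)).comp
      (ContinuousLinearMap.inl ℝ E ℝ)) hH').congr fun y hy => ?_
    exact (hasFDerivAt_parametric hU hH a b hy).2.2.fderiv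

lemma fderiv_parametric_apply {U : Set E} (hU : IsOpen U) {H : E → ℝ → F}
    (hH : ContDiffOn ℝ ∞ (fun z : E × ℝ => H z.1 z.2) (U ×ˢ univ)) (a b : ℝ) {x : E} (hx : x ∈ U)
    (v : E) : Continuous (fun θ => fderiv ℝ (fun y => H y θ) x v) ∧
      fderiv ℝ (fun y => ∫ θ in a..b, H y θ) x v =
        ∫ θ in a..b, fderiv ℝ (fun y => H y θ) x v := by
  obtain ⟨h1, h2, h3⟩ := hasFDerivAt_parametric hU hH a b hx
  simp only [fun θ => (h1 θ).fderiv]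
  refine ⟨h2.clm_apply continuous_const, ?_⟩
  rw [h3.fderiv, ContinuousLinearMap.intervalIntegral_apply (h2.intervalIntegrable _ _)]

end Parametric

lemma isOpen_strictMono (m : ℕ) : IsOpen {x : Fin m → ℝ | StrictMono x} := by
  have : {x : Fin m → ℝ | StrictMono x} = ⋂ i, ⋂ k, {x : Fin m → ℝ | i < k → x i < x k} := by
    ext x
    simp only [mem_ofPred_eq, mem_iInter]
    exact ⟨fun h i k hik => h hik, fun h i k hik => h i k hik⟩
  rw [this]
  refine isOpen_iInter_of_finite fun i => isOpen_iInter_of_finite fun k => ?_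
  by_cases hik : i < k
  · simp only [hik, true_imp_iff]
    exact isOpen_lt (continuous_apply i) (continuous_apply k)
  · simp [hik]

lemma hasDerivAt_abs_rpow_neg_half {t : ℝ} (ht : t ≠ 0) :
    HasDerivAt (fun t : ℝ => |t| ^ (-1 / 2 : ℝ)) (-(1 / 2) * |t| ^ (-1 / 2 : ℝ) / t) t := by
  have h := (hasDerivAt_abs ht).rpow_const (p := (-1 / 2 : ℝ)) (Or.inl (abs_pos.2 ht).ne')
  refine h.congr_deriv ?_
  rw [Real.rpow_sub_one (abs_pos.2 ht).ne']
  rcases lt_or_gt_of_ne ht with h0 | h0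
  · rw [abs_of_neg h0, sign_neg h0]
    simp only [SignType.coe_neg, SignType.coe_one]
    field_simp
  · rw [abs_of_pos h0, sign_pos h0]
    simp only [SignType.coe_one]
    field_simp

lemma contDiffAt_abs_rpow_neg_half {t : ℝ} (ht : t ≠ 0) {n : ℕ∞} :
    ContDiffAt ℝ n (fun t : ℝ => |t| ^ (-1 / 2 : ℝ)) t :=
  (contDiffAt_abs ht).rpow_const_of_ne (abs_pos.2 ht).ne'

section Gap

variable {m : ℕ}

lemma gapPoint_mem {x : Fin m → ℝ} {p q : Fin m} (h : x p ≤ x q) (θ : ℝ) :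
    gapPoint x p q θ ∈ Icc (x p) (x q) := by
  have h1 := Real.neg_one_le_cos θ
  have h2 := Real.cos_le_one θ
  simp only [gapPoint]
  constructor <;> nlinarith

lemma gapPoint_ne {x : Fin m → ℝ} (hx : StrictMono x) {p q : Fin m} (hpq : (q : ℕ) = p + 1) (θ : ℝ)
    {i : Fin m} (hi : i ∈ (Finset.univ.erase p).erase q) : gapPoint x p q θ - x i ≠ 0 := by
  simp only [Finset.mem_erase, Finset.mem_univ, and_true] at hi
  have hm := gapPoint_mem (x := x) (p := p) (q := q) (hx (by rw [Fin.lt_def]; omega)).le θ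
  rw [sub_ne_zero]
  have h1 : (i : ℕ) ≠ p := fun h => hi.2 (Fin.ext h)
  have h2 : (i : ℕ) ≠ q := fun h => hi.1 (Fin.ext h)
  rcases lt_or_gt_of_ne h1 with h | h
  · exact ((hx (Fin.lt_def.2 h)).trans_le hm.1).ne'
  · exact (hm.2.trans_lt (hx (Fin.lt_def.2 (by omega)))).ne

lemma contDiffOn_gap (c : ℝ) (s : ℕ) {p q : Fin m} (hpq : (q : ℕ) = p + 1) :
    ContDiffOn ℝ ∞ (fun z : (Fin m → ℝ) × ℝ => (gapPoint z.1 p q z.2 - c) ^ s *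
      restWeight z.1 p q (gapPoint z.1 p q z.2)) ({x | StrictMono x} ×ˢ univ) := by
  have hU : ContDiff ℝ ∞ (fun z : (Fin m → ℝ) × ℝ => gapPoint z.1 p q z.2) := by
    unfold gapPoint
    have := Real.contDiff_cos (n := ∞)
    fun_prop
  rintro ⟨x, θ⟩ ⟨hx, -⟩
  refine ContDiffAt.contDiffWithinAt (ContDiffAt.mul ?_ ?_)
  · exact ((hU.sub contDiff_const).pow s).contDiffAt
  · unfold restWeight
    refine contDiffAt_prod fun i hi => ?_
    have h1 : ContDiffAt ℝ ∞ (fun z : (Fin m → ℝ) × ℝ => gapPoint z.1 p q z.2 - z.1 i) (x, θ) := by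
      refine hU.contDiffAt.sub ?_
      exact ContDiff.contDiffAt (by fun_prop)
    exact (contDiffAt_abs_rpow_neg_half (gapPoint_ne hx hpq θ hi)).comp (x, θ) h1

lemma hasDerivAt_gap_other (c : ℝ) (s : ℕ) {p q : Fin m} (hpq : (q : ℕ) = p + 1) {x : Fin m → ℝ}
    (hx : StrictMono x) (θ : ℝ) {i : Fin m} (hip : i ≠ p) (hiq : i ≠ q) :
    HasDerivAt (fun t : ℝ => (gapPoint (x + t • Pi.single i 1) p q θ - c) ^ s *
      restWeight (x + t • Pi.single i 1) p q (gapPoint (x + t • Pi.single i 1) p q θ))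
      (1 / 2 * ((gapPoint x p q θ - c) ^ s * restWeight x p q (gapPoint x p q θ)) /
        (gapPoint x p q θ - x i)) 0 := by
  have hi : i ∈ (Finset.univ.erase p).erase q := by simp [hip, hiq]
  have hne := gapPoint_ne hx hpq θ hi
  have hU : ∀ t : ℝ, gapPoint (x + t • Pi.single i 1) p q θ = gapPoint x p q θ := by
    intro t; simp [gapPoint, hip.symm, hiq.symm]
  simp only [hU]
  set U := gapPoint x p q θ
  have hR : ∀ t : ℝ, restWeight (x + t • Pi.single i 1) p q U = |U - x i - t| ^ (-1 / 2 : ℝ) *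
      ∏ k ∈ ((Finset.univ.erase p).erase q).erase i, |U - x k| ^ (-1 / 2 : ℝ) := by
    intro t
    rw [restWeight, ← Finset.mul_prod_erase _ _ hi]
    congr 1
    · simp [sub_sub]
    · refine Finset.prod_congr rfl fun k hk => ?_
      simp [(Finset.mem_erase.1 hk).1]
  have hR0 := hR 0
  simp only [zero_smul, add_zero, sub_zero] at hR0
  simp only [hR]
  rw [hR0]
  have h1 : HasDerivAt (fun t : ℝ => |U - x i - t| ^ (-1 / 2 : ℝ))
      (-(1 / 2) * |U - x i| ^ (-1 / 2 : ℝ) / (U - x i) * -1) 0 := by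
    have := (hasDerivAt_abs_rpow_neg_half (t := U - x i - 0) (by simpa using hne)).comp (0 : ℝ)
      ((hasDerivAt_id (0 : ℝ)).const_sub (U - x i))
    exact this.congr_deriv (by simp)
  refine ((h1.mul_const _).const_mul _).congr_deriv ?_
  ring

lemma hasDerivAt_gap_translate (c : ℝ) (s : ℕ) {p q : Fin m} (x : Fin m → ℝ) (θ : ℝ) :
    HasDerivAt (fun t : ℝ => (gapPoint (x + t • fun _ => 1) p q θ - c) ^ s *
      restWeight (x + t • fun _ => 1) p q (gapPoint (x + t • fun _ => 1) p q θ))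
      (s * ((gapPoint x p q θ - c) ^ (s - 1) * restWeight x p q (gapPoint x p q θ))) 0 := by
  have hU : ∀ t : ℝ, gapPoint (x + t • fun _ => 1) p q θ = gapPoint x p q θ + t := by
    intro t; simp [gapPoint]; ring
  have hR : ∀ t u : ℝ, restWeight (x + t • fun _ => 1) p q (u + t) = restWeight x p q u := by
    intro t u; simp [restWeight]
  simp only [hU, hR]
  have := ((((hasDerivAt_id (0 : ℝ)).const_add (gapPoint x p q θ)).sub_const c).pow s).mul_const
    (restWeight x p q (gapPoint x p q θ))
  refine this.congr_deriv ?_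
  simp [mul_assoc]

lemma differentiableAt_restWeight {p q : Fin m} (hpq : (q : ℕ) = p + 1) {x : Fin m → ℝ}
    (hx : StrictMono x) (c : ℝ) (s : ℕ) (θ : ℝ) :
    DifferentiableAt ℝ (fun u => (u - c) ^ s * restWeight x p q u) (gapPoint x p q θ) := by
  refine DifferentiableAt.mul (by fun_prop) ?_
  unfold restWeight
  refine DifferentiableAt.fun_finsetProd fun k hk => ?_
  exact (hasDerivAt_abs_rpow_neg_half (gapPoint_ne hx hpq θ hk)).differentiableAt.comp
    (gapPoint x p q θ) (f := fun u => u - x k) (by fun_prop)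

lemma hasDerivAt_gap_end (c : ℝ) (s : ℕ) {p q : Fin m} (hpq : (q : ℕ) = p + 1) {x : Fin m → ℝ}
    (hx : StrictMono x) (θ : ℝ) {i : Fin m} {w : ℝ}
    (hi : i = p ∧ w = (1 + Real.cos θ) / 2 ∨ i = q ∧ w = (1 - Real.cos θ) / 2) :
    HasDerivAt (fun t : ℝ => (gapPoint (x + t • Pi.single i 1) p q θ - c) ^ s *
      restWeight (x + t • Pi.single i 1) p q (gapPoint (x + t • Pi.single i 1) p q θ))
      (w * deriv (fun u => (u - c) ^ s * restWeight x p q u) (gapPoint x p q θ)) 0 := by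
  have hne : p ≠ q := fun h => by rw [h] at hpq; omega
  have hU : ∀ t : ℝ, gapPoint (x + t • Pi.single i 1) p q θ = gapPoint x p q θ + t * w := by
    intro t
    rcases hi with ⟨rfl, rfl⟩ | ⟨rfl, rfl⟩
    · simp [gapPoint, hne.symm]; ring
    · simp [gapPoint, hne]; ring
  have hR : ∀ t u : ℝ, restWeight (x + t • Pi.single i 1) p q u = restWeight x p q u := by
    intro t u
    refine Finset.prod_congr rfl fun k hk => ?_
    simp only [Finset.mem_erase, Finset.mem_univ, and_true] at hk
    have : k ≠ i := by
      rcases hi with ⟨rfl, -⟩ | ⟨rfl, -⟩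
      · exact hk.2
      · exact hk.1
    simp [this]
  simp only [hU, hR]
  have hd := differentiableAt_restWeight hpq hx c s θ
  have h2 : HasDerivAt (fun t : ℝ => gapPoint x p q θ + t * w) (1 * w) 0 :=
    ((hasDerivAt_id (0 : ℝ)).mul_const w).const_add _
  have h3 : HasDerivAt (fun u => (u - c) ^ s * restWeight x p q u)
      (deriv (fun u => (u - c) ^ s * restWeight x p q u) (gapPoint x p q θ))
      (gapPoint x p q θ + 0 * w) := by
    rw [zero_mul, add_zero]; exact hd.hasDerivAt
  have h4 := h3.comp (0 : ℝ) h2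
  exact h4.congr_deriv (by rw [one_mul, mul_comm])

lemma fderiv_gap_eq {c : ℝ} {s : ℕ} {p q : Fin m} (hpq : (q : ℕ) = p + 1) {x : Fin m → ℝ}
    (hx : StrictMono x) {θ : ℝ} {v : Fin m → ℝ} {d : ℝ}
    (h : HasDerivAt (fun t : ℝ => (gapPoint (x + t • v) p q θ - c) ^ s *
      restWeight (x + t • v) p q (gapPoint (x + t • v) p q θ)) d 0) :
    fderiv ℝ (fun y => (gapPoint y p q θ - c) ^ s * restWeight y p q (gapPoint y p q θ)) x v =
      d := by
  have hdiff := (hasFDerivAt_parametric (isOpen_strictMono m) (H := fun y θ =>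
    (gapPoint y p q θ - c) ^ s * restWeight y p q (gapPoint y p q θ))
    (contDiffOn_gap c s hpq) 0 0 hx).1 θ
  rw [← hdiff.differentiableAt.lineDeriv_eq_fderiv]
  exact h.deriv

lemma contDiffOn_gapMoment (c : ℝ) (s : ℕ) {p q : Fin m} (hpq : (q : ℕ) = p + 1) :
    ContDiffOn ℝ 2 (fun x : Fin m → ℝ => gapMoment x c s p q) {x | StrictMono x} :=
  contDiffOn_parametric (isOpen_strictMono m) 0 Real.pi 2 (H := fun y θ =>
    (gapPoint y p q θ - c) ^ s * restWeight y p q (gapPoint y p q θ)) (contDiffOn_gap c s hpq)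

lemma fderiv_gapMoment (c : ℝ) (s : ℕ) {p q : Fin m} (hpq : (q : ℕ) = p + 1) {x : Fin m → ℝ}
    (hx : StrictMono x) (v : Fin m → ℝ) :
    Continuous (fun θ => fderiv ℝ (fun y =>
      (gapPoint y p q θ - c) ^ s * restWeight y p q (gapPoint y p q θ)) x v) ∧
    fderiv ℝ (fun x : Fin m → ℝ => gapMoment x c s p q) x v =
      ∫ θ in (0 : ℝ)..Real.pi, fderiv ℝ (fun y =>
        (gapPoint y p q θ - c) ^ s * restWeight y p q (gapPoint y p q θ)) x v :=
  fderiv_parametric_apply (isOpen_strictMono m) (H := fun y θ =>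
    (gapPoint y p q θ - c) ^ s * restWeight y p q (gapPoint y p q θ)) (contDiffOn_gap c s hpq)
    0 Real.pi hx v

lemma continuous_gap (c : ℝ) (s : ℕ) {p q : Fin m} (hpq : (q : ℕ) = p + 1) {x : Fin m → ℝ}
    (hx : StrictMono x) :
    Continuous (fun θ => (gapPoint x p q θ - c) ^ s * restWeight x p q (gapPoint x p q θ)) :=
  (contDiffOn_gap c s hpq).continuousOn.comp_continuous (f := fun θ : ℝ => (x, θ)) (by fun_prop)
    fun _ => ⟨hx, mem_univ _⟩

lemma gapMoment_translate (c : ℝ) (s : ℕ) {p q : Fin m} (hpq : (q : ℕ) = p + 1) {x : Fin m → ℝ}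
    (hx : StrictMono x) :
    fderiv ℝ (fun x : Fin m → ℝ => gapMoment x c s p q) x (fun _ => 1) =
      s * gapMoment x c (s - 1) p q := by
  rw [(fderiv_gapMoment c s hpq hx _).2, gapMoment, ← intervalIntegral.integral_const_mul]
  exact intervalIntegral.integral_congr fun θ _ =>
    fderiv_gap_eq hpq hx (hasDerivAt_gap_translate c s x θ)

lemma integral_sub_add_continuous {A B C : ℝ → ℝ} (hA : Continuous A) (hB : Continuous B)
    (hC : Continuous C) (b c l r : ℝ) : ∫ θ in l..r, (A θ - (b * B θ + c * C θ)) =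
      (∫ θ in l..r, A θ) - (b * (∫ θ in l..r, B θ) + c * ∫ θ in l..r, C θ) := by
  have hB' : Continuous fun θ => b * B θ := by fun_prop
  have hC' : Continuous fun θ => c * C θ := by fun_prop
  have hBC : Continuous fun θ => b * B θ + c * C θ := by fun_prop
  rw [intervalIntegral.integral_sub (hA.intervalIntegrable _ _) (hBC.intervalIntegrable _ _),
    intervalIntegral.integral_add (hB'.intervalIntegrable _ _) (hC'.intervalIntegrable _ _),
    intervalIntegral.integral_const_mul, intervalIntegral.integral_const_mul]

lemma gapMoment_recurrence (c : ℝ) (s : ℕ) {p q : Fin m} (hpq : (q : ℕ) = p + 1) {x : Fin m → ℝ}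
    (hx : StrictMono x) (i : Fin m) :
    fderiv ℝ (fun x : Fin m → ℝ => gapMoment x c (s + 1) p q) x (Pi.single i 1) =
      (x i - c) * fderiv ℝ (fun x : Fin m → ℝ => gapMoment x c s p q) x (Pi.single i 1) +
        1 / 2 * gapMoment x c s p q := by
  obtain ⟨c1, e1⟩ := fderiv_gapMoment c (s + 1) hpq hx (Pi.single i 1)
  obtain ⟨c0, e0⟩ := fderiv_gapMoment c s hpq hx (Pi.single i 1)
  have ch := continuous_gap c s hpq hx
  have cont := c1.sub ((c0.const_mul (x i - c)).add (ch.const_mul (1 / 2)))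
  suffices key : ∫ θ in (0 : ℝ)..Real.pi, (fderiv ℝ (fun y => (gapPoint y p q θ - c) ^ (s + 1) *
      restWeight y p q (gapPoint y p q θ)) x (Pi.single i 1) -
      ((x i - c) * fderiv ℝ (fun y => (gapPoint y p q θ - c) ^ s *
        restWeight y p q (gapPoint y p q θ)) x (Pi.single i 1) +
      1 / 2 * ((gapPoint x p q θ - c) ^ s * restWeight x p q (gapPoint x p q θ)))) = 0 by
    rw [integral_sub_add_continuous c1 c0 ch] at key
    rw [e1, e0, gapMoment]
    linarith
  by_cases hi : i = p ∨ i = q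
  · have hne : p ≠ q := fun h => by rw [h] at hpq; omega
    obtain ⟨σ, hσ⟩ : ∃ σ : ℝ, (i = p ∧ σ = 1) ∨ (i = q ∧ σ = -1) := by
      rcases hi with h | h
      · exact ⟨1, Or.inl ⟨h, rfl⟩⟩
      · exact ⟨-1, Or.inr ⟨h, rfl⟩⟩
    have hw : ∀ θ, i = p ∧ (1 + σ * Real.cos θ) / 2 = (1 + Real.cos θ) / 2 ∨
        i = q ∧ (1 + σ * Real.cos θ) / 2 = (1 - Real.cos θ) / 2 := by
      intro θ
      rcases hσ with ⟨h, rfl⟩ | ⟨h, rfl⟩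
      · exact Or.inl ⟨h, by ring⟩
      · exact Or.inr ⟨h, by ring⟩
    have hσ2 : σ ^ 2 = 1 := by
      rcases hσ with ⟨-, rfl⟩ | ⟨-, rfl⟩ <;> norm_num
    have hxi : ∀ θ, gapPoint x p q θ - x i =
        σ * ((x q - x p) / 2) * (1 - σ * Real.cos θ) := by
      intro θ
      rcases hσ with ⟨rfl, rfl⟩ | ⟨rfl, rfl⟩ <;> simp only [gapPoint] <;> ring
    set h : ℝ → ℝ := fun u => (u - c) ^ s * restWeight x p q u with hh
    have hprim : ∀ θ, HasDerivAt (fun θ => σ / 2 * (Real.sin θ * h (gapPoint x p q θ)))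
        (fderiv ℝ (fun y => (gapPoint y p q θ - c) ^ (s + 1) *
          restWeight y p q (gapPoint y p q θ)) x (Pi.single i 1) -
        ((x i - c) * fderiv ℝ (fun y => (gapPoint y p q θ - c) ^ s *
          restWeight y p q (gapPoint y p q θ)) x (Pi.single i 1) +
        1 / 2 * ((gapPoint x p q θ - c) ^ s * restWeight x p q (gapPoint x p q θ)))) θ := by
      intro θ
      rw [fderiv_gap_eq hpq hx (hasDerivAt_gap_end c (s + 1) hpq hx θ (hw θ)),
        fderiv_gap_eq hpq hx (hasDerivAt_gap_end c s hpq hx θ (hw θ))]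
      have hd : HasDerivAt h (deriv h (gapPoint x p q θ)) (gapPoint x p q θ) :=
        (differentiableAt_restWeight hpq hx c s θ).hasDerivAt
      have hds : deriv (fun u => (u - c) ^ (s + 1) * restWeight x p q u) (gapPoint x p q θ) =
          h (gapPoint x p q θ) + (gapPoint x p q θ - c) * deriv h (gapPoint x p q θ) := by
        have e : (fun u => (u - c) ^ (s + 1) * restWeight x p q u) = fun u => (u - c) * h u := by
          funext u; simp only [hh]; ring
        rw [e]
        have := ((hasDerivAt_id (gapPoint x p q θ)).sub_const c).mul hd
        exact this.deriv.trans (by simp)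
      have hU : HasDerivAt (fun θ => gapPoint x p q θ) ((x q - x p) / 2 * Real.sin θ) θ := by
        have := ((Real.hasDerivAt_cos θ).const_mul ((x q - x p) / 2)).const_sub ((x p + x q) / 2)
        exact this.congr_deriv (by ring)
      have := (((Real.hasDerivAt_sin θ).mul (hd.comp θ hU)).const_mul (σ / 2))
      refine this.congr_deriv ?_
      rw [hds]
      simp only [Function.comp]
      have hU' := hxi θ
      have hsc := Real.sin_sq_add_cos_sq θ
      change _ = _ - (_ + 1 / 2 * h (gapPoint x p q θ))
      have e2 : gapPoint x p q θ - c =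
          x i - c + σ * ((x q - x p) / 2) * (1 - σ * Real.cos θ) := by rw [← hU']; ring
      rw [e2]
      generalize deriv h (gapPoint x p q θ) = d
      linear_combination σ * ((x q - x p) / 4) * d * hsc +
        σ * ((x q - x p) / 4) * d * (Real.cos θ) ^ 2 * hσ2
    rw [intervalIntegral.integral_eq_sub_of_hasDerivAt (fun θ _ => hprim θ)
      (cont.intervalIntegrable _ _)]
    simp
  · rw [not_or] at hi
    have hi' : i ∈ (Finset.univ.erase p).erase q := by simp [hi.1, hi.2]
    rw [intervalIntegral.integral_congr (g := fun _ => (0 : ℝ)), intervalIntegral.integral_zero]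
    intro θ _
    simp only
    rw [fderiv_gap_eq hpq hx (hasDerivAt_gap_other c (s + 1) hpq hx θ hi.1 hi.2),
      fderiv_gap_eq hpq hx (hasDerivAt_gap_other c s hpq hx θ hi.1 hi.2)]
    have := gapPoint_ne hx hpq θ hi'
    field_simp
    ring

end Gap

section PartialDeriv

variable {m : ℕ}

lemma partialDeriv_congr {U : Set (Fin m → ℝ)} (hU : IsOpen U) {f g : (Fin m → ℝ) → ℂ}
    (h : ∀ x ∈ U, f x = g x) {x : Fin m → ℝ} (hx : x ∈ U) (i : Fin m) :
    partialDeriv i f x = partialDeriv i g x := by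
  have : f =ᶠ[𝓝 x] g := by filter_upwards [hU.mem_nhds hx] with y hy using h y hy
  rw [partialDeriv, this.fderiv_eq, partialDeriv]

lemma partialDeriv_add {f g : (Fin m → ℝ) → ℂ} {x : Fin m → ℝ} (hf : DifferentiableAt ℝ f x)
    (hg : DifferentiableAt ℝ g x) (i : Fin m) :
    partialDeriv i (fun y => f y + g y) x = partialDeriv i f x + partialDeriv i g x := by
  simp only [partialDeriv]
  rw [fderiv_fun_add hf hg]; rfl

lemma partialDeriv_const_mul {f : (Fin m → ℝ) → ℂ} {x : Fin m → ℝ}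
    (hf : DifferentiableAt ℝ f x) (c : ℂ) (i : Fin m) :
    partialDeriv i (fun y => c * f y) x = c * partialDeriv i f x := by
  simp only [partialDeriv]
  rw [fderiv_const_mul hf]; rfl

lemma partialDeriv_mul {f g : (Fin m → ℝ) → ℂ} {x : Fin m → ℝ} (hf : DifferentiableAt ℝ f x)
    (hg : DifferentiableAt ℝ g x) (i : Fin m) :
    partialDeriv i (fun y => f y * g y) x = partialDeriv i f x * g x + f x * partialDeriv i g x := by
  simp only [partialDeriv]
  rw [fderiv_fun_mul hf hg]
  simp only [add_apply, smul_apply, smul_eq_mul]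
  ring

lemma partialDeriv_ofReal {f : (Fin m → ℝ) → ℝ} {x : Fin m → ℝ} (hf : DifferentiableAt ℝ f x)
    (i : Fin m) : partialDeriv i (fun y => (f y : ℂ)) x = (fderiv ℝ f x (Pi.single i 1) : ℝ) := by
  have h : HasFDerivAt (fun y => (f y : ℂ)) (Complex.ofRealCLM.comp (fderiv ℝ f x)) x :=
    Complex.ofRealCLM.hasFDerivAt.comp x hf.hasFDerivAt
  rw [partialDeriv, h.fderiv]; rfl

lemma partialDeriv_eq_of_line {f : (Fin m → ℝ) → ℂ} {x : Fin m → ℝ} (hf : DifferentiableAt ℝ f x)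
    {i : Fin m} {d : ℂ} (h : HasDerivAt (fun t : ℝ => f (x + t • Pi.single i 1)) d 0) :
    partialDeriv i f x = d := by
  rw [partialDeriv, ← hf.lineDeriv_eq_fderiv]; exact h.deriv

lemma contDiffOn_partialDeriv {U : Set (Fin m → ℝ)} (hU : IsOpen U) {f : (Fin m → ℝ) → ℂ}
    (hf : ContDiffOn ℝ 2 f U) (i : Fin m) : ContDiffOn ℝ 1 (partialDeriv i f) U :=
  (hf.fderiv_of_isOpen hU (m := 1) (by norm_num)).clm_apply contDiffOn_const

lemma partialDeriv_comm {U : Set (Fin m → ℝ)} (hU : IsOpen U) {f : (Fin m → ℝ) → ℂ}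
    (hf : ContDiffOn ℝ 2 f U) {x : Fin m → ℝ} (hx : x ∈ U) (i j : Fin m) :
    partialDeriv i (partialDeriv j f) x = partialDeriv j (partialDeriv i f) x := by
  have hat : ContDiffAt ℝ 2 f x := hf.contDiffAt (hU.mem_nhds hx)
  have hs := hat.isSymmSndFDerivAt (by simp)
  have hd : DifferentiableAt ℝ (fderiv ℝ f) x :=
    ((hf.fderiv_of_isOpen hU (m := 1) (by norm_num)).differentiableOn (by norm_num)).differentiableAt
      (hU.mem_nhds hx)
  have key : ∀ v w : Fin m → ℝ, fderiv ℝ (fun y => fderiv ℝ f y v) x w =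
      fderiv ℝ (fderiv ℝ f) x w v := by
    intro v w
    rw [fderiv_clm_apply hd (differentiableAt_const v)]
    simp
  unfold partialDeriv
  rw [key, key]
  exact hs _ _

end PartialDeriv

/-- A family of functions satisfying the differential relations of the moments
`∫ (u - c)^s ∏_k (u - x_k)^{-1/2} du` along a cycle. -/
structure IsPeriodFamily {m : ℕ} (c : ℝ) (P : ℕ → (Fin m → ℝ) → ℂ) : Prop where
  contDiffOn : ∀ s, ContDiffOn ℝ 2 (P s) {x | StrictMono x}
  recurrence : ∀ s i x, StrictMono x → partialDeriv i (P (s + 1)) x =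
    (x i - c : ℝ) * partialDeriv i (P s) x + 1 / 2 * P s x
  translate : ∀ s x, StrictMono x → ∑ i, partialDeriv i (P s) x = s * P (s - 1) x

namespace IsPeriodFamily

variable {m : ℕ} {c : ℝ} {P Q : ℕ → (Fin m → ℝ) → ℂ}

lemma differentiableAt (hP : IsPeriodFamily c P) (s : ℕ) {x : Fin m → ℝ} (hx : StrictMono x) :
    DifferentiableAt ℝ (P s) x :=
  ((hP.contDiffOn s).differentiableOn (by norm_num)).differentiableAt
    ((isOpen_strictMono m).mem_nhds hx)

lemma differentiableAt_partialDeriv (hP : IsPeriodFamily c P) (s : ℕ) {x : Fin m → ℝ}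
    (hx : StrictMono x) (i : Fin m) : DifferentiableAt ℝ (partialDeriv i (P s)) x :=
  ((contDiffOn_partialDeriv (isOpen_strictMono m) (hP.contDiffOn s) i).differentiableOn
    (by norm_num)).differentiableAt ((isOpen_strictMono m).mem_nhds hx)

lemma zero : IsPeriodFamily c (fun _ _ => 0 : ℕ → (Fin m → ℝ) → ℂ) where
  contDiffOn _ := contDiffOn_const
  recurrence s i x _ := by simp [partialDeriv]
  translate s x _ := by simp [partialDeriv]

lemma add (hP : IsPeriodFamily c P) (hQ : IsPeriodFamily c Q) :
    IsPeriodFamily c fun s x => P s x + Q s x where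
  contDiffOn s := (hP.contDiffOn s).add (hQ.contDiffOn s)
  recurrence s i x hx := by
    rw [partialDeriv_add (hP.differentiableAt _ hx) (hQ.differentiableAt _ hx),
      partialDeriv_add (hP.differentiableAt _ hx) (hQ.differentiableAt _ hx),
      hP.recurrence s i x hx, hQ.recurrence s i x hx]
    ring
  translate s x hx := by
    simp only [fun i => partialDeriv_add (hP.differentiableAt s hx) (hQ.differentiableAt s hx) i]
    rw [Finset.sum_add_distrib, hP.translate s x hx, hQ.translate s x hx, mul_add]

lemma const_mul (hP : IsPeriodFamily c P) (a : ℂ) : IsPeriodFamily c fun s x => a * P s x where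
  contDiffOn s := contDiffOn_const.mul (hP.contDiffOn s)
  recurrence s i x hx := by
    rw [partialDeriv_const_mul (hP.differentiableAt _ hx),
      partialDeriv_const_mul (hP.differentiableAt _ hx), hP.recurrence s i x hx]
    ring
  translate s x hx := by
    simp only [fun i => partialDeriv_const_mul (hP.differentiableAt s hx) a i]
    rw [← Finset.mul_sum, hP.translate s x hx]
    ring

lemma congr (hP : IsPeriodFamily c P) (h : ∀ s x, StrictMono x → Q s x = P s x) :
    IsPeriodFamily c Q where
  contDiffOn s := (hP.contDiffOn s).congr fun x hx => h s x hx
  recurrence s i x hx := by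
    rw [partialDeriv_congr (isOpen_strictMono m) (h (s + 1)) hx,
      partialDeriv_congr (isOpen_strictMono m) (h s) hx, h s x hx, hP.recurrence s i x hx]
  translate s x hx := by
    simp only [partialDeriv_congr (isOpen_strictMono m) (h s) hx]
    rw [h _ x hx, hP.translate s x hx]

lemma sum {ι : Type*} (t : Finset ι) {R : ι → ℕ → (Fin m → ℝ) → ℂ}
    (h : ∀ k ∈ t, IsPeriodFamily c (R k)) : IsPeriodFamily c fun s x => ∑ k ∈ t, R k s x := by
  classical
  induction t using Finset.induction_on with
  | empty => simpa using zero
  | insert a t ha ih =>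
    refine ((h a (Finset.mem_insert_self _ _)).add
      (ih fun k hk => h k (Finset.mem_insert_of_mem hk))).congr fun s x _ => ?_
    rw [Finset.sum_insert ha]

lemma gap (c : ℝ) {p q : Fin m} (hpq : (q : ℕ) = p + 1) :
    IsPeriodFamily c fun s x => (gapMoment x c s p q : ℂ) := by
  have hd : ∀ s x, StrictMono x → DifferentiableAt ℝ (fun x : Fin m → ℝ => gapMoment x c s p q) x :=
    fun s x hx => ((contDiffOn_gapMoment c s hpq).differentiableOn (by norm_num)).differentiableAt
      ((isOpen_strictMono m).mem_nhds hx)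
  refine ⟨fun s => Complex.ofRealCLM.contDiff.comp_contDiffOn (contDiffOn_gapMoment c s hpq),
    fun s i x hx => ?_, fun s x hx => ?_⟩
  · rw [partialDeriv_ofReal (hd _ x hx), partialDeriv_ofReal (hd _ x hx),
      gapMoment_recurrence c s hpq hx i]
    push_cast; ring
  · simp only [partialDeriv_ofReal (hd s x hx)]
    rw [← Complex.ofReal_sum, ← map_sum, ← Complex.ofReal_natCast, ← Complex.ofReal_mul,
      ← gapMoment_translate c s hpq hx]
    congr 3
    funext i
    simp [Finset.sum_apply, Pi.single_apply]

lemma moment (c : ℝ) {p q : Fin m} (hpq : p ≤ q) :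
    IsPeriodFamily c fun s x => moment x c s p q := by
  obtain ⟨d, hd⟩ : ∃ d, (q : ℕ) = p + d := Nat.exists_eq_add_of_le hpq
  induction d generalizing q with
  | zero =>
    have : p = q := Fin.ext (by omega)
    subst this
    refine zero.congr fun s x _ => ?_
    simp [_root_.moment]
  | succ d ih =>
    have hlt : (p : ℕ) + d < m := by omega
    have h1 := ih (q := ⟨p + d, hlt⟩) (by rw [Fin.le_def]; simp) rfl
    have h2 : (q : ℕ) = (⟨p + d, hlt⟩ : Fin m) + 1 := by simp only; omega
    refine (h1.add ((gap c h2).const_mul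
      ((-Complex.I) ^ (Finset.Ioi (⟨p + d, hlt⟩ : Fin m)).card))).congr fun s x hx => ?_
    rw [← moment_add hx.injective c s p ⟨p + d, hlt⟩ q, moment_eq_gapMoment hx c s h2]

/-- The Euler-Poisson-Darboux equation. -/
lemma euler_darboux (hP : IsPeriodFamily c P) (s : ℕ) {x : Fin m → ℝ} (hx : StrictMono x)
    {i j : Fin m} (hij : i ≠ j) : (x i - x j : ℝ) * partialDeriv i (partialDeriv j (P s)) x =
      1 / 2 * (partialDeriv i (P s) x - partialDeriv j (P s) x) := by
  have key : ∀ i j : Fin m, i ≠ j → partialDeriv j (partialDeriv i (P (s + 1))) x =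
      (x i - c : ℝ) * partialDeriv j (partialDeriv i (P s)) x +
        1 / 2 * partialDeriv j (P s) x := by
    intro i j hij
    have hl : DifferentiableAt ℝ (fun y : Fin m → ℝ => ((y i - c : ℝ) : ℂ)) x := by fun_prop
    have hl0 : partialDeriv j (fun y : Fin m → ℝ => ((y i - c : ℝ) : ℂ)) x = 0 := by
      refine partialDeriv_eq_of_line hl ?_
      simp only [Pi.add_apply, Pi.smul_apply, Pi.single_eq_of_ne hij, smul_zero, add_zero]
      exact hasDerivAt_const _ _
    have hd := hP.differentiableAt_partialDeriv s hx i
    have hmul : DifferentiableAt ℝ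
        (fun y : Fin m → ℝ => ((y i - c : ℝ) : ℂ) * partialDeriv i (P s) y) x := hl.mul hd
    have hhalf : DifferentiableAt ℝ (fun y => 1 / 2 * P s y) x :=
      (hP.differentiableAt s hx).const_mul _
    rw [partialDeriv_congr (isOpen_strictMono m) (hP.recurrence s i) hx,
      partialDeriv_add hmul hhalf,
      partialDeriv_mul hl hd, hl0, partialDeriv_const_mul (hP.differentiableAt s hx)]
    ring
  have e1 := key i j hij
  have e2 := key j i hij.symm
  have c1 := partialDeriv_comm (isOpen_strictMono m) (hP.contDiffOn (s + 1)) hx i j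
  have c2 := partialDeriv_comm (isOpen_strictMono m) (hP.contDiffOn s) hx i j
  rw [← c1] at e1
  rw [← c2] at e1
  rw [e1] at e2
  push_cast at e2 ⊢
  linear_combination e2

lemma partialDeriv_succ (hP : IsPeriodFamily c P) (s : ℕ) {x : Fin m → ℝ} (hx : StrictMono x)
    {j : Fin m} (hj : x j = c) : partialDeriv j (P (s + 1)) x = 1 / 2 * P s x := by
  rw [hP.recurrence s j x hx, hj]; simp

lemma partialDeriv_partialDeriv_succ (hP : IsPeriodFamily c P) (s : ℕ) {x : Fin m → ℝ}
    (hx : StrictMono x) {j : Fin m} (hj : x j = c) :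
    partialDeriv j (partialDeriv j (P (s + 1))) x = 3 / 2 * partialDeriv j (P s) x := by
  have hl : DifferentiableAt ℝ (fun y : Fin m → ℝ => ((y j - c : ℝ) : ℂ)) x := by fun_prop
  have hl0 : partialDeriv j (fun y : Fin m → ℝ => ((y j - c : ℝ) : ℂ)) x = 1 := by
    refine partialDeriv_eq_of_line hl ?_
    simp only [Pi.add_apply, Pi.smul_apply, Pi.single_eq_same, smul_eq_mul, mul_one]
    have := (((hasDerivAt_id (0 : ℝ)).const_add (x j)).sub_const c).ofReal_comp
    simpa using this
  have hd := hP.differentiableAt_partialDeriv s hx j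
  have hmul : DifferentiableAt ℝ
      (fun y : Fin m → ℝ => ((y j - c : ℝ) : ℂ) * partialDeriv j (P s) y) x := hl.mul hd
  have hhalf : DifferentiableAt ℝ (fun y => 1 / 2 * P s y) x :=
    (hP.differentiableAt s hx).const_mul _
  rw [partialDeriv_congr (isOpen_strictMono m) (hP.recurrence s j) hx,
    partialDeriv_add hmul hhalf,
    partialDeriv_mul hl hd, hl0, partialDeriv_const_mul (hP.differentiableAt s hx), hj]
  simp; ring

lemma sum_difference_quotients (hP : IsPeriodFamily c P) (s : ℕ) {x : Fin m → ℝ}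
    (hx : StrictMono x) (j : Fin m) :
    ∑ i ∈ Finset.univ.erase j, ((x j - x i : ℝ) : ℂ)⁻¹ *
        (partialDeriv i (P s) x - partialDeriv j (P s) x) =
      2 * (partialDeriv j (partialDeriv j (P s)) x - s * partialDeriv j (P (s - 1)) x) := by
  have h1 : ∀ i ∈ Finset.univ.erase j, ((x j - x i : ℝ) : ℂ)⁻¹ *
      (partialDeriv i (P s) x - partialDeriv j (P s) x) =
      -2 * partialDeriv j (partialDeriv i (P s)) x := by
    intro i hi
    have hij := (Finset.mem_erase.1 hi).1
    have hne : ((x j - x i : ℝ) : ℂ) ≠ 0 :=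
      Complex.ofReal_ne_zero.2 (sub_ne_zero.2 fun h => hij (hx.injective h).symm)
    have h := hP.euler_darboux s hx hij
    rw [partialDeriv_comm (isOpen_strictMono m) (hP.contDiffOn s) hx] at h
    rw [inv_mul_eq_iff_eq_mul₀ hne]
    push_cast at h ⊢
    linear_combination -2 * h
  have h2 : partialDeriv j (fun y => ∑ i, partialDeriv i (P s) y) x =
      ∑ i, partialDeriv j (partialDeriv i (P s)) x := by
    change fderiv ℝ (fun y => ∑ i, partialDeriv i (P s) y) x (Pi.single j 1) = _
    rw [fderiv_fun_sum fun i _ => hP.differentiableAt_partialDeriv s hx i]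
    simp [partialDeriv]
  rw [partialDeriv_congr (isOpen_strictMono m) (hP.translate s) hx,
    partialDeriv_const_mul (hP.differentiableAt _ hx),
    ← Finset.add_sum_erase _ _ (Finset.mem_univ j)] at h2
  rw [Finset.sum_congr rfl h1, ← Finset.mul_sum]
  linear_combination 2 * h2

end IsPeriodFamily

section Determinant

variable {m n : ℕ}

/-- The determinant as a continuous real-multilinear function of the rows. -/
def detRowCMM (n : ℕ) : ContinuousMultilinearMap ℝ (fun _ : Fin n => Fin n → ℂ) ℂ where
  toMultilinearMap :=
    (Matrix.detRowAlternating (n := Fin n) (R := ℂ)).toMultilinearMap.restrictScalars ℝ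
  cont := Continuous.matrix_det continuous_id

lemma detRowCMM_apply (v : Fin n → Fin n → ℂ) : detRowCMM n v = (Matrix.of v).det := rfl

lemma detRowCMM_eq_zero {v : Fin n → Fin n → ℂ} {s t : Fin n} (hst : s ≠ t) {a : ℂ}
    (h : v s = a • v t) : detRowCMM n v = 0 := by
  have hv : v = Function.update v s (a • v t) := by rw [← h, Function.update_eq_self]
  have := (Matrix.detRowAlternating (n := Fin n) (R := ℂ)).map_update_smul v s a (v t)
  rw [← hv] at this
  change Matrix.detRowAlternating v = 0
  rw [this, AlternatingMap.map_eq_zero_of_eq _ _ (i := s) (j := t) _ hst, smul_zero]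
  rw [Function.update_self, Function.update_of_ne hst.symm]

lemma detRowCMM_update_smul (v : Fin n → Fin n → ℂ) (s : Fin n) (a : ℂ) (w : Fin n → ℂ) :
    detRowCMM n (Function.update v s (a • w)) = a * detRowCMM n (Function.update v s w) :=
  (Matrix.detRowAlternating (n := Fin n) (R := ℂ)).map_update_smul v s a w

lemma contDiffOn_detRow {U : Set (Fin m → ℝ)} {k : WithTop ℕ∞}
    {f : Fin n → Fin n → (Fin m → ℝ) → ℂ} (hf : ∀ s r, ContDiffOn ℝ k (f s r) U) :
    ContDiffOn ℝ k (fun y => detRowCMM n fun s r => f s r y) U :=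
  (detRowCMM n).contDiff.comp_contDiffOn
    (contDiffOn_pi.2 fun s => contDiffOn_pi.2 fun r => hf s r)

lemma partialDeriv_detRow {f : Fin n → Fin n → (Fin m → ℝ) → ℂ} {x : Fin m → ℝ}
    (hf : ∀ s r, DifferentiableAt ℝ (f s r) x) (i : Fin m) :
    partialDeriv i (fun y => detRowCMM n fun s r => f s r y) x =
      ∑ s, detRowCMM n (Function.update (fun s r => f s r x) s fun r => partialDeriv i (f s r) x) := by
  have h1 : ∀ s, HasFDerivAt (fun y r => f s r y)
      (ContinuousLinearMap.pi fun r => fderiv ℝ (f s r) x) x := fun s =>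
    hasFDerivAt_pi.2 fun r => (hf s r).hasFDerivAt
  have h2 := HasFDerivAt.multilinear_comp (detRowCMM n) h1
  rw [partialDeriv, h2.fderiv]
  simp only [sum_apply, ContinuousLinearMap.comp_apply,
    ContinuousMultilinearMap.toContinuousLinearMap_apply]
  rfl

end Determinant

section PeriodDeterminant

variable {m n : ℕ} {c : ℝ} {P : Fin n → ℕ → (Fin m → ℝ) → ℂ}

/-- Second order equation for the determinant of a period matrix. -/
theorem period_det_second_order (hP : ∀ r, IsPeriodFamily c (P r)) {x : Fin m → ℝ}
    (hx : StrictMono x) {j : Fin m} (hj : x j = c) {D : (Fin m → ℝ) → ℂ}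
    (hD : D = fun y => detRowCMM n fun s r => P r s y) :
    2 * partialDeriv j (partialDeriv j D) x =
      ∑ i ∈ Finset.univ.erase j, ((x j - x i : ℝ) : ℂ)⁻¹ *
        (partialDeriv i D x - partialDeriv j D x) := by
  have hdP : ∀ {y : Fin m → ℝ}, StrictMono y → ∀ s r : Fin n, DifferentiableAt ℝ (P r s) y :=
    fun hy s r => (hP r).differentiableAt s hy
  set v : Fin n → Fin n → ℂ := fun s r => P r s x with hv
  set d : ℕ → Fin n → ℂ := fun s r => partialDeriv j (P r s) x with hd
  set e : ℕ → Fin n → ℂ := fun s r => partialDeriv j (partialDeriv j (P r s)) x with he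
  have hd_succ : ∀ (s t : Fin n), (s : ℕ) = t + 1 → d s = (1 / 2 : ℂ) • v t := by
    intro s t h
    ext r
    simp only [hd, hv, h, Pi.smul_apply, smul_eq_mul]
    exact (hP r).partialDeriv_succ t hx hj
  have he_succ : ∀ (s : ℕ), e (s + 1) = (3 / 2 : ℂ) • d s := by
    intro s
    ext r
    exact (hP r).partialDeriv_partialDeriv_succ s hx hj
  have hD1 : ∀ i {y : Fin m → ℝ}, StrictMono y → partialDeriv i D y = ∑ s, detRowCMM n
      (Function.update (fun s r => P r s y) s fun r => partialDeriv i (P r s) y) := by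
    intro i y hy
    rw [hD]
    exact partialDeriv_detRow (f := fun s r => P r s) (hdP hy) i
  set H : Fin n → Fin n → ℂ := fun s t => detRowCMM n
    (Function.update (Function.update v s (d s)) t (if t = s then e s else d t)) with hH
  have hD2 : partialDeriv j (partialDeriv j D) x = ∑ s, ∑ t, H s t := by
    rw [partialDeriv_congr (isOpen_strictMono m) (fun y hy => hD1 j hy) hx]
    have hform : ∀ (s : Fin n) (y : Fin m → ℝ), (Function.update (fun (s : Fin n) r => P r s y) s
        fun r => partialDeriv j (P r s) y) =
        fun (t : Fin n) r => (if t = s then partialDeriv j (P r t) else P r t) y := by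
      intro s y
      ext t r
      by_cases h : t = s
      · subst h; simp
      · simp [h]
    have hdiff : ∀ s t r : Fin n,
        DifferentiableAt ℝ (if t = s then partialDeriv j (P r t) else P r t) x := by
      intro s t r
      split_ifs
      · exact (hP r).differentiableAt_partialDeriv t hx j
      · exact hdP hx t r
    simp only [hform]
    have hsum : partialDeriv j (fun y => ∑ s : Fin n, detRowCMM n fun t r =>
        (if t = s then partialDeriv j (P r t) else P r t) y) x = ∑ s : Fin n,
        partialDeriv j (fun y => detRowCMM n fun t r =>
          (if t = s then partialDeriv j (P r t) else P r t) y) x := by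
      unfold partialDeriv
      rw [fderiv_fun_sum]
      · simp
      · intro s _
        exact (((detRowCMM n).contDiff (n := 1)).differentiable (by norm_num) _).comp x
          (differentiableAt_pi.2 fun t => differentiableAt_pi.2 fun r => hdiff s t r)
    rw [hsum]
    refine Finset.sum_congr rfl fun s _ => ?_
    rw [partialDeriv_detRow (hdiff s)]
    refine Finset.sum_congr rfl fun t _ => ?_
    rw [hH]
    congr 1
    rw [← hform]
    congr 1
    ext r
    by_cases h : t = s
    · subst h; simp [he]
    · simp [h, hd]
  have hR : ∑ i ∈ Finset.univ.erase j, ((x j - x i : ℝ) : ℂ)⁻¹ *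
      (partialDeriv i D x - partialDeriv j D x) =
      ∑ s : Fin n, 2 * (detRowCMM n (Function.update v s (e s)) -
        s * detRowCMM n (Function.update v s (d (s - 1)))) := by
    simp only [hD1 _ hx, ← Finset.sum_sub_distrib, Finset.mul_sum]
    rw [Finset.sum_comm]
    refine Finset.sum_congr rfl fun s _ => ?_
    let ℓ : (Fin n → ℂ) →ₗ[ℂ] ℂ :=
      (Matrix.detRowAlternating (n := Fin n) (R := ℂ)).toMultilinearMap.toLinearMap v s
    have hℓ : ∀ w, detRowCMM n (Function.update v s w) = ℓ w := fun w => rfl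
    simp only [← hv, hℓ]
    have h2 : ∀ i, ((x j - x i : ℝ) : ℂ)⁻¹ * (ℓ (fun r => partialDeriv i (P r s) x) -
        ℓ (fun r => partialDeriv j (P r s) x)) = ℓ (((x j - x i : ℝ) : ℂ)⁻¹ •
        ((fun r => partialDeriv i (P r s) x) - (fun r => partialDeriv j (P r s) x))) := by
      intro i; rw [map_smul, map_sub, smul_eq_mul]
    simp only [h2]
    rw [← map_sum, ← smul_eq_mul (s : ℂ), ← map_smul, ← map_sub, ← smul_eq_mul, ← map_smul]
    congr 1
    ext r
    have := (hP r).sum_difference_quotients s hx j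
    simp only [Finset.sum_apply, Pi.smul_apply, Pi.sub_apply, smul_eq_mul]
    rw [this]
  rw [hD2, hR]
  have hH_symm : ∀ s t : Fin n, s ≠ t → H s t = H t s := by
    intro s t hst
    simp only [hH, if_neg hst, if_neg hst.symm]
    rw [Function.update_comm hst]
  have hH_zero : ∀ s t : Fin n, 2 ≤ (s : ℕ) → H s t = 0 := by
    intro s t hs
    obtain ⟨s', hs'⟩ : ∃ s' : Fin n, (s : ℕ) = s' + 1 := ⟨⟨s - 1, by omega⟩, by simp; omega⟩
    obtain ⟨s'', hs''⟩ : ∃ s'' : Fin n, (s' : ℕ) = s'' + 1 := ⟨⟨s' - 1, by omega⟩, by simp; omega⟩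
    have n1 : s ≠ s' := by rw [Ne, Fin.ext_iff]; omega
    have n2 : s ≠ s'' := by rw [Ne, Fin.ext_iff]; omega
    have n3 : s' ≠ s'' := by rw [Ne, Fin.ext_iff]; omega
    by_cases hts : t = s
    · subst hts
      simp only [hH, if_true, Function.update_idem]
      refine detRowCMM_eq_zero n2 (a := 3 / 4) ?_
      rw [Function.update_self, Function.update_of_ne n2.symm, hs', he_succ, hd_succ _ _ hs'',
        smul_smul]
      norm_num
    · simp only [hH, if_neg hts]
      by_cases hts' : t = s'
      · subst hts'
        refine detRowCMM_eq_zero n3 (a := 1 / 2) ?_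
        rw [Function.update_self, Function.update_of_ne n3.symm, Function.update_of_ne n2.symm,
          hd_succ _ _ hs'']
      · refine detRowCMM_eq_zero n1 (a := 1 / 2) ?_
        rw [Function.update_of_ne (Ne.symm hts), Function.update_self,
          Function.update_of_ne (Ne.symm hts'), Function.update_of_ne n1.symm, hd_succ _ _ hs']
  have hR_zero : ∀ s : Fin n, 2 ≤ (s : ℕ) → 2 * (detRowCMM n (Function.update v s (e s)) -
        s * detRowCMM n (Function.update v s (d (s - 1)))) = 0 := by
    intro s hs
    have h0 := hH_zero s s hs
    simp only [hH, if_true, Function.update_idem] at h0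
    obtain ⟨s', hs'⟩ : ∃ s' : Fin n, (s : ℕ) = s' + 1 := ⟨⟨s - 1, by omega⟩, by simp; omega⟩
    obtain ⟨s'', hs''⟩ : ∃ s'' : Fin n, (s' : ℕ) = s'' + 1 := ⟨⟨s' - 1, by omega⟩, by simp; omega⟩
    have n2 : s ≠ s'' := by rw [Ne, Fin.ext_iff]; omega
    rw [h0, detRowCMM_eq_zero n2 (a := 1 / 2)]
    · simp
    · rw [Function.update_self, Function.update_of_ne n2.symm, hs', Nat.add_sub_cancel,
        hd_succ _ _ hs'']
  clear hD2 hR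
  rcases n with _ | _ | k
  · simp
  · simp [hH]
  ·
    rw [Fin.sum_univ_succ, Fin.sum_univ_succ (n := k),
      Finset.sum_eq_zero fun s _ => Finset.sum_eq_zero fun t _ => hH_zero _ t (by simp),
      Fin.sum_univ_succ, Fin.sum_univ_succ (n := k), Fin.sum_univ_succ (n := k + 1) (f := H _),
      Fin.sum_univ_succ (n := k),
      Finset.sum_eq_zero fun t _ => (?_ : H 0 (Fin.succ (Fin.succ t)) = 0),
      Finset.sum_eq_zero fun t _ => (?_ : H (Fin.succ 0) (Fin.succ (Fin.succ t)) = 0),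
      Fin.sum_univ_succ, Fin.sum_univ_succ (n := k),
      Finset.sum_eq_zero fun t _ => hR_zero _ (by simp)]
    rotate_left
    · rw [hH_symm _ _ (by simp [Fin.ext_iff])]; exact hH_zero _ _ (by simp)
    · rw [hH_symm _ _ (by simp [Fin.ext_iff])]; exact hH_zero _ _ (by simp)
    have h01 : (0 : Fin (k + 2)) ≠ 1 := by simp
    have hd1 : d 1 = (1 / 2 : ℂ) • v 0 := by simpa using hd_succ 1 0 (by simp)
    have he1 : e 1 = (3 / 2 : ℂ) • d 0 := he_succ 0
    have h10 : H 1 0 = H 0 1 := hH_symm _ _ h01.symm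
    have hH11 : H 1 1 = 3 / 2 * detRowCMM (k + 2) (Function.update v 1 (d 0)) := by
      simp only [hH, if_true, Function.update_idem, Fin.val_one, he1, detRowCMM_update_smul]
    have hH01 : H 0 1 = -1 / 2 * detRowCMM (k + 2) (Function.update v 1 (d 0)) := by
      simp only [hH, if_neg h01.symm, Fin.val_one, Fin.val_zero, hd1, detRowCMM_update_smul]
      have hsw : Function.update (Function.update v 0 (d 0)) 1 (v 0) =
          (Function.update v 1 (d 0)) ∘ Equiv.swap 0 1 := by
        ext t r
        by_cases h0 : t = 0
        · subst h0; simp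
        · by_cases h1 : t = 1
          · subst h1; simp [h01]
          · simp [h0, h1, Equiv.swap_apply_of_ne_of_ne h0 h1]
      have := (Matrix.detRowAlternating (n := Fin (k + 2)) (R := ℂ)).map_swap
        (Function.update v 1 (d 0)) h01
      rw [hsw]
      change 1 / 2 * Matrix.detRowAlternating _ = -1 / 2 * Matrix.detRowAlternating _
      rw [this]; ring
    have hH00 : H 0 0 = detRowCMM (k + 2) (Function.update v 0 (e 0)) := by
      simp only [hH, if_true, Function.update_idem, Fin.val_zero]
    simp only [Fin.succ_zero_eq_one, h10, hH11, hH01, hH00, Fin.val_zero, Fin.val_one, he1,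
      detRowCMM_update_smul]
    simp
    ring

end PeriodDeterminant

section Vandermonde

variable {m : ℕ}

/-- The logarithm of `vdmQuarter`, as a symmetric sum over all ordered pairs. -/
def logVdm (x : Fin m → ℝ) : ℝ := 1 / 8 * ∑ i, ∑ j, Real.log (x j - x i)

lemma vdmQuarter_pos {x : Fin m → ℝ} (hx : StrictMono x) : 0 < vdmQuarter x :=
  Finset.prod_pos fun _ _ => Finset.prod_pos fun _ hj =>
    Real.rpow_pos_of_pos (sub_pos.2 (hx (Finset.mem_Ioi.1 hj))) _

lemma sum_sum_eq_two_mul_sum_Ioi (f : Fin m → Fin m → ℝ) (hs : ∀ i j, f i j = f j i)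
    (h0 : ∀ i, f i i = 0) : ∑ i, ∑ j, f i j = 2 * ∑ i, ∑ j ∈ Finset.Ioi i, f i j := by
  have h1 : ∀ i, ∑ j, f i j = ∑ j ∈ Finset.Ioi i, f i j + ∑ j ∈ Finset.Iio i, f i j := by
    intro i
    rw [← Finset.add_sum_erase _ _ (Finset.mem_univ i), h0, zero_add, ← Finset.sum_union]
    · congr 1
      ext j; simp [lt_or_lt_iff_ne, ne_comm]
    · exact Finset.disjoint_left.2 fun j hj hj' =>
        lt_asymm (Finset.mem_Ioi.1 hj) (Finset.mem_Iio.1 hj')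
  have h2 : ∑ i, ∑ j ∈ Finset.Iio i, f i j = ∑ i, ∑ j ∈ Finset.Ioi i, f i j := by
    rw [Finset.sum_comm' (t' := Finset.univ) (s' := fun j => Finset.Ioi j) (by simp)]
    exact Finset.sum_congr rfl fun i _ => Finset.sum_congr rfl fun j _ => hs _ _
  simp only [h1, Finset.sum_add_distrib, h2]; ring

lemma vdmQuarter_eq_exp {x : Fin m → ℝ} (hx : StrictMono x) :
    vdmQuarter x = Real.exp (logVdm x) := by
  rw [logVdm, sum_sum_eq_two_mul_sum_Ioi _ (fun i j => by rw [← Real.log_neg_eq_log, neg_sub])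
    (fun i => by simp), vdmQuarter, ← mul_assoc, Finset.mul_sum, Real.exp_sum]
  refine Finset.prod_congr rfl fun i _ => ?_
  rw [Finset.mul_sum, Real.exp_sum]
  refine Finset.prod_congr rfl fun j hj => ?_
  rw [Real.rpow_def_of_pos (sub_pos.2 (hx (Finset.mem_Ioi.1 hj)))]
  congr 1; ring

lemma contDiffOn_logVdm {n : WithTop ℕ∞} :
    ContDiffOn ℝ n (logVdm (m := m)) {x | StrictMono x} := by
  refine contDiffOn_const.mul (ContDiffOn.sum fun i _ => ContDiffOn.sum fun j _ => ?_)
  by_cases h : i = j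
  · subst h; simpa using contDiffOn_const
  · exact ContDiffOn.log (by fun_prop) fun x hx => sub_ne_zero.2 fun e => h (hx.injective e).symm

lemma fderiv_logVdm {x : Fin m → ℝ} (hx : StrictMono x) (k : Fin m) :
    fderiv ℝ logVdm x (Pi.single k 1) = 1 / 4 * ∑ l, (x k - x l)⁻¹ := by
  have hd : DifferentiableAt ℝ logVdm x :=
    ((contDiffOn_logVdm (n := 1)).differentiableOn (by norm_num)).differentiableAt
      ((isOpen_strictMono m).mem_nhds hx)
  rw [← hd.lineDeriv_eq_fderiv]
  have h1 : ∀ i j : Fin m, HasDerivAt (fun t : ℝ => Real.log ((x + t • Pi.single k 1 : Fin m → ℝ) j -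
      (x + t • Pi.single k 1 : Fin m → ℝ) i))
      (((Pi.single k 1 : Fin m → ℝ) j - (Pi.single k 1 : Fin m → ℝ) i) / (x j - x i)) 0 := by
    intro i j
    by_cases h : i = j
    · subst h; simpa using hasDerivAt_const (0 : ℝ) (0 : ℝ)
    · have hl : ∀ i, HasDerivAt (fun t : ℝ => (x + t • Pi.single k 1 : Fin m → ℝ) i)
          ((Pi.single k 1 : Fin m → ℝ) i) 0 := by
        intro i
        simpa using ((hasDerivAt_id (0 : ℝ)).mul_const ((Pi.single k 1 : Fin m → ℝ) i)).const_add
          (x i)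
      have := ((hl j).sub (hl i)).log (by
        simpa using sub_ne_zero.2 fun e => h (hx.injective e).symm)
      simpa using this
  have h2 : HasDerivAt (fun t : ℝ => logVdm (x + t • Pi.single k 1))
      (1 / 8 * ∑ i, ∑ j, ((Pi.single k 1 : Fin m → ℝ) j - (Pi.single k 1 : Fin m → ℝ) i) /
        (x j - x i)) 0 :=
    (HasDerivAt.fun_sum fun i _ => HasDerivAt.fun_sum fun j _ => h1 i j).const_mul _
  rw [lineDeriv, h2.deriv]
  simp only [sub_div, Finset.sum_sub_distrib, Pi.single_apply, ite_div, zero_div,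
    Finset.sum_ite_eq', Finset.mem_univ, if_true]
  rw [Finset.sum_comm (f := fun i j => if i = k then 1 / (x j - x i) else 0)]
  simp only [Finset.sum_ite_eq', Finset.mem_univ, if_true, ← Finset.sum_sub_distrib]
  rw [Finset.mul_sum, Finset.mul_sum]
  refine Finset.sum_congr rfl fun l _ => ?_
  rw [← neg_sub (x k) (x l), one_div_neg_eq_neg_one_div]
  ring

/-- The complex-valued version of `vdmQuarter`, smooth on the chamber. -/
lemma contDiffOn_vdmQuarter {n : WithTop ℕ∞} :
    ContDiffOn ℝ n (fun x : Fin m → ℝ => (vdmQuarter x : ℂ)) {x | StrictMono x} :=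
  Complex.ofRealCLM.contDiff.comp_contDiffOn
    (contDiffOn_logVdm.exp.congr fun _ hx => vdmQuarter_eq_exp hx)

lemma partialDeriv_vdmQuarter {x : Fin m → ℝ} (hx : StrictMono x) (k : Fin m) :
    partialDeriv k (fun x => (vdmQuarter x : ℂ)) x =
      1 / 4 * (∑ l, ((x k - x l : ℝ) : ℂ)⁻¹) * vdmQuarter x := by
  have hd : DifferentiableAt ℝ logVdm x :=
    ((contDiffOn_logVdm (n := 1)).differentiableOn (by norm_num)).differentiableAt
      ((isOpen_strictMono m).mem_nhds hx)
  rw [partialDeriv_congr (isOpen_strictMono m) (g := fun x => ((Real.exp (logVdm x) : ℝ) : ℂ))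
    (fun y hy => by rw [vdmQuarter_eq_exp hy]) hx, partialDeriv_ofReal hd.exp, fderiv_exp hd,
    vdmQuarter_eq_exp hx]
  simp only [smul_apply, fderiv_logVdm hx, smul_eq_mul]
  push_cast
  ring

lemma partialDeriv_sum_inv_sub {x : Fin m → ℝ} (hx : StrictMono x) (j : Fin m) :
    DifferentiableAt ℝ (fun y : Fin m → ℝ => ∑ l, ((y j - y l : ℝ) : ℂ)⁻¹) x ∧
    partialDeriv j (fun y => ∑ l, ((y j - y l : ℝ) : ℂ)⁻¹) x =
      -∑ l, ((x j - x l : ℝ) : ℂ)⁻¹ ^ 2 := by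
  have hd : ∀ l : Fin m, DifferentiableAt ℝ (fun y : Fin m → ℝ => ((y j - y l : ℝ) : ℂ)⁻¹) x ∧
      partialDeriv j (fun y : Fin m → ℝ => ((y j - y l : ℝ) : ℂ)⁻¹) x =
        -((x j - x l : ℝ) : ℂ)⁻¹ ^ 2 := by
    intro l
    by_cases h : j = l
    · subst h; simp [partialDeriv]
    · have hne : x j - x l ≠ 0 := sub_ne_zero.2 fun e => h (hx.injective e)
      have hd1 : DifferentiableAt ℝ (fun y : Fin m → ℝ => (y j - y l)⁻¹) x :=
        DifferentiableAt.fun_inv (by fun_prop) hne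
      simp only [← Complex.ofReal_inv]
      refine ⟨Complex.ofRealCLM.differentiableAt.comp x hd1, ?_⟩
      refine partialDeriv_eq_of_line (Complex.ofRealCLM.differentiableAt.comp x hd1) ?_
      have hl : HasDerivAt (fun t : ℝ => (x + t • Pi.single j 1 : Fin m → ℝ) j -
          (x + t • Pi.single j 1 : Fin m → ℝ) l) 1 0 := by
        simp only [Pi.add_apply, Pi.smul_apply, Pi.single_eq_same, Pi.single_eq_of_ne (Ne.symm h),
          smul_eq_mul, mul_one, mul_zero, add_zero]
        exact ((hasDerivAt_id (0 : ℝ)).const_add (x j)).sub_const _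
      have := (hl.fun_inv (by simpa using hne)).ofReal_comp
      rw [zero_smul, add_zero, neg_div, one_div, ← inv_pow] at this
      have hc : (-(((x j - x l)⁻¹ : ℝ) : ℂ) ^ 2 : ℂ) = ((-(x j - x l)⁻¹ ^ 2 : ℝ) : ℂ) := by push_cast; rfl
      rw [← hc] at this
      exact this
  refine ⟨DifferentiableAt.fun_sum fun l _ => (hd l).1, ?_⟩
  unfold partialDeriv
  rw [fderiv_fun_sum fun l _ => (hd l).1, sum_apply, ← Finset.sum_neg_distrib]
  exact Finset.sum_congr rfl fun l _ => (hd l).2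

lemma sum_inv_sub_mul_inv_sub {x : Fin m → ℂ} (hx : Function.Injective x) (j : Fin m) :
    ∑ i, (x i - x j)⁻¹ * ∑ l, (x i - x l)⁻¹ =
      3 / 2 * ∑ i, (x j - x i)⁻¹ ^ 2 - 1 / 2 * (∑ i, (x j - x i)⁻¹) ^ 2 := by
  have key : ∀ i l, (x i - x j)⁻¹ * (x i - x l)⁻¹ + (x l - x j)⁻¹ * (x l - x i)⁻¹ =
      -((x j - x i)⁻¹ * (x j - x l)⁻¹) + (if i = l then (x j - x i)⁻¹ ^ 2 else 0) +
        (if l = j then (x j - x i)⁻¹ ^ 2 else 0) + (if i = j then (x j - x l)⁻¹ ^ 2 else 0) := by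
    intro i l
    by_cases h1 : i = l
    · subst h1
      by_cases h2 : i = j
      · subst h2; simp
      · rw [← neg_sub (x i) (x j)]
        generalize x i - x j = d
        simp [h2]; ring
    by_cases h2 : l = j
    · subst h2
      rw [← neg_sub (x i) (x l)]
      generalize x i - x l = d
      simp [h1]; ring
    by_cases h3 : i = j
    · subst h3
      rw [← neg_sub (x l) (x i)]
      generalize x l - x i = d
      simp [h1, h2]; ring
    have n1 : x i - x l ≠ 0 := sub_ne_zero.2 fun e => h1 (hx e)
    have n2 : x l - x j ≠ 0 := sub_ne_zero.2 fun e => h2 (hx e)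
    have n3 : x i - x j ≠ 0 := sub_ne_zero.2 fun e => h3 (hx e)
    rw [← neg_sub (x i) (x l), ← neg_sub (x i) (x j), ← neg_sub (x l) (x j)]
    simp only [h1, h2, h3, if_false, add_zero, inv_neg]
    field_simp
    ring
  have h1 : ∑ i, ∑ l, ((x i - x j)⁻¹ * (x i - x l)⁻¹ + (x l - x j)⁻¹ * (x l - x i)⁻¹) =
      2 * ∑ i, (x i - x j)⁻¹ * ∑ l, (x i - x l)⁻¹ := by
    simp only [Finset.sum_add_distrib]
    rw [Finset.sum_comm (f := fun i l => (x l - x j)⁻¹ * (x l - x i)⁻¹)]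
    simp only [← Finset.mul_sum]; ring
  simp only [key, Finset.sum_add_distrib, Finset.sum_ite_eq, Finset.sum_ite_eq', Finset.mem_univ,
    if_true, Finset.sum_neg_distrib, ← Finset.mul_sum, ← Finset.sum_mul] at h1
  rw [Finset.sum_comm (f := fun i l => if i = j then (x j - x l)⁻¹ ^ 2 else 0)] at h1
  simp only [Finset.sum_ite_eq', Finset.mem_univ, if_true] at h1
  linear_combination -1 / 2 * h1

end Vandermonde

lemma LinkPattern.isPeriodFamily {N : ℕ} (β : LinkPattern N) (c : ℝ) (r : Fin N) :
    IsPeriodFamily c fun s x => moment x c s (β.a r) (β.b r) :=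
  IsPeriodFamily.moment c (β.a_lt_b r).le

lemma coulombGas_eq_detRow {N : ℕ} (β : LinkPattern N) (c : ℝ) {x : Fin (2 * N) → ℝ}
    (hx : x ∈ chamber N) : coulombGas β x = (∏ r, Complex.I ^ (Finset.Ioi (β.a r)).card) *
      ((vdmQuarter x : ℂ) * detRowCMM N fun s r => moment x c s (β.a r) (β.b r)) := by
  rw [coulombGas_eq_det β hx c, mul_assoc, detRowCMM_apply, ← Matrix.det_transpose]
  rfl

/-- Regularity and the second-order partial differential equations. -/
theorem coulombGas_pde {N : ℕ} (β : LinkPattern N) : ContDiffOn ℝ 2 (coulombGas β) (chamber N) ∧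
      ∀ x ∈ chamber N, ∀ j : Fin (2 * N),
        4 * partialDeriv j (partialDeriv j (coulombGas β)) x +
          ∑ i ∈ Finset.univ.erase j,
            ((2 / (x i - x j) : ℝ) * partialDeriv i (coulombGas β) x +
              ((1 / 4) / (x i - x j) ^ 2 : ℝ) * coulombGas β x) = 0 := by
  have hU : IsOpen {x : Fin (2 * N) → ℝ | StrictMono x} := isOpen_strictMono _
  have hDreg : ∀ c : ℝ, ContDiffOn ℝ 2
      (fun x => detRowCMM N fun s r => moment x c s (β.a r) (β.b r)) {x | StrictMono x} := fun c =>
    contDiffOn_detRow (f := fun s r x => moment x c s (β.a r) (β.b r))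
      fun s r => (β.isPeriodFamily c r).contDiffOn s
  have hFreg : ContDiffOn ℝ 2 (coulombGas β) (chamber N) :=
    (contDiffOn_const.mul (contDiffOn_vdmQuarter.mul (hDreg 0))).congr
      fun x hx => coulombGas_eq_detRow β 0 hx
  refine ⟨hFreg, fun x hx j => ?_⟩
  replace hx : StrictMono x := hx
  set D : (Fin (2 * N) → ℝ) → ℂ :=
    fun y => detRowCMM N fun s r => moment y (x j) s (β.a r) (β.b r) with hD
  set W : (Fin (2 * N) → ℝ) → ℂ := fun y => (vdmQuarter y : ℂ) with hW
  set S : Fin (2 * N) → (Fin (2 * N) → ℝ) → ℂ :=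
    fun k y => ∑ l, ((y k - y l : ℝ) : ℂ)⁻¹ with hS
  set K : ℂ := ∏ r, Complex.I ^ (Finset.Ioi (β.a r)).card with hK
  have hDd : ∀ {y}, StrictMono y → DifferentiableAt ℝ D y := fun hy =>
    ((hDreg (x j)).differentiableOn (by norm_num)).differentiableAt (hU.mem_nhds hy)
  have hWd : ∀ {y}, StrictMono y → DifferentiableAt ℝ W y := fun hy =>
    (contDiffOn_vdmQuarter.differentiableOn one_ne_zero).differentiableAt (hU.mem_nhds hy)
  have hWDd : ∀ {y}, StrictMono y → DifferentiableAt ℝ (fun y => W y * D y) y := fun hy =>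
    (hWd hy).mul (hDd hy)
  have hF1 : ∀ (k) {y}, StrictMono y → partialDeriv k (coulombGas β) y =
      K * (1 / 4 * S k y * (W y * D y) + W y * partialDeriv k D y) := by
    intro k y hy
    rw [partialDeriv_congr hU (fun y hy => coulombGas_eq_detRow β (x j) hy) hy,
      partialDeriv_const_mul (hWDd hy), partialDeriv_mul (hWd hy) (hDd hy),
      partialDeriv_vdmQuarter hy]
    ring
  obtain ⟨hSd, hS'⟩ := partialDeriv_sum_inv_sub hx j
  have hDj : DifferentiableAt ℝ (partialDeriv j D) x :=
    ((contDiffOn_partialDeriv hU (hDreg (x j)) j).differentiableOn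
      (by norm_num)).differentiableAt (hU.mem_nhds hx)
  have hSd4 : DifferentiableAt ℝ (fun y => 1 / 4 * S j y) x := hSd.const_mul _
  have hA : DifferentiableAt ℝ (fun y => 1 / 4 * S j y * (W y * D y)) x := hSd4.mul (hWDd hx)
  have hB : DifferentiableAt ℝ (fun y => W y * partialDeriv j D y) x := (hWd hx).mul hDj
  have hAB : DifferentiableAt ℝ
      (fun y => 1 / 4 * S j y * (W y * D y) + W y * partialDeriv j D y) x := hA.add hB
  have hF2 : partialDeriv j (partialDeriv j (coulombGas β)) x =
      K * W x * (-1 / 4 * (∑ l, ((x j - x l : ℝ) : ℂ)⁻¹ ^ 2) * D x + 1 / 16 * S j x ^ 2 * D x +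
        1 / 2 * S j x * partialDeriv j D x + partialDeriv j (partialDeriv j D) x) := by
    rw [partialDeriv_congr hU (fun y hy => hF1 j hy) hx, partialDeriv_const_mul hAB,
      partialDeriv_add hA hB, partialDeriv_mul hSd4 (hWDd hx), partialDeriv_mul (hWd hx) (hDd hx),
      partialDeriv_mul (hWd hx) hDj, partialDeriv_const_mul hSd, hS', partialDeriv_vdmQuarter hx]
    simp only [hS, hW]
    ring
  have h2nd := period_det_second_order (fun r => β.isPeriodFamily (x j) r) hx rfl hD
  have hsum := sum_inv_sub_mul_inv_sub (x := fun i => (x i : ℂ))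
    (Complex.ofReal_injective.comp hx.injective) j
  have hF : coulombGas β x = K * (W x * D x) := coulombGas_eq_detRow β (x j) hx
  have hfull : ∑ i ∈ Finset.univ.erase j,
      (((2 / (x i - x j) : ℝ) : ℂ) * partialDeriv i (coulombGas β) x +
        (((1 / 4) / (x i - x j) ^ 2 : ℝ) : ℂ) * coulombGas β x) =
      K * W x * (1 / 2 * D x * ∑ i, ((x i : ℂ) - x j)⁻¹ * S i x +
        2 * ∑ i, ((x i : ℂ) - x j)⁻¹ * partialDeriv i D x +
        1 / 4 * D x * ∑ i, ((x j : ℂ) - x i)⁻¹ ^ 2) := by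
    rw [Finset.sum_erase _ (by simp), Finset.mul_sum, Finset.mul_sum, Finset.mul_sum,
      ← Finset.sum_add_distrib, ← Finset.sum_add_distrib, Finset.mul_sum]
    refine Finset.sum_congr rfl fun i _ => ?_
    rw [hF1 i hx, hF, ← neg_sub (x i : ℂ) (x j : ℂ)]
    push_cast
    rw [inv_neg, div_eq_mul_inv _ ((x i : ℂ) - x j), div_eq_mul_inv _ (((x i : ℂ) - x j) ^ 2),
      ← inv_pow]
    ring
  have h2' : 2 * partialDeriv j (partialDeriv j D) x =
      -(∑ i, ((x i : ℂ) - x j)⁻¹ * partialDeriv i D x) - S j x * partialDeriv j D x := by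
    rw [h2nd, Finset.sum_erase _ (by simp), hS, Finset.sum_mul, ← Finset.sum_neg_distrib,
      ← Finset.sum_sub_distrib]
    refine Finset.sum_congr rfl fun i _ => ?_
    push_cast
    rw [← neg_sub (x j : ℂ) (x i : ℂ), inv_neg]
    ring
  rw [hfull, hF2]
  simp only [hS] at h2' ⊢
  push_cast at h2' ⊢
  linear_combination (K * W x) * (2 * h2' + 1 / 2 * D x * hsum)

section Positivity

/-- The moment of `absWeight` over the gap between `x_k` and `x_{k+1}`. -/
def absMoment {m : ℕ} (x : Fin m → ℝ) (s k : ℕ) : ℝ :=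
  if h : k + 1 < m then ∫ u in (x ⟨k, by omega⟩)..(x ⟨k + 1, h⟩), u ^ s * absWeight x u else 0

lemma moment_eq_sum_absMoment {m : ℕ} {x : Fin m → ℝ} (hx : StrictMono x) (s : ℕ) {p q : Fin m}
    (hpq : p ≤ q) : moment x 0 s p q =
      ∑ k ∈ Finset.Ico (p : ℕ) q, (-Complex.I) ^ (m - 1 - k) * (absMoment x s k : ℂ) := by
  obtain ⟨d, hd⟩ : ∃ d, (q : ℕ) = p + d := Nat.exists_eq_add_of_le hpq
  induction d generalizing q with
  | zero =>
    have : p = q := Fin.ext (by omega)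
    subst this
    simp [moment]
  | succ d ih =>
    have hlt : (p : ℕ) + d < m := by omega
    have hlt' : (p : ℕ) + d + 1 < m := by omega
    have h1 := ih (q := ⟨p + d, hlt⟩) (by rw [Fin.le_def]; simp) rfl
    have h2 : (q : ℕ) = (⟨p + d, hlt⟩ : Fin m) + 1 := by simp only; omega
    have h3 : q = ⟨p + d + 1, hlt'⟩ := Fin.ext (by simp only; omega)
    rw [← moment_add hx.injective 0 s p ⟨p + d, hlt⟩ q, h1, hd, ← add_assoc,
      Finset.sum_Ico_succ_top (by omega)]
    congr 1
    have h4 := integral_gap hx h2 fun u => u ^ s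
    rw [Fin.card_Ioi] at h4
    rw [absMoment, dif_pos hlt', ← h3, ← h4, moment]
    simp

lemma det_absMoment_pos {m n : ℕ} {x : Fin m → ℝ} (hx : StrictMono x) {κ : Fin n → ℕ}
    (hκ : StrictMono κ) (hm : ∀ r, κ r + 1 < m) :
    0 < (Matrix.of fun r s : Fin n => absMoment x s (κ r)).det := by
  set lft : Fin n → Fin m := fun r => ⟨κ r, by have := hm r; omega⟩ with hlft
  set rgt : Fin n → Fin m := fun r => ⟨κ r + 1, hm r⟩ with hrgt
  set S : Fin n → Set ℝ := fun r => Ioo (x (lft r)) (x (rgt r)) with hS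
  have hlt : ∀ r, x (lft r) < x (rgt r) := fun r => hx (by rw [Fin.lt_def]; simp [lft, rgt])
  have hint : ∀ (r : Fin n) (s : Fin n), IntegrableOn (fun u => u ^ (s : ℕ) * absWeight x u) (S r) := by
    intro r s
    have h := ((intervalIntegrable_iff_integrableOn_Ioo_of_le (hlt r).le).1
      (intervalIntegrable_mul_weight hx.injective (continuous_sub_pow 0 s) _ _)).norm
    have h' : IntegrableOn (fun u : ℝ => |u| ^ (s : ℕ) * absWeight x u) (S r) := by
      refine h.congr (Eventually.of_forall fun u => ?_)
      simp [norm_weight]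
    refine Integrable.mono h' ?_ (Eventually.of_forall fun u => ?_)
    · refine (Measurable.mul (by fun_prop) ?_).aestronglyMeasurable
      unfold absWeight
      fun_prop
    · simp
  have hdet : ∀ u : Fin n → ℝ, (Matrix.of fun r s : Fin n => u r ^ (s : ℕ) * absWeight x (u r)).det =
      (∏ r, absWeight x (u r)) * ∏ r, ∏ s ∈ Finset.Ioi r, (u s - u r) := by
    intro u
    have h1 : (Matrix.of fun r s : Fin n => u r ^ (s : ℕ) * absWeight x (u r)) =
        Matrix.of fun r s : Fin n => absWeight x (u r) * Matrix.vandermonde u r s := by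
      ext r s; simp [Matrix.vandermonde_apply, mul_comm]
    rw [h1, Matrix.det_mul_column, Matrix.det_vandermonde]
  have hpos : ∀ u ∈ Set.univ.pi S,
      0 < (Matrix.of fun r s : Fin n => u r ^ (s : ℕ) * absWeight x (u r)).det := by
    intro u hu
    rw [hdet]
    refine mul_pos (Finset.prod_pos fun r _ => Finset.prod_pos fun i _ => ?_)
      (Finset.prod_pos fun r _ => Finset.prod_pos fun s hs => ?_)
    · refine Real.rpow_pos_of_pos (abs_pos.2 (sub_ne_zero.2 ?_)) _
      have hr := hu r (mem_univ r)
      intro e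
      have h1 : lft r < i := hx.lt_iff_lt.1 (e ▸ hr.1)
      have h2 : i < rgt r := hx.lt_iff_lt.1 (e ▸ hr.2)
      simp only [Fin.lt_def, hlft, hrgt] at h1 h2
      omega
    · have hr := hu r (mem_univ r)
      have hs' := hu s (mem_univ s)
      have : x (rgt r) ≤ x (lft s) := hx.monotone (by
        rw [Fin.le_def]; exact hκ (Finset.mem_Ioi.1 hs))
      linarith [hr.2, hs'.1]
  have hvol : (volume : Measure (Fin n → ℝ)).restrict (Set.univ.pi S) =
      Measure.pi fun r => volume.restrict (S r) := by
    rw [volume_pi, Measure.restrict_pi_pi]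
  have hintdet : IntegrableOn (fun u : Fin n → ℝ =>
      (Matrix.of fun r s : Fin n => u r ^ (s : ℕ) * absWeight x (u r)).det) (Set.univ.pi S) := by
    rw [IntegrableOn, hvol]
    simp only [← Matrix.det_transpose (Matrix.of _), Matrix.det_apply', Matrix.transpose_apply,
      Matrix.of_apply]
    refine integrable_finsetSum _ fun σ _ => ?_
    exact (Integrable.fintype_prod (f := fun r (t : ℝ) => t ^ ((σ r : Fin n) : ℕ) * absWeight x t)
      fun r => hint r (σ r)).const_mul _
  have heq : ((Matrix.of fun r s : Fin n => absMoment x s (κ r)).det : ℂ) =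
      ((∫ u in Set.univ.pi S,
        (Matrix.of fun r s : Fin n => u r ^ (s : ℕ) * absWeight x (u r)).det : ℝ) : ℂ) := by
    have h := integral_pi_det S (fun (s : Fin n) u => ((u ^ (s : ℕ) * absWeight x u : ℝ) : ℂ))
      fun r s => (hint r s).ofReal
    have hcast : ∀ A : Matrix (Fin n) (Fin n) ℝ, ((A.det : ℝ) : ℂ) =
        (Matrix.of fun r s => ((A r s : ℝ) : ℂ)).det := fun A =>
      RingHom.map_det Complex.ofRealHom A
    rw [hcast, ← integral_complex_ofReal]
    simp only [hcast]
    refine Eq.trans ?_ h.symm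
    congr 2
    ext r s
    simp only [Matrix.of_apply]
    rw [integral_complex_ofReal, absMoment, dif_pos (hm r), intervalIntegral.integral_of_le (hlt r).le,
      integral_Ioc_eq_integral_Ioo]
  rw [Complex.ofReal_inj.1 heq]
  have hmeas : MeasurableSet (Set.univ.pi S) := MeasurableSet.univ_pi fun r => measurableSet_Ioo
  rw [setIntegral_pos_iff_support_of_nonneg_ae ((ae_restrict_iff' hmeas).2
    (Eventually.of_forall fun u hu => (hpos u hu).le)) hintdet]
  refine lt_of_lt_of_le ?_ (measure_mono (μ := volume) (s := Set.univ.pi S)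
    fun u hu => ⟨(hpos u hu).ne', hu⟩)
  exact (isOpen_set_pi finite_univ fun r _ => isOpen_Ioo).measure_pos _
    (univ_pi_nonempty_iff.2 fun r => nonempty_Ioo.2 (hlt r))

open scoped ComplexOrder in
/-- The Coulomb gas functions are positive. -/
theorem coulombGas_pos {N : ℕ} (β : LinkPattern N) {x : Fin (2 * N) → ℝ} (hx : x ∈ chamber N) :
    0 < coulombGas β x := by
  have hx' : StrictMono x := hx
  have key := LinkPattern.alternating_pos (Matrix.detRowAlternating (n := Fin N) (R := ℂ))
    (fun k s => (absMoment x s k : ℂ)) (fun κ hκ hm => ?_) β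
  · rw [coulombGas_eq_det β hx 0, mul_right_comm]
    refine mul_pos ?_ (Complex.zero_lt_real.2 (vdmQuarter_pos hx'))
    rw [← Matrix.det_mul_column]
    convert key using 1
    change Matrix.det _ = Matrix.det _
    congr 1
    ext r s
    simp only [Matrix.of_apply, Finset.sum_apply, Pi.smul_apply, smul_eq_mul]
    rw [moment_eq_sum_absMoment hx' s (β.a_lt_b r).le, Finset.mul_sum]
    refine Finset.sum_congr rfl fun k hk => ?_
    rw [Finset.mem_Ico] at hk
    have hb := (β.b r).isLt
    rw [Fin.card_Ioi, ← mul_assoc]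
    congr 1
    rw [show 2 * N - 1 - (β.a r : ℕ) = (k - β.a r) + (2 * N - 1 - k) by omega, pow_add, mul_assoc,
      ← mul_pow]
    simp
  · have h := det_absMoment_pos hx' hκ fun r => by have := hm r; omega
    have hcast : Matrix.detRowAlternating (fun r (s : Fin N) => (absMoment x s (κ r) : ℂ)) =
        (((Matrix.of fun r s : Fin N => absMoment x s (κ r)).det : ℝ) : ℂ) :=
      (RingHom.map_det Complex.ofRealHom _).symm
    rw [hcast]
    exact Complex.zero_lt_real.2 h

end Positivity

section PairKernel

/-- The factor of the absolute weight belonging to two points. -/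
def pairKernel (p : ℝ × ℝ) (u : ℝ) : ℝ := |u - p.1| ^ (-1 / 2 : ℝ) * |u - p.2| ^ (-1 / 2 : ℝ)

/-- The midpoint of two points. -/
def pairMid (p : ℝ × ℝ) : ℝ := (p.1 + p.2) / 2

lemma pairKernel_nonneg (p : ℝ × ℝ) (u : ℝ) : 0 ≤ pairKernel p u := by
  unfold pairKernel; positivity

lemma continuous_pairMid : Continuous pairMid := by unfold pairMid; fun_prop

lemma pairKernel_reflect (p : ℝ × ℝ) (u : ℝ) : pairKernel (-p.2, -p.1) u = pairKernel p (-u) := by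
  simp only [pairKernel]
  rw [mul_comm, ← abs_neg (-u - p.1), ← abs_neg (-u - p.2)]
  congr 3 <;> ring_nf

lemma intervalIntegrable_pairKernel_self {p : ℝ × ℝ} (hp : p.1 < p.2) (a b : ℝ) :
    IntervalIntegrable (pairKernel p) volume a b := by
  have hinj : Function.Injective ![p.1, p.2] := by
    intro i k h
    fin_cases i <;> fin_cases k <;> simp_all [hp.ne, hp.ne']
  refine (intervalIntegrable_weight hinj a b).norm.congr fun u _ => ?_
  simp [norm_weight, absWeight, Fin.prod_univ_two, pairKernel]

lemma intervalIntegrable_pairKernel {p : ℝ × ℝ} (hp : p.1 < p.2) {g : ℝ → ℝ}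
    (hg : Continuous g) (a b : ℝ) :
    IntervalIntegrable (fun u => pairKernel p u * g u) volume a b :=
  (intervalIntegrable_pairKernel_self hp a b).mul_continuousOn hg.continuousOn

lemma intervalIntegrable_mul_pairKernel {p : ℝ × ℝ} (hp : p.1 < p.2) {g : ℝ → ℂ}
    (hg : Continuous g) (a b : ℝ) :
    IntervalIntegrable (fun u => (pairKernel p u : ℂ) * g u) volume a b := by
  have h := intervalIntegrable_pairKernel_self hp a b
  have h' : IntervalIntegrable (fun u => (pairKernel p u : ℂ)) volume a b :=
    ⟨h.1.ofReal, h.2.ofReal⟩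
  exact h'.mul_continuousOn hg.continuousOn

lemma pairKernel_of_gt {p : ℝ × ℝ} (hp : p.1 < p.2) {u : ℝ} (hu : p.2 < u) :
    pairKernel p u = (√(u - p.1) * √(u - p.2))⁻¹ := by
  have h1 : 0 < u - p.1 := by linarith
  have h2 : 0 < u - p.2 := by linarith
  rw [pairKernel, abs_of_pos h1, abs_of_pos h2, mul_inv, Real.sqrt_eq_rpow, Real.sqrt_eq_rpow,
    ← Real.rpow_neg h1.le, ← Real.rpow_neg h2.le]
  norm_num

lemma hasDerivAt_sqrt_sub {a u : ℝ} (h : a < u) :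
    HasDerivAt (fun u => √(u - a)) (1 / (2 * √(u - a))) u :=
  ((hasDerivAt_id u).sub_const a).sqrt (sub_pos.2 h).ne'

lemma integral_pairKernel_right {p : ℝ × ℝ} (hp : p.1 < p.2) {c : ℝ} (hc : p.2 ≤ c) :
    ∫ u in p.2..c, pairKernel p u =
      2 * Real.log (√(c - p.1) + √(c - p.2)) - Real.log (p.2 - p.1) := by
  have hcont : ContinuousOn (fun u => 2 * Real.log (√(u - p.1) + √(u - p.2))) (Icc p.2 c) := by
    refine continuousOn_const.mul (ContinuousOn.log (by fun_prop) fun u hu => ?_)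
    have : 0 < √(u - p.1) := Real.sqrt_pos.2 (by linarith [hu.1])
    positivity
  rw [intervalIntegral.integral_eq_sub_of_hasDerivAt_of_le hc hcont]
  · rw [sub_self, Real.sqrt_zero, add_zero, Real.log_sqrt (by linarith)]
    ring
  · intro u hu
    have h1 : 0 < √(u - p.1) := Real.sqrt_pos.2 (by linarith [hu.1])
    have h2 : 0 < √(u - p.2) := Real.sqrt_pos.2 (by linarith [hu.1])
    have := (((hasDerivAt_sqrt_sub (hp.trans hu.1)).add (hasDerivAt_sqrt_sub hu.1)).log
      (by simp only [Pi.add_apply]; positivity)).const_mul 2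
    refine this.congr_deriv ?_
    rw [pairKernel_of_gt hp hu.1]
    simp only [Pi.add_apply]
    field_simp
    ring
  · exact intervalIntegrable_pairKernel_self hp p.2 c

lemma integral_pairKernel_mul_right {p : ℝ × ℝ} (hp : p.1 < p.2) {c : ℝ} (hc : p.2 ≤ c) :
    ∫ u in p.2..c, pairKernel p u * (u - pairMid p) = √(c - p.1) * √(c - p.2) := by
  have hcont : ContinuousOn (fun u => √(u - p.1) * √(u - p.2)) (Icc p.2 c) := by fun_prop
  rw [intervalIntegral.integral_eq_sub_of_hasDerivAt_of_le hc hcont]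
  · simp
  · intro u hu
    have h1 : 0 < √(u - p.1) := Real.sqrt_pos.2 (by linarith [hu.1])
    have h2 : 0 < √(u - p.2) := Real.sqrt_pos.2 (by linarith [hu.1])
    have e1 : √(u - p.1) ^ 2 = u - p.1 := Real.sq_sqrt (by linarith [hu.1])
    have e2 : √(u - p.2) ^ 2 = u - p.2 := Real.sq_sqrt (by linarith [hu.1])
    refine ((hasDerivAt_sqrt_sub (hp.trans hu.1)).mul (hasDerivAt_sqrt_sub hu.1)).congr_deriv ?_
    rw [pairKernel_of_gt hp hu.1, pairMid]
    field_simp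
    linear_combination e1 + e2
  · exact intervalIntegrable_pairKernel hp (by fun_prop) p.2 c

lemma integral_pairKernel_middle {p : ℝ × ℝ} (hp : p.1 < p.2) :
    ∫ u in p.1..p.2, pairKernel p u = Real.pi := by
  have := integral_cos_substitution hp fun _ => 1
  simpa [pairKernel] using this

/-- Pairs of points collapsing to `ξ`, in increasing order. -/
def collapse (ξ : ℝ) : Filter (ℝ × ℝ) := 𝓝[{p | p.1 < p.2}] (ξ, ξ)

lemma collapse_le (ξ : ℝ) : collapse ξ ≤ 𝓝 (ξ, ξ) := nhdsWithin_le_nhds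

lemma eventually_lt_collapse (ξ : ℝ) : ∀ᶠ p in collapse ξ, p.1 < p.2 := self_mem_nhdsWithin

lemma tendsto_fst_collapse (ξ : ℝ) : Tendsto (fun p : ℝ × ℝ => p.1) (collapse ξ) (𝓝 ξ) :=
  (continuous_fst.tendsto (ξ, ξ)).mono_left (collapse_le ξ)

lemma tendsto_snd_collapse (ξ : ℝ) : Tendsto (fun p : ℝ × ℝ => p.2) (collapse ξ) (𝓝 ξ) :=
  (continuous_snd.tendsto (ξ, ξ)).mono_left (collapse_le ξ)

lemma tendsto_pairMid_collapse (ξ : ℝ) : Tendsto pairMid (collapse ξ) (𝓝 ξ) := by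
  have := (continuous_pairMid.tendsto (ξ, ξ)).mono_left (collapse_le ξ)
  simpa [pairMid] using this

lemma tendsto_reflect_collapse (ξ : ℝ) :
    Tendsto (fun p : ℝ × ℝ => (-p.2, -p.1)) (collapse ξ) (collapse (-ξ)) := by
  refine tendsto_nhdsWithin_iff.2 ⟨?_, ?_⟩
  · exact (tendsto_snd_collapse ξ).neg.prodMk_nhds (tendsto_fst_collapse ξ).neg
  · filter_upwards [eventually_lt_collapse ξ] with p hp
    simpa using hp

lemma tendsto_sub_collapse (ξ : ℝ) :
    Tendsto (fun p : ℝ × ℝ => p.2 - p.1) (collapse ξ) (𝓝[>] 0) := by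
  refine tendsto_nhdsWithin_iff.2 ⟨?_, ?_⟩
  · simpa using (tendsto_snd_collapse ξ).sub (tendsto_fst_collapse ξ)
  · filter_upwards [eventually_lt_collapse ξ] with p hp
    simpa using hp

/-- The logarithmic divergence rate `|log (x₂ - x₁)|`. -/
def logGap (p : ℝ × ℝ) : ℝ := |Real.log (p.2 - p.1)|

lemma logGap_nonneg (p : ℝ × ℝ) : 0 ≤ logGap p := abs_nonneg _

lemma tendsto_logGap (ξ : ℝ) : Tendsto logGap (collapse ξ) atTop :=
  tendsto_abs_atBot_atTop.comp (Real.tendsto_log_nhdsGT_zero.comp (tendsto_sub_collapse ξ))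

lemma tendsto_inv_logGap (ξ : ℝ) : Tendsto (fun p => (logGap p)⁻¹) (collapse ξ) (𝓝 0) :=
  tendsto_inv_atTop_zero.comp (tendsto_logGap ξ)

lemma eventually_logGap_eq (ξ : ℝ) :
    ∀ᶠ p in collapse ξ, logGap p = -Real.log (p.2 - p.1) ∧ 0 < logGap p := by
  filter_upwards [(Real.tendsto_log_nhdsGT_zero.comp (tendsto_sub_collapse ξ)).eventually_lt_atBot 0]
    with p hp
  simp only [Function.comp_apply] at hp
  rw [logGap, abs_of_neg hp]
  exact ⟨rfl, by linarith⟩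

lemma tendsto_logGap_mul_sub (ξ : ℝ) :
    Tendsto (fun p => logGap p * (p.2 - p.1)) (collapse ξ) (𝓝 0) := by
  have h := (tendsto_log_mul_rpow_nhdsGT_zero (r := 1) one_pos).comp (tendsto_sub_collapse ξ)
  have h' := h.abs
  rw [abs_zero] at h'
  refine h'.congr' ?_
  filter_upwards [eventually_lt_collapse ξ] with p hp
  simp [logGap, abs_mul, abs_of_pos (sub_pos.2 hp)]

/-- A bounded continuous function is affinely controlled near a point. -/
lemma exists_affine_bound {g : ℝ → ℂ} (hg : Continuous g) {M : ℝ} (hM : ∀ u, ‖g u‖ ≤ M) (ξ : ℝ)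
    {ε : ℝ} (hε : 0 < ε) : ∃ C, 0 ≤ C ∧ ∀ u, ‖g u - g ξ‖ ≤ ε + C * |u - ξ| := by
  obtain ⟨δ, hδ, h⟩ := Metric.continuous_iff.1 hg ξ ε hε
  have hM0 : 0 ≤ M := (norm_nonneg _).trans (hM 0)
  refine ⟨2 * M / δ, by positivity, fun u => ?_⟩
  by_cases hu : |u - ξ| < δ
  · have := h u (by rwa [Real.dist_eq])
    rw [dist_eq_norm] at this
    have : 0 ≤ 2 * M / δ * |u - ξ| := by positivity
    linarith
  · have h1 : ‖g u - g ξ‖ ≤ 2 * M := (norm_sub_le _ _).trans (by linarith [hM u, hM ξ])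
    have h2 : 2 * M ≤ 2 * M / δ * |u - ξ| := by
      rw [div_mul_eq_mul_div, le_div_iff₀ hδ]
      exact mul_le_mul_of_nonneg_left (not_lt.1 hu) (by positivity)
    linarith

lemma tendsto_of_forall_norm_sub_le {l : Filter (ℝ × ℝ)} {f : ℝ × ℝ → ℂ} {a : ℂ}
    (h : ∀ ε > 0, ∃ F : ℝ × ℝ → ℝ, Tendsto F l (𝓝 ε) ∧ ∀ᶠ p in l, ‖f p - a‖ ≤ F p) :
    Tendsto f l (𝓝 a) := by
  rw [Metric.tendsto_nhds]
  intro ε hε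
  obtain ⟨F, hF, hle⟩ := h (ε / 2) (by positivity)
  filter_upwards [hle, hF.eventually_lt_const (half_lt_self hε)] with p h1 h2
  rw [dist_eq_norm]
  exact h1.trans_lt h2

variable {g : ℝ → ℂ} {M ξ c : ℝ}

lemma tendsto_inv_logGap_mul_integral (ξ : ℝ) (hc : ξ < c) :
    Tendsto (fun p => (logGap p)⁻¹ * ∫ u in p.2..c, pairKernel p u) (collapse ξ) (𝓝 1) := by
  have h1 : Tendsto (fun p : ℝ × ℝ => 2 * Real.log (√(c - p.1) + √(c - p.2))) (collapse ξ)
      (𝓝 (2 * Real.log (√(c - ξ) + √(c - ξ)))) := by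
    have : 0 < √(c - ξ) := Real.sqrt_pos.2 (by linarith)
    exact ((((tendsto_fst_collapse ξ).const_sub c).sqrt.add
      ((tendsto_snd_collapse ξ).const_sub c).sqrt).log (by positivity)).const_mul 2
  have h2 := ((tendsto_inv_logGap ξ).mul h1).add_const 1
  rw [zero_mul, zero_add] at h2
  refine h2.congr' ?_
  filter_upwards [eventually_lt_collapse ξ, (tendsto_snd_collapse ξ).eventually_lt_const hc,
    eventually_logGap_eq ξ] with p hp hpc hL
  rw [integral_pairKernel_right hp hpc.le, sub_eq_add_neg (2 * _), ← hL.1, mul_add,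
    inv_mul_cancel₀ hL.2.ne']

lemma tendsto_inv_logGap_mul_pairKernel (hg : Continuous g) (hM : ∀ u, ‖g u‖ ≤ M) (hc : ξ < c) :
    Tendsto (fun p => ((logGap p)⁻¹ : ℂ) * ∫ u in p.2..c, (pairKernel p u : ℂ) * g u)
      (collapse ξ) (𝓝 (g ξ)) := by
  have hone : Tendsto (fun p => (((logGap p)⁻¹ * ∫ u in p.2..c, pairKernel p u : ℝ) : ℂ) * g ξ)
      (collapse ξ) (𝓝 (g ξ)) := by
    have := ((Complex.continuous_ofReal.tendsto 1).comp
      (tendsto_inv_logGap_mul_integral ξ hc)).mul_const (g ξ)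
    simpa using this
  rw [show g ξ = 0 + g ξ by ring]
  refine (Tendsto.add (f := fun p => ((logGap p)⁻¹ : ℂ) *
    ∫ u in p.2..c, (pairKernel p u : ℂ) * (g u - g ξ)) ?_ hone).congr' ?_
  · refine tendsto_of_forall_norm_sub_le fun ε hε => ?_
    obtain ⟨C, hC, hb⟩ := exists_affine_bound hg hM ξ hε
    refine ⟨fun p => (ε + C * |pairMid p - ξ|) * ((logGap p)⁻¹ * ∫ u in p.2..c, pairKernel p u) +
      C * ((logGap p)⁻¹ * (√(c - p.1) * √(c - p.2))), ?_, ?_⟩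
    · have h1 : Tendsto (fun p => ε + C * |pairMid p - ξ|) (collapse ξ) (𝓝 ε) := by
        have := ((((tendsto_pairMid_collapse ξ).sub_const ξ).abs).const_mul C).const_add ε
        simpa using this
      have h2 := (tendsto_inv_logGap ξ).mul (((tendsto_fst_collapse ξ).const_sub c).sqrt.mul
        ((tendsto_snd_collapse ξ).const_sub c).sqrt)
      have := (h1.mul (tendsto_inv_logGap_mul_integral ξ hc)).add (h2.const_mul C)
      simpa using this
    · filter_upwards [eventually_lt_collapse ξ, (tendsto_snd_collapse ξ).eventually_lt_const hc,
        eventually_logGap_eq ξ] with p hp hpc hL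
      have i1 : IntervalIntegrable (pairKernel p) volume p.2 c :=
        intervalIntegrable_pairKernel_self hp p.2 c
      have i2 : IntervalIntegrable (fun u => pairKernel p u * (u - pairMid p)) volume p.2 c :=
        intervalIntegrable_pairKernel hp (by fun_prop) p.2 c
      have hle : ‖∫ u in p.2..c, (pairKernel p u : ℂ) * (g u - g ξ)‖ ≤
          ∫ u in p.2..c, (pairKernel p u * (ε + C * |pairMid p - ξ|) +
            C * (pairKernel p u * (u - pairMid p))) := by
        refine intervalIntegral.norm_integral_le_of_norm_le hpc.le
          (Eventually.of_forall fun u hu => ?_) ((i1.mul_const _).add (i2.const_mul _))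
        rw [norm_mul, Complex.norm_real, Real.norm_eq_abs, abs_of_nonneg (pairKernel_nonneg p u)]
        have h1 : |u - ξ| ≤ (u - pairMid p) + |pairMid p - ξ| := by
          have h2 : 0 ≤ u - pairMid p := by rw [pairMid]; linarith [hu.1]
          calc |u - ξ| = |(u - pairMid p) + (pairMid p - ξ)| := by ring_nf
            _ ≤ _ := (abs_add_le _ _).trans (by rw [abs_of_nonneg h2])
        calc pairKernel p u * ‖g u - g ξ‖ ≤ pairKernel p u *
              (ε + C * ((u - pairMid p) + |pairMid p - ξ|)) :=
              mul_le_mul_of_nonneg_left ((hb u).trans (by gcongr)) (pairKernel_nonneg p u)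
          _ = _ := by ring
      rw [intervalIntegral.integral_add (i1.mul_const _) (i2.const_mul _),
        intervalIntegral.integral_mul_const, intervalIntegral.integral_const_mul,
        integral_pairKernel_mul_right hp hpc.le] at hle
      rw [sub_zero, norm_mul, norm_inv, Complex.norm_real, Real.norm_eq_abs, abs_of_pos hL.2]
      calc _ ≤ (logGap p)⁻¹ * _ := mul_le_mul_of_nonneg_left hle (inv_nonneg.2 hL.2.le)
        _ = _ := by ring
  · filter_upwards [eventually_lt_collapse ξ] with p hp
    have h1 : (∫ u in p.2..c, (pairKernel p u : ℂ) * g u) =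
        (∫ u in p.2..c, (pairKernel p u : ℂ) * (g u - g ξ)) +
          ((∫ u in p.2..c, pairKernel p u : ℝ) : ℂ) * g ξ := by
      rw [← intervalIntegral.integral_ofReal, ← intervalIntegral.integral_mul_const,
        ← intervalIntegral.integral_add]
      · congr 1; ext u; ring
      · exact intervalIntegrable_mul_pairKernel hp (by fun_prop) _ _
      · exact intervalIntegrable_mul_pairKernel hp (g := fun _ => g ξ) continuous_const _ _
    rw [h1]; push_cast; ring

lemma tendsto_integral_pow_mul_pairKernel (hg : Continuous g) (hM : ∀ u, ‖g u‖ ≤ M) (hc : ξ < c)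
    (s : ℕ) : Tendsto (fun p => ∫ u in p.2..c,
        (pairKernel p u : ℂ) * (((u : ℂ) - pairMid p) ^ (s + 1) * g u))
      (collapse ξ) (𝓝 (∫ u in ξ..c, ((u : ℂ) - ξ) ^ s * g u)) := by
  have hlim : Tendsto (fun p : ℝ × ℝ => ∫ u in p.2..c, ((u : ℂ) - pairMid p) ^ s * g u)
      (collapse ξ) (𝓝 (∫ u in ξ..c, ((u : ℂ) - ξ) ^ s * g u)) := by
    have hc : Continuous fun p : ℝ × ℝ => ∫ u in c..p.2, ((u : ℂ) - pairMid p) ^ s * g u := by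
      refine intervalIntegral.continuous_parametric_intervalIntegral_of_continuous
        (f := fun (p : ℝ × ℝ) (u : ℝ) => ((u : ℂ) - pairMid p) ^ s * g u) ?_ continuous_snd
      have := continuous_pairMid
      unfold Function.uncurry
      fun_prop
    have := ((hc.tendsto (ξ, ξ)).mono_left (collapse_le ξ)).neg
    simp only [← intervalIntegral.integral_symm] at this
    simpa [pairMid] using this
  have hdiff : Tendsto (fun p : ℝ × ℝ => (∫ u in p.2..c,
      (pairKernel p u : ℂ) * (((u : ℂ) - pairMid p) ^ (s + 1) * g u)) -
      ∫ u in p.2..c, ((u : ℂ) - pairMid p) ^ s * g u) (collapse ξ) (𝓝 0) := by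
    have hM0 : 0 ≤ M := (norm_nonneg _).trans (hM 0)
    refine squeeze_zero_norm' (a := fun p => (|c - pairMid p| ^ s * M) * (p.2 - p.1)) ?_ ?_
    · filter_upwards [eventually_lt_collapse ξ, (tendsto_snd_collapse ξ).eventually_lt_const hc]
        with p hp hpc
      have i1 : IntervalIntegrable (fun u => pairKernel p u * (u - pairMid p)) volume p.2 c :=
        intervalIntegrable_pairKernel hp (by fun_prop) p.2 c
      have hmid : pairMid p < p.2 := by rw [pairMid]; linarith
      rw [← intervalIntegral.integral_sub
        (intervalIntegrable_mul_pairKernel hp (by fun_prop) _ _)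
        ((by fun_prop : Continuous fun u : ℝ => ((u : ℂ) - pairMid p) ^ s * g u).intervalIntegrable
          _ _)]
      have hle : ‖∫ u in p.2..c, ((pairKernel p u : ℂ) * (((u : ℂ) - pairMid p) ^ (s + 1) * g u) -
          ((u : ℂ) - pairMid p) ^ s * g u)‖ ≤
          ∫ u in p.2..c, (|c - pairMid p| ^ s * M) * (pairKernel p u * (u - pairMid p) - 1) := by
        refine intervalIntegral.norm_integral_le_of_norm_le hpc.le
          (Eventually.of_forall fun u hu => ?_) ((i1.sub intervalIntegrable_const).const_mul _)
        have hu1 : 0 < u - p.1 := by linarith [hu.1]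
        have hu2 : 0 < u - p.2 := by linarith [hu.1]
        have hum : 0 ≤ u - pairMid p := by linarith [hu.1]
        have hk : 1 ≤ pairKernel p u * (u - pairMid p) := by
          rw [pairKernel_of_gt hp hu.1, inv_mul_eq_div, le_div_iff₀ (by positivity), one_mul,
            ← Real.sqrt_mul hu1.le]
          refine Real.sqrt_le_iff.2 ⟨hum, ?_⟩
          rw [pairMid]
          nlinarith [sq_nonneg (p.2 - p.1)]
        have e : (pairKernel p u : ℂ) * (((u : ℂ) - pairMid p) ^ (s + 1) * g u) -
            ((u : ℂ) - pairMid p) ^ s * g u = (((u - pairMid p) ^ s : ℝ) : ℂ) * g u *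
            ((pairKernel p u * (u - pairMid p) - 1 : ℝ) : ℂ) := by push_cast; ring
        rw [e, norm_mul, norm_mul, Complex.norm_real, Complex.norm_real, Real.norm_eq_abs,
          Real.norm_eq_abs, abs_of_nonneg (sub_nonneg.2 hk), abs_pow]
        refine mul_le_mul_of_nonneg_right ?_ (sub_nonneg.2 hk)
        refine mul_le_mul ?_ (hM u) (norm_nonneg _) (by positivity)
        refine pow_le_pow_left₀ (abs_nonneg _) ?_ s
        rw [abs_of_nonneg hum]
        exact (sub_le_sub_right hu.2 _).trans (le_abs_self _)
      refine hle.trans ?_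
      rw [intervalIntegral.integral_const_mul, intervalIntegral.integral_sub i1
        intervalIntegrable_const, integral_pairKernel_mul_right hp hpc.le,
        intervalIntegral.integral_const, smul_eq_mul, mul_one]
      refine mul_le_mul_of_nonneg_left ?_ (by positivity)
      have h1 : √(c - p.2) ≤ √(c - p.1) := Real.sqrt_le_sqrt (by linarith)
      have h2 : √(c - p.1) * √(c - p.2) ≤ c - p.1 :=
        (mul_le_mul_of_nonneg_left h1 (Real.sqrt_nonneg _)).trans
          (Real.mul_self_sqrt (by linarith)).le
      linarith
    · have h1 := (((((tendsto_pairMid_collapse ξ).const_sub c).abs).pow s).mul_const M).mul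
        ((tendsto_snd_collapse ξ).sub (tendsto_fst_collapse ξ))
      simpa using h1
  simpa using hdiff.add hlim

lemma tendsto_integral_pairKernel_middle (hg : Continuous g) (hM : ∀ u, ‖g u‖ ≤ M) :
    Tendsto (fun p : ℝ × ℝ => ∫ u in p.1..p.2, (pairKernel p u : ℂ) * g u)
      (collapse ξ) (𝓝 (Real.pi * g ξ)) := by
  refine tendsto_of_forall_norm_sub_le fun ε hε => ?_
  obtain ⟨C, hC, hb⟩ := exists_affine_bound hg hM ξ (div_pos hε Real.pi_pos)
  refine ⟨fun p => Real.pi * (ε / Real.pi + C * (|p.1 - ξ| + |p.2 - ξ|)), ?_, ?_⟩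
  · have := (((((tendsto_fst_collapse ξ).sub_const ξ).abs.add
      ((tendsto_snd_collapse ξ).sub_const ξ).abs).const_mul C).const_add (ε / Real.pi)).const_mul
        Real.pi
    simpa [mul_div_cancel₀ _ Real.pi_pos.ne'] using this
  · filter_upwards [eventually_lt_collapse ξ] with p hp
    have i1 : IntervalIntegrable (pairKernel p) volume p.1 p.2 :=
        intervalIntegrable_pairKernel_self hp p.1 p.2
    have h1 : (∫ u in p.1..p.2, (pairKernel p u : ℂ) * g u) - Real.pi * g ξ =
        ∫ u in p.1..p.2, (pairKernel p u : ℂ) * (g u - g ξ) := by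
      rw [← integral_pairKernel_middle hp, ← intervalIntegral.integral_ofReal,
        ← intervalIntegral.integral_mul_const, ← intervalIntegral.integral_sub]
      · congr 1; ext u; ring
      · exact intervalIntegrable_mul_pairKernel hp hg _ _
      · exact intervalIntegrable_mul_pairKernel hp (g := fun _ => g ξ) continuous_const _ _
    rw [h1]
    have hle : ‖∫ u in p.1..p.2, (pairKernel p u : ℂ) * (g u - g ξ)‖ ≤
        ∫ u in p.1..p.2, pairKernel p u * (ε / Real.pi + C * (|p.1 - ξ| + |p.2 - ξ|)) := by
      refine intervalIntegral.norm_integral_le_of_norm_le hp.le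
        (Eventually.of_forall fun u hu => ?_) (i1.mul_const _)
      rw [norm_mul, Complex.norm_real, Real.norm_eq_abs, abs_of_nonneg (pairKernel_nonneg p u)]
      refine mul_le_mul_of_nonneg_left ((hb u).trans ?_) (pairKernel_nonneg p u)
      have : |u - ξ| ≤ |p.1 - ξ| + |p.2 - ξ| := by
        have h1 := abs_nonneg (p.1 - ξ)
        have h2 := abs_nonneg (p.2 - ξ)
        refine abs_le.2 ⟨?_, ?_⟩
        · linarith [neg_abs_le (p.1 - ξ), hu.1]
        · linarith [le_abs_self (p.2 - ξ), hu.2]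
      gcongr
    rwa [intervalIntegral.integral_mul_const, integral_pairKernel_middle hp] at hle

lemma tendsto_logGap_mul_integral_middle (hM : ∀ u, ‖g u‖ ≤ M) (s : ℕ) :
    Tendsto (fun p : ℝ × ℝ => (logGap p : ℂ) * ∫ u in p.1..p.2,
        (pairKernel p u : ℂ) * (((u : ℂ) - pairMid p) ^ (s + 1) * g u))
      (collapse ξ) (𝓝 0) := by
  have hM0 : 0 ≤ M := (norm_nonneg _).trans (hM 0)
  refine squeeze_zero_norm' (a := fun p => Real.pi * M * (p.2 - p.1) ^ s *
    (logGap p * (p.2 - p.1))) ?_ ?_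
  · filter_upwards [eventually_lt_collapse ξ] with p hp
    have i1 : IntervalIntegrable (pairKernel p) volume p.1 p.2 :=
        intervalIntegrable_pairKernel_self hp p.1 p.2
    have hle : ‖∫ u in p.1..p.2, (pairKernel p u : ℂ) * (((u : ℂ) - pairMid p) ^ (s + 1) * g u)‖ ≤
        ∫ u in p.1..p.2, pairKernel p u * ((p.2 - p.1) ^ (s + 1) * M) := by
      refine intervalIntegral.norm_integral_le_of_norm_le hp.le
        (Eventually.of_forall fun u hu => ?_) (i1.mul_const _)
      rw [norm_mul, Complex.norm_real, Real.norm_eq_abs, abs_of_nonneg (pairKernel_nonneg p u),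
        norm_mul, norm_pow, ← Complex.ofReal_sub, Complex.norm_real, Real.norm_eq_abs]
      refine mul_le_mul_of_nonneg_left (mul_le_mul ?_ (hM u) (norm_nonneg _) ?_)
        (pairKernel_nonneg p u)
      · refine pow_le_pow_left₀ (abs_nonneg _) (abs_le.2 ⟨?_, ?_⟩) _ <;>
          rw [pairMid] <;> linarith [hu.1, hu.2]
      · exact pow_nonneg (by linarith) _
    rw [intervalIntegral.integral_mul_const, integral_pairKernel_middle hp] at hle
    rw [norm_mul, Complex.norm_real, Real.norm_eq_abs,
      abs_of_nonneg (logGap_nonneg p)]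
    refine (mul_le_mul_of_nonneg_left hle (logGap_nonneg p)).trans (le_of_eq ?_)
    ring
  · have h1 := ((((tendsto_snd_collapse ξ).sub (tendsto_fst_collapse ξ)).pow s).const_mul
      (Real.pi * M)).mul (tendsto_logGap_mul_sub ξ)
    simpa using h1

end PairKernel

section CollapsingIntegrals

/-- A locally integrable function that is continuous on a neighbourhood of radius `δ` of `ξ`. -/
structure IsRegularAt (G : ℝ → ℂ) (ξ δ : ℝ) : Prop where
  pos : 0 < δ
  integrable : ∀ a b, IntervalIntegrable G volume a b
  continuousOn : ContinuousOn G (Icc (ξ - δ) (ξ + δ))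

namespace IsRegularAt

variable {G : ℝ → ℂ} {ξ δ A B : ℝ}

lemma reflect (h : IsRegularAt G ξ δ) : IsRegularAt (fun u => G (-u)) (-ξ) δ where
  pos := h.pos
  integrable a b := by
    have := (h.integrable (-a) (-b)).comp_sub_left 0
    simpa using this
  continuousOn := h.continuousOn.comp continuous_neg.continuousOn fun u hu =>
    ⟨by linarith [hu.2], by linarith [hu.1]⟩

lemma exists_continuous (h : IsRegularAt G ξ δ) : ∃ g : ℝ → ℂ, Continuous g ∧
    (∃ M, ∀ u, ‖g u‖ ≤ M) ∧ ∀ u ∈ Icc (ξ - δ) (ξ + δ), g u = G u := by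
  have hle : ξ - δ ≤ ξ + δ := by linarith [h.pos]
  obtain ⟨M, hM⟩ := isCompact_Icc.exists_bound_of_continuousOn h.continuousOn
  refine ⟨IccExtend hle (fun u => G u), ?_, ⟨M, fun u => ?_⟩, fun u hu => ?_⟩
  · exact Continuous.Icc_extend' (continuousOn_iff_continuous_domRestrict.1 h.continuousOn)
  · exact hM _ (projIcc (ξ - δ) (ξ + δ) hle u).2
  · rw [IccExtend_of_mem hle _ hu]

lemma continuousOn_pairKernel {p : ℝ × ℝ} {S : Set ℝ} (h1 : p.1 ∉ S) (h2 : p.2 ∉ S) :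
    ContinuousOn (pairKernel p) S := by
  refine ContinuousOn.mul ?_ ?_
  · exact ContinuousOn.rpow_const (by fun_prop) fun u hu =>
      Or.inl (abs_pos.2 (sub_ne_zero.2 (ne_of_mem_of_not_mem hu h1))).ne'
  · exact ContinuousOn.rpow_const (by fun_prop) fun u hu =>
      Or.inl (abs_pos.2 (sub_ne_zero.2 (ne_of_mem_of_not_mem hu h2))).ne'

lemma tendsto_far (hG : IntervalIntegrable G volume A B) (hAB : A ≤ B) (hξ : ξ ∉ Icc A B) (s : ℕ) :
    Tendsto (fun p => ∫ u in A..B, (pairKernel p u : ℂ) * (((u : ℂ) - pairMid p) ^ s * G u))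
      (collapse ξ) (𝓝 (∫ u in A..B, ((|u - ξ|⁻¹ : ℝ) : ℂ) * (((u : ℂ) - ξ) ^ s * G u))) := by
  obtain ⟨d, hd, hball⟩ := Metric.isOpen_iff.1 (isClosed_Icc (a := A) (b := B)).isOpen_compl ξ hξ
  have hdist : ∀ u ∈ Icc A B, d ≤ |u - ξ| := fun u hu => by
    by_contra! h
    exact hball (by rwa [Metric.mem_ball, Real.dist_eq]) hu
  have hnear : ∀ᶠ p in collapse ξ, |p.1 - ξ| < d / 2 ∧ |p.2 - ξ| < d / 2 := by
    have h1 := Metric.tendsto_nhds.1 (tendsto_fst_collapse ξ) (d / 2) (by positivity)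
    have h2 := Metric.tendsto_nhds.1 (tendsto_snd_collapse ξ) (d / 2) (by positivity)
    filter_upwards [h1, h2] with p h1 h2
    exact ⟨h1, h2⟩
  have hrp : (0 : ℝ) < d / 2 := by positivity
  have hfar : ∀ p : ℝ × ℝ, |p.1 - ξ| < d / 2 → |p.2 - ξ| < d / 2 → ∀ u ∈ Icc A B,
      d / 2 ≤ |u - p.1| ∧ d / 2 ≤ |u - p.2| := by
    intro p h1 h2 u hu
    have h := hdist u hu
    have h3 := abs_sub_le u p.1 ξ
    have h4 := abs_sub_le u p.2 ξ
    constructor <;> linarith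
  have : (collapse ξ).IsCountablyGenerated :=
    inferInstanceAs (𝓝[{p : ℝ × ℝ | p.1 < p.2}] (ξ, ξ)).IsCountablyGenerated
  refine intervalIntegral.tendsto_integral_filter_of_dominated_convergence
    (fun u => ((d / 2) ^ (-1 / 2 : ℝ) * (d / 2) ^ (-1 / 2 : ℝ)) *
      ((|A - ξ| + |B - ξ| + d / 2) ^ s * ‖G u‖)) ?_ ?_ ((hG.norm.const_mul _).const_mul _) ?_
  · filter_upwards [hnear] with p hp
    rw [uIoc_of_le hAB]
    have hc : ContinuousOn (fun u : ℝ => (pairKernel p u : ℂ)) (uIcc A B) := by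
      rw [uIcc_of_le hAB]
      refine Complex.continuous_ofReal.comp_continuousOn (continuousOn_pairKernel ?_ ?_)
      · intro h; have := (hfar p hp.1 hp.2 _ h).1; rw [sub_self, abs_zero] at this; linarith
      · intro h; have := (hfar p hp.1 hp.2 _ h).2; rw [sub_self, abs_zero] at this; linarith
    exact ((hG.continuousOn_mul (g := fun u : ℝ => ((u : ℂ) - pairMid p) ^ s)
      (by fun_prop)).continuousOn_mul hc).1.aestronglyMeasurable
  · filter_upwards [hnear] with p hp
    refine Eventually.of_forall fun u hu => ?_
    rw [uIoc_of_le hAB] at hu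
    have hu' : u ∈ Icc A B := ⟨hu.1.le, hu.2⟩
    obtain ⟨f1, f2⟩ := hfar p hp.1 hp.2 u hu'
    rw [norm_mul, norm_mul, norm_pow, Complex.norm_real, ← Complex.ofReal_sub, Complex.norm_real,
      Real.norm_eq_abs, Real.norm_eq_abs, abs_of_nonneg (pairKernel_nonneg p u)]
    refine mul_le_mul ?_ (mul_le_mul_of_nonneg_right (pow_le_pow_left₀ (abs_nonneg _) ?_ s)
      (norm_nonneg _)) (by positivity) (by positivity)
    · exact mul_le_mul (Real.rpow_le_rpow_of_nonpos hrp f1 (by norm_num))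
        (Real.rpow_le_rpow_of_nonpos hrp f2 (by norm_num)) (by positivity) (by positivity)
    · have a1 := neg_abs_le (A - ξ)
      have a2 := le_abs_self (B - ξ)
      have a3 := abs_nonneg (A - ξ)
      have a4 := abs_nonneg (B - ξ)
      have b1 := abs_lt.1 hp.1
      have b2 := abs_lt.1 hp.2
      rw [pairMid, abs_le]
      constructor <;> linarith [hu'.1, hu'.2]
  · refine Eventually.of_forall fun u hu => ?_
    rw [uIoc_of_le hAB] at hu
    have hu0 : u - ξ ≠ 0 := fun e => by
      have := hdist u ⟨hu.1.le, hu.2⟩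
      rw [e, abs_zero] at this; linarith
    have h1 : Tendsto (fun p => pairKernel p u) (collapse ξ) (𝓝 (|u - ξ|⁻¹)) := by
      have := (((tendsto_fst_collapse ξ).const_sub u).abs.rpow_const (p := -1 / 2)
        (Or.inl (abs_pos.2 hu0).ne')).mul (((tendsto_snd_collapse ξ).const_sub u).abs.rpow_const
        (p := -1 / 2) (Or.inl (abs_pos.2 hu0).ne'))
      rwa [← Real.rpow_add (abs_pos.2 hu0), show (-1 / 2 + -1 / 2 : ℝ) = -1 by norm_num,
        Real.rpow_neg_one] at this
    have h2 : Tendsto (fun p => (pairMid p : ℂ)) (collapse ξ) (𝓝 (ξ : ℂ)) :=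
      (Complex.continuous_ofReal.tendsto ξ).comp (tendsto_pairMid_collapse ξ)
    exact ((Complex.continuous_ofReal.tendsto _).comp h1).mul (((h2.const_sub _).pow s).mul_const _)

lemma integral_split (h : IsRegularAt G ξ δ) (hB : ξ + δ ≤ B) (s : ℕ) :
    ∀ᶠ p in collapse ξ, ∫ u in p.2..B, (pairKernel p u : ℂ) * (((u : ℂ) - pairMid p) ^ s * G u) =
      (∫ u in p.2..(ξ + δ), (pairKernel p u : ℂ) * (((u : ℂ) - pairMid p) ^ s * G u)) +
        ∫ u in (ξ + δ)..B, (pairKernel p u : ℂ) * (((u : ℂ) - pairMid p) ^ s * G u) := by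
  obtain ⟨g, hg, -, hgG⟩ := h.exists_continuous
  have hδ := h.pos
  filter_upwards [eventually_lt_collapse ξ, (tendsto_snd_collapse ξ).eventually_lt_const
    (show ξ < ξ + δ by linarith), (tendsto_snd_collapse ξ).eventually_const_lt
    (show ξ - δ < ξ by linarith)] with p hp hp1 hp2
  refine (intervalIntegral.integral_add_adjacent_intervals ?_ ?_).symm
  · refine (intervalIntegrable_mul_pairKernel hp
      (g := fun u => ((u : ℂ) - pairMid p) ^ s * g u) (by fun_prop) _ _).congr fun u hu => ?_
    rw [uIoc_of_le hp1.le] at hu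
    rw [hgG u ⟨by linarith [hu.1], hu.2⟩]
  · refine ((h.integrable _ _).continuousOn_mul (by fun_prop)).continuousOn_mul ?_
    rw [uIcc_of_le hB]
    refine Complex.continuous_ofReal.comp_continuousOn (continuousOn_pairKernel ?_ ?_)
    · intro hm; linarith [hm.1]
    · intro hm; linarith [hm.1]

lemma integral_congr_near {g : ℝ → ℂ} (hgG : ∀ u ∈ Icc (ξ - δ) (ξ + δ), g u = G u)
    (hδ : 0 < δ) (s : ℕ) : ∀ᶠ p in collapse ξ,
    ∫ u in p.2..(ξ + δ), (pairKernel p u : ℂ) * (((u : ℂ) - pairMid p) ^ s * g u) =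
      ∫ u in p.2..(ξ + δ), (pairKernel p u : ℂ) * (((u : ℂ) - pairMid p) ^ s * G u) := by
  filter_upwards [(tendsto_snd_collapse ξ).eventually_lt_const
    (show ξ < ξ + δ by linarith), (tendsto_snd_collapse ξ).eventually_const_lt
    (show ξ - δ < ξ by linarith)] with p hp1 hp2
  refine intervalIntegral.integral_congr fun u hu => ?_
  rw [uIcc_of_le hp1.le] at hu
  rw [hgG u ⟨by linarith [hu.1], hu.2⟩]

lemma mem_self (h : IsRegularAt G ξ δ) : ξ ∈ Icc (ξ - δ) (ξ + δ) :=
  ⟨by linarith [h.pos], by linarith [h.pos]⟩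

lemma tendsto_right_zero (h : IsRegularAt G ξ δ) (hB : ξ + δ ≤ B) :
    Tendsto (fun p => ((logGap p)⁻¹ : ℂ) *
      ∫ u in p.2..B, (pairKernel p u : ℂ) * (((u : ℂ) - pairMid p) ^ 0 * G u))
      (collapse ξ) (𝓝 (G ξ)) := by
  obtain ⟨g, hg, ⟨M, hM⟩, hgG⟩ := h.exists_continuous
  have hδ := h.pos
  have hnear := tendsto_inv_logGap_mul_pairKernel hg hM (show ξ < ξ + δ by linarith)
  have hfar := ((Complex.continuous_ofReal.tendsto 0).comp (tendsto_inv_logGap ξ)).mul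
    (tendsto_far (h.integrable (ξ + δ) B) hB (fun hm => by linarith [hm.1] : ξ ∉ Icc (ξ + δ) B) 0)
  have := hnear.add hfar
  rw [Complex.ofReal_zero, zero_mul, add_zero, hgG ξ h.mem_self] at this
  refine this.congr' ?_
  filter_upwards [h.integral_split hB 0, integral_congr_near hgG hδ 0] with p h1 h2
  rw [h1, ← h2]
  simp [mul_add]

lemma tendsto_right_succ (h : IsRegularAt G ξ δ) (hB : ξ + δ ≤ B) (s : ℕ) :
    Tendsto (fun p => ∫ u in p.2..B, (pairKernel p u : ℂ) * (((u : ℂ) - pairMid p) ^ (s + 1) * G u))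
      (collapse ξ) (𝓝 (∫ u in ξ..B, ((u : ℂ) - ξ) ^ s * G u)) := by
  obtain ⟨g, hg, ⟨M, hM⟩, hgG⟩ := h.exists_continuous
  have hδ := h.pos
  have hnear := tendsto_integral_pow_mul_pairKernel hg hM (show ξ < ξ + δ by linarith) s
  have hfar := tendsto_far (h.integrable (ξ + δ) B) hB
    (fun hm => by linarith [hm.1] : ξ ∉ Icc (ξ + δ) B) (s + 1)
  have hlim : ∫ u in ξ..B, ((u : ℂ) - ξ) ^ s * G u =
      (∫ u in ξ..(ξ + δ), ((u : ℂ) - ξ) ^ s * g u) +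
        ∫ u in (ξ + δ)..B, ((|u - ξ|⁻¹ : ℝ) : ℂ) * (((u : ℂ) - ξ) ^ (s + 1) * G u) := by
    rw [← intervalIntegral.integral_add_adjacent_intervals
      ((h.integrable ξ (ξ + δ)).continuousOn_mul (g := fun u : ℝ => ((u : ℂ) - ξ) ^ s) (by fun_prop))
      ((h.integrable (ξ + δ) B).continuousOn_mul (by fun_prop))]
    congr 1
    · refine intervalIntegral.integral_congr fun u hu => ?_
      rw [uIcc_of_le (by linarith)] at hu
      rw [hgG u ⟨by linarith [hu.1], hu.2⟩]
    · refine intervalIntegral.integral_congr fun u hu => ?_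
      rw [uIcc_of_le hB] at hu
      have hu0 : 0 < u - ξ := by linarith [hu.1]
      have : (u : ℂ) - ξ ≠ 0 := by rw [← Complex.ofReal_sub]; exact Complex.ofReal_ne_zero.2 hu0.ne'
      rw [abs_of_pos hu0, pow_succ']
      push_cast
      field_simp
  rw [hlim]
  refine (hnear.add hfar).congr' ?_
  filter_upwards [h.integral_split hB (s + 1), integral_congr_near hgG hδ (s + 1)] with p h1 h2
  rw [h1, ← h2]

lemma integral_reflect (G : ℝ → ℂ) (A : ℝ) (s : ℕ) (p : ℝ × ℝ) :
    ∫ u in A..p.1, (pairKernel p u : ℂ) * (((u : ℂ) - pairMid p) ^ s * G u) =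
      (-1) ^ s * ∫ u in (-p.2, -p.1).2..(-A), (pairKernel (-p.2, -p.1) u : ℂ) *
        (((u : ℂ) - pairMid (-p.2, -p.1)) ^ s * G (-u)) := by
  have := intervalIntegral.integral_comp_neg (a := -p.1) (b := -A)
    fun u : ℝ => (pairKernel p u : ℂ) * (((u : ℂ) - pairMid p) ^ s * G u)
  rw [neg_neg, neg_neg] at this
  rw [← this, ← intervalIntegral.integral_const_mul]
  refine intervalIntegral.integral_congr fun u _ => ?_
  simp only [pairKernel_reflect]
  have e : ((-u : ℝ) : ℂ) - pairMid p = -1 * ((u : ℂ) - pairMid (-p.2, -p.1)) := by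
    simp only [pairMid]; push_cast; ring
  rw [e, mul_pow]; ring

lemma tendsto_left_zero (h : IsRegularAt G ξ δ) (hA : A ≤ ξ - δ) :
    Tendsto (fun p => ((logGap p)⁻¹ : ℂ) *
      ∫ u in A..p.1, (pairKernel p u : ℂ) * (((u : ℂ) - pairMid p) ^ 0 * G u))
      (collapse ξ) (𝓝 (G ξ)) := by
  have := (h.reflect.tendsto_right_zero (B := -A) (by linarith)).comp (tendsto_reflect_collapse ξ)
  rw [neg_neg] at this
  refine this.congr fun p => ?_
  rw [integral_reflect]
  simp only [Function.comp_apply, logGap, pow_zero, one_mul]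
  rw [show -p.1 - -p.2 = p.2 - p.1 by ring]

lemma tendsto_left_succ (h : IsRegularAt G ξ δ) (hA : A ≤ ξ - δ) (s : ℕ) :
    Tendsto (fun p => ∫ u in A..p.1, (pairKernel p u : ℂ) * (((u : ℂ) - pairMid p) ^ (s + 1) * G u))
      (collapse ξ) (𝓝 (-∫ u in A..ξ, ((u : ℂ) - ξ) ^ s * G u)) := by
  have := ((h.reflect.tendsto_right_succ (B := -A) (by linarith) s).comp
    (tendsto_reflect_collapse ξ)).const_mul ((-1) ^ (s + 1))
  have hlim : -∫ u in A..ξ, ((u : ℂ) - ξ) ^ s * G u =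
      (-1) ^ (s + 1) * ∫ u in (-ξ)..(-A), ((u : ℂ) - (-ξ : ℝ)) ^ s * G (-u) := by
    have := intervalIntegral.integral_comp_neg (a := -ξ) (b := -A)
      fun u : ℝ => ((u : ℂ) - ξ) ^ s * G u
    rw [neg_neg, neg_neg] at this
    rw [← this, ← intervalIntegral.integral_neg, ← intervalIntegral.integral_const_mul]
    refine intervalIntegral.integral_congr fun u _ => ?_
    have e : ((-u : ℝ) : ℂ) - ξ = -1 * ((u : ℂ) - (-ξ : ℝ)) := by push_cast; ring
    rw [e, mul_pow]; ring
  rw [hlim]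
  exact this.congr fun p => (integral_reflect G A (s + 1) p).symm

lemma integral_congr_middle {g : ℝ → ℂ} (hgG : ∀ u ∈ Icc (ξ - δ) (ξ + δ), g u = G u)
    (hδ : 0 < δ) (s : ℕ) : ∀ᶠ p in collapse ξ,
    ∫ u in p.1..p.2, (pairKernel p u : ℂ) * (((u : ℂ) - pairMid p) ^ s * g u) =
      ∫ u in p.1..p.2, (pairKernel p u : ℂ) * (((u : ℂ) - pairMid p) ^ s * G u) := by
  filter_upwards [eventually_lt_collapse ξ, (tendsto_snd_collapse ξ).eventually_lt_const
    (show ξ < ξ + δ by linarith), (tendsto_fst_collapse ξ).eventually_const_lt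
    (show ξ - δ < ξ by linarith)] with p hp hp1 hp2
  refine intervalIntegral.integral_congr fun u hu => ?_
  rw [uIcc_of_le hp.le] at hu
  rw [hgG u ⟨by linarith [hu.1], by linarith [hu.2]⟩]

lemma tendsto_middle_zero (h : IsRegularAt G ξ δ) :
    Tendsto (fun p : ℝ × ℝ =>
      ∫ u in p.1..p.2, (pairKernel p u : ℂ) * (((u : ℂ) - pairMid p) ^ 0 * G u))
      (collapse ξ) (𝓝 (Real.pi * G ξ)) := by
  obtain ⟨g, hg, ⟨M, hM⟩, hgG⟩ := h.exists_continuous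
  have := tendsto_integral_pairKernel_middle (ξ := ξ) hg hM
  rw [hgG ξ h.mem_self] at this
  refine this.congr' ?_
  filter_upwards [integral_congr_middle hgG h.pos 0] with p h1
  rw [← h1]; simp

lemma tendsto_middle_succ (h : IsRegularAt G ξ δ) (s : ℕ) :
    Tendsto (fun p : ℝ × ℝ => (logGap p : ℂ) *
      ∫ u in p.1..p.2, (pairKernel p u : ℂ) * (((u : ℂ) - pairMid p) ^ (s + 1) * G u))
      (collapse ξ) (𝓝 0) := by
  obtain ⟨g, hg, ⟨M, hM⟩, hgG⟩ := h.exists_continuous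
  refine (tendsto_logGap_mul_integral_middle (ξ := ξ) hM s).congr' ?_
  filter_upwards [integral_congr_middle hgG h.pos (s + 1)] with p h1
  rw [h1]

end IsRegularAt

end CollapsingIntegrals

section CollapsingPair

lemma gap_induction {m : ℕ} {R : Fin m → Fin m → Prop} (hrefl : ∀ p, R p p)
    (hgap : ∀ p q : Fin m, (q : ℕ) = p + 1 → R p q) (htrans : ∀ p q r, R p q → R q r → R p r)
    {p q : Fin m} (hpq : p ≤ q) : R p q := by
  obtain ⟨d, hd⟩ : ∃ d, (q : ℕ) = p + d := Nat.exists_eq_add_of_le hpq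
  induction d generalizing q with
  | zero => exact (Fin.ext (by omega) : p = q) ▸ hrefl p
  | succ d ih =>
    have hlt : (p : ℕ) + d < m := by omega
    exact htrans p ⟨p + d, hlt⟩ q (ih (by rw [Fin.le_def]; simp) rfl)
      (hgap _ _ (by simp only; omega))

variable {n : ℕ} {x : Fin (2 * (n + 1)) → ℝ} {j : Fin (2 * n + 1)} {ξ : ℝ}

lemma setPair_lo (x : Fin (2 * (n + 1)) → ℝ) (j : Fin (2 * n + 1)) (p : ℝ × ℝ) :
    setPair x j p (lo j) = p.1 := by
  rw [setPair, Function.update_of_ne (LinkPattern.lo_ne_hi j), Function.update_self]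

lemma setPair_hi (x : Fin (2 * (n + 1)) → ℝ) (j : Fin (2 * n + 1)) (p : ℝ × ℝ) :
    setPair x j p (hi j) = p.2 := by
  rw [setPair, Function.update_self]

lemma setPair_of_ne (x : Fin (2 * (n + 1)) → ℝ) (p : ℝ × ℝ) {k : Fin (2 * (n + 1))}
    (h1 : k ≠ lo j) (h2 : k ≠ hi j) : setPair x j p k = x k := by
  rw [setPair, Function.update_of_ne h2, Function.update_of_ne h1]

lemma setPair_skip (x : Fin (2 * (n + 1)) → ℝ) (j : Fin (2 * n + 1)) (p : ℝ × ℝ) (i : Fin (2 * n)) :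
    setPair x j p (skip j i) = x (skip j i) :=
  setPair_of_ne x p (skip_ne_lo j i) (skip_ne_hi j i)

/-- The point `ξ` lies between the neighbours of `x_j, x_{j+1}`. -/
def IsBetween (x : Fin (2 * (n + 1)) → ℝ) (j : Fin (2 * n + 1)) (ξ : ℝ) : Prop :=
  StrictMono x ∧ (∀ i, i < lo j → x i < ξ) ∧ ∀ i, hi j < i → ξ < x i

lemma lt_lo_or_hi_lt {k : Fin (2 * (n + 1))} (h1 : k ≠ lo j) (h2 : k ≠ hi j) :
    k < lo j ∨ hi j < k := by
  simp only [ne_eq, Fin.ext_iff, Fin.lt_def, lo, hi] at *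
  omega

lemma IsBetween.eventually_strictMono (h : IsBetween x j ξ) :
    ∀ᶠ p in collapse ξ, StrictMono (setPair x j p) := by
  obtain ⟨hx, hl, hr⟩ := h
  have h1 : ∀ᶠ p in collapse ξ, ∀ i, i < lo j → x i < p.1 :=
    eventually_all.2 fun i => by
      by_cases hi : i < lo j
      · filter_upwards [(tendsto_fst_collapse ξ).eventually_const_lt (hl i hi)] with p hp _ using hp
      · exact Eventually.of_forall fun p h => absurd h hi
  have h2 : ∀ᶠ p in collapse ξ, ∀ i, hi j < i → p.2 < x i :=
    eventually_all.2 fun i => by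
      by_cases hi' : hi j < i
      · filter_upwards [(tendsto_snd_collapse ξ).eventually_lt_const (hr i hi')] with p hp _ using hp
      · exact Eventually.of_forall fun p h => absurd h hi'
  filter_upwards [eventually_lt_collapse ξ, h1, h2] with p hp h1 h2
  intro i k hik
  have hlh : lo j < hi j := by simp [Fin.lt_def, lo, hi]
  by_cases i1 : i = lo j
  · subst i1
    rw [setPair_lo]
    by_cases k2 : k = hi j
    · subst k2; rwa [setPair_hi]
    · rw [setPair_of_ne x p hik.ne' k2]
      rcases lt_lo_or_hi_lt hik.ne' k2 with h | h
      · exact absurd h hik.asymm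
      · exact hp.trans (h2 k h)
  by_cases i2 : i = hi j
  · subst i2
    have k1 : k ≠ lo j := (hlh.trans hik).ne'
    rw [setPair_hi, setPair_of_ne x p k1 hik.ne']
    exact h2 k hik
  rw [setPair_of_ne x p i1 i2]
  by_cases k1 : k = lo j
  · subst k1; rw [setPair_lo]; exact h1 i hik
  by_cases k2 : k = hi j
  · subst k2
    rw [setPair_hi]
    rcases lt_lo_or_hi_lt i1 i2 with h | h
    · exact (h1 i h).trans hp
    · exact absurd h hik.asymm
  rw [setPair_of_ne x p k1 k2]
  exact hx hik

lemma weight_setPair (x : Fin (2 * (n + 1)) → ℝ) (j : Fin (2 * n + 1)) (p : ℝ × ℝ) (u : ℝ) :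
    weight (setPair x j p) u = ((if u < p.1 then -Complex.I else 1) *
      (if u < p.2 then -Complex.I else 1)) * (pairKernel p u : ℂ) * weight (x ∘ skip j) u := by
  rw [weight, prod_lo_hi_skip j]
  simp only [setPair_lo, setPair_hi, setPair_skip]
  rw [← Complex.ofReal_sub, ← Complex.ofReal_sub, ofReal_cpow_neg_half, ofReal_cpow_neg_half,
    pairKernel, weight]
  simp only [sub_neg, Function.comp_apply]
  push_cast
  ring

lemma weight_setPair_right (x : Fin (2 * (n + 1)) → ℝ) (j : Fin (2 * n + 1)) {p : ℝ × ℝ}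
    (hp : p.1 < p.2) {u : ℝ} (hu : p.2 ≤ u) :
    weight (setPair x j p) u = (pairKernel p u : ℂ) * weight (x ∘ skip j) u := by
  rw [weight_setPair, if_neg (by linarith), if_neg (by linarith)]; ring

lemma weight_setPair_left (x : Fin (2 * (n + 1)) → ℝ) (j : Fin (2 * n + 1)) {p : ℝ × ℝ}
    (hp : p.1 < p.2) {u : ℝ} (hu : u ≤ p.1) :
    weight (setPair x j p) u = -((pairKernel p u : ℂ) * weight (x ∘ skip j) u) := by
  rcases hu.lt_or_eq with h | h
  · rw [weight_setPair, if_pos h, if_pos (h.trans hp)]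
    linear_combination (pairKernel p u : ℂ) * weight (x ∘ skip j) u * Complex.I_sq
  · have : pairKernel p u = 0 := by simp [pairKernel, h]
    rw [weight_setPair, this]; simp

lemma weight_setPair_middle (x : Fin (2 * (n + 1)) → ℝ) (j : Fin (2 * n + 1)) {p : ℝ × ℝ}
    {u : ℝ} (hu : p.1 ≤ u) (hu' : u ≤ p.2) :
    weight (setPair x j p) u = -Complex.I * ((pairKernel p u : ℂ) * weight (x ∘ skip j) u) := by
  rcases hu'.lt_or_eq with h | h
  · rw [weight_setPair, if_neg (not_lt.2 hu), if_pos h]; ring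
  · have : pairKernel p u = 0 := by simp [pairKernel, h]
    rw [weight_setPair, this]; simp

lemma exists_isRegularAt_weight {m : ℕ} {x : Fin m → ℝ} (hx : Function.Injective x)
    (hξ : ∀ i, x i ≠ ξ) : ∃ δ, IsRegularAt (weight x) ξ δ ∧ ∀ i, δ ≤ |x i - ξ| := by
  obtain ⟨d, hd, hdx⟩ : ∃ d > 0, ∀ i, d ≤ |x i - ξ| := by
    rcases isEmpty_or_nonempty (Fin m) with he | he
    · exact ⟨1, one_pos, fun i => he.elim i⟩
    · obtain ⟨i, hi⟩ := Finite.exists_min fun i => |x i - ξ|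
      exact ⟨_, abs_pos.2 (sub_ne_zero.2 (hξ i)), hi⟩
  refine ⟨d / 2, ⟨by positivity, fun a b => intervalIntegrable_weight hx a b, ?_⟩,
    fun i => (half_lt_self hd).le.trans (hdx i)⟩
  have hu : ∀ u ∈ Icc (ξ - d / 2) (ξ + d / 2), ∀ i, (u < x i ↔ ξ < x i) ∧ u ≠ x i := by
    intro u hu i
    rcases le_abs.1 (hdx i) with h | h
    · exact ⟨iff_of_true (by linarith [hu.2]) (by linarith), by linarith [hu.2] |> fun h : u < x i => h.ne⟩
    · exact ⟨iff_of_false (by linarith [hu.1]) (by linarith),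
        (by linarith [hu.1] : x i < u).ne'⟩
  have h1 : ∀ u ∈ Icc (ξ - d / 2) (ξ + d / 2), weight x u =
      (-Complex.I) ^ (Finset.univ.filter fun i => ξ < x i).card * (absWeight x u : ℂ) := by
    intro u hu'
    rw [weight_eq]
    simp only [fun i => (hu u hu' i).1]
  refine ContinuousOn.congr ?_ h1
  refine continuousOn_const.mul (Complex.continuous_ofReal.comp_continuousOn ?_)
  refine continuousOn_finsetProd _ fun i _ => ?_
  exact ContinuousOn.rpow_const (by fun_prop) fun u hu' =>
    Or.inl (abs_pos.2 (sub_ne_zero.2 (hu u hu' i).2)).ne'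

lemma IsBetween.ne (h : IsBetween x j ξ) (i : Fin (2 * n)) : (x ∘ skip j) i ≠ ξ := by
  rcases lt_lo_or_hi_lt (skip_ne_lo j i) (skip_ne_hi j i) with h' | h'
  · exact (h.2.1 _ h').ne
  · exact (h.2.2 _ h').ne'

lemma IsBetween.strictMono_skip (h : IsBetween x j ξ) : StrictMono (x ∘ skip j) :=
  h.1.comp (skip_strictMono j)

lemma moment_setPair_eq_right (x : Fin (2 * (n + 1)) → ℝ) {p : ℝ × ℝ} (hp : p.1 < p.2) (s : ℕ)
    {P Q : Fin (2 * (n + 1))} (h1 : p.2 ≤ setPair x j p P)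
    (hPQ : setPair x j p P ≤ setPair x j p Q) :
    moment (setPair x j p) (pairMid p) s P Q = ∫ u in (setPair x j p P)..(setPair x j p Q),
      (pairKernel p u : ℂ) * (((u : ℂ) - pairMid p) ^ s * weight (x ∘ skip j) u) := by
  refine intervalIntegral.integral_congr fun u hu => ?_
  rw [uIcc_of_le hPQ] at hu
  rw [weight_setPair_right x j hp (h1.trans hu.1)]
  ring

lemma moment_setPair_eq_left (x : Fin (2 * (n + 1)) → ℝ) {p : ℝ × ℝ} (hp : p.1 < p.2) (s : ℕ)
    {P Q : Fin (2 * (n + 1))} (h1 : setPair x j p Q ≤ p.1)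
    (hPQ : setPair x j p P ≤ setPair x j p Q) :
    moment (setPair x j p) (pairMid p) s P Q = -∫ u in (setPair x j p P)..(setPair x j p Q),
      (pairKernel p u : ℂ) * (((u : ℂ) - pairMid p) ^ s * weight (x ∘ skip j) u) := by
  rw [← intervalIntegral.integral_neg]
  refine intervalIntegral.integral_congr fun u hu => ?_
  rw [uIcc_of_le hPQ] at hu
  rw [weight_setPair_left x j hp (hu.2.trans h1)]
  ring

lemma moment_setPair_eq_middle (x : Fin (2 * (n + 1)) → ℝ) {p : ℝ × ℝ} (hp : p.1 < p.2) (s : ℕ) :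
    moment (setPair x j p) (pairMid p) s (lo j) (hi j) = -Complex.I * ∫ u in p.1..p.2,
      (pairKernel p u : ℂ) * (((u : ℂ) - pairMid p) ^ s * weight (x ∘ skip j) u) := by
  rw [← intervalIntegral.integral_const_mul, moment, setPair_lo, setPair_hi]
  refine intervalIntegral.integral_congr fun u hu => ?_
  rw [uIcc_of_le hp.le] at hu
  rw [weight_setPair_middle x j hu.1 hu.2]
  ring

/-- Limit of the columns of the period matrix, as a function of the endpoint. -/
def collapsedMoment (x : Fin (2 * (n + 1)) → ℝ) (j : Fin (2 * n + 1)) (ξ : ℝ) (s : ℕ)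
    (k : Fin (2 * (n + 1))) : ℂ :=
  match s with
  | 0 => if k = lo j ∨ k = hi j then -weight (x ∘ skip j) ξ else 0
  | s + 1 => ∫ u in ξ..(setPair x j (ξ, ξ) k), ((u : ℂ) - ξ) ^ s * weight (x ∘ skip j) u

/-- The middle row: the moments over the collapsing interval. -/
lemma IsBetween.tendsto_moment_middle_zero (h : IsBetween x j ξ) :
    Tendsto (fun p => moment (setPair x j p) (pairMid p) 0 (lo j) (hi j)) (collapse ξ)
      (𝓝 (-Complex.I * (Real.pi * weight (x ∘ skip j) ξ))) := by
  obtain ⟨δ, hδ, -⟩ := exists_isRegularAt_weight h.strictMono_skip.injective h.ne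
  refine (hδ.tendsto_middle_zero.const_mul (-Complex.I)).congr' ?_
  filter_upwards [eventually_lt_collapse ξ] with p hp
  rw [moment_setPair_eq_middle x hp]

lemma IsBetween.tendsto_logGap_mul_moment_middle (h : IsBetween x j ξ) (s : ℕ) :
    Tendsto (fun p => (logGap p : ℂ) * moment (setPair x j p) (pairMid p) (s + 1) (lo j) (hi j))
      (collapse ξ) (𝓝 0) := by
  obtain ⟨δ, hδ, -⟩ := exists_isRegularAt_weight h.strictMono_skip.injective h.ne
  have := (hδ.tendsto_middle_succ s).const_mul (-Complex.I)
  rw [mul_zero] at this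
  refine this.congr' ?_
  filter_upwards [eventually_lt_collapse ξ] with p hp
  rw [moment_setPair_eq_middle x hp]; ring

lemma tendsto_inv_logGap_ofReal (ξ : ℝ) :
    Tendsto (fun p => ((logGap p)⁻¹ : ℂ)) (collapse ξ) (𝓝 0) := by
  have := (Complex.continuous_ofReal.tendsto 0).comp (tendsto_inv_logGap ξ)
  rw [Complex.ofReal_zero] at this
  exact this.congr fun p => by simp

lemma integral_right_eq {G : ℝ → ℂ} {A B : ℝ} (hA : ξ < A) (hAB : A ≤ B) (s : ℕ) :
    ∫ u in A..B, ((|u - ξ|⁻¹ : ℝ) : ℂ) * (((u : ℂ) - ξ) ^ (s + 1) * G u) =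
      ∫ u in A..B, ((u : ℂ) - ξ) ^ s * G u := by
  refine intervalIntegral.integral_congr fun u hu => ?_
  rw [uIcc_of_le hAB] at hu
  have hu0 : 0 < u - ξ := by linarith [hu.1]
  have : (u : ℂ) - ξ ≠ 0 := by rw [← Complex.ofReal_sub]; exact Complex.ofReal_ne_zero.2 hu0.ne'
  rw [abs_of_pos hu0, pow_succ']
  push_cast
  field_simp

lemma integral_left_eq {G : ℝ → ℂ} {A B : ℝ} (hB : B < ξ) (hAB : A ≤ B) (s : ℕ) :
    ∫ u in A..B, ((|u - ξ|⁻¹ : ℝ) : ℂ) * (((u : ℂ) - ξ) ^ (s + 1) * G u) =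
      -∫ u in A..B, ((u : ℂ) - ξ) ^ s * G u := by
  rw [← intervalIntegral.integral_neg]
  refine intervalIntegral.integral_congr fun u hu => ?_
  rw [uIcc_of_le hAB] at hu
  have hu0 : u - ξ < 0 := by linarith [hu.2]
  have : (u : ℂ) - ξ ≠ 0 := by rw [← Complex.ofReal_sub]; exact Complex.ofReal_ne_zero.2 hu0.ne
  have h2 : (ξ : ℂ) - u ≠ 0 := by rw [← neg_sub]; exact neg_ne_zero.2 this
  rw [abs_of_neg hu0, pow_succ']
  push_cast
  rw [neg_sub]
  field_simp
  ring

/-- Limits of the moments as two points collapse; the moments of order zero are divided by the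
logarithm. -/
theorem IsBetween.tendsto_moment (h : IsBetween x j ξ) (s : ℕ) {P Q : Fin (2 * (n + 1))}
    (hPQ : P ≤ Q) :
    Tendsto (fun p => (if s = 0 then ((logGap p)⁻¹ : ℂ) else 1) *
      moment (setPair x j p) (pairMid p) s P Q) (collapse ξ)
      (𝓝 (collapsedMoment x j ξ s Q - collapsedMoment x j ξ s P)) := by
  obtain ⟨δ, hδ, hδx⟩ := exists_isRegularAt_weight h.strictMono_skip.injective h.ne
  have hδ0 := hδ.pos
  have hint : ∀ (s : ℕ) a b, IntervalIntegrable
      (fun u : ℝ => ((u : ℂ) - ξ) ^ s * weight (x ∘ skip j) u) volume a b := fun s a b =>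
    (hδ.integrable a b).continuousOn_mul (g := fun u : ℝ => ((u : ℂ) - ξ) ^ s) (by fun_prop)
  have hdiff : ∀ (s : ℕ) (P Q : Fin (2 * (n + 1))), collapsedMoment x j ξ (s + 1) Q -
      collapsedMoment x j ξ (s + 1) P = ∫ u in (setPair x j (ξ, ξ) P)..(setPair x j (ξ, ξ) Q),
        ((u : ℂ) - ξ) ^ s * weight (x ∘ skip j) u := fun s P Q =>
    intervalIntegral.integral_interval_sub_left (hint s _ _) (hint s _ _)
  have hfar_zero : ∀ {A B : ℝ}, A ≤ B → ξ ∉ Icc A B →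
      Tendsto (fun p => ((logGap p)⁻¹ : ℂ) * ∫ u in A..B, (pairKernel p u : ℂ) *
        (((u : ℂ) - pairMid p) ^ 0 * weight (x ∘ skip j) u)) (collapse ξ) (𝓝 0) := by
    intro A B hAB hξ
    have := (tendsto_inv_logGap_ofReal ξ).mul
      (IsRegularAt.tendsto_far (hδ.integrable A B) hAB hξ 0)
    rwa [zero_mul] at this
  refine gap_induction (R := fun P Q => Tendsto (fun p => (if s = 0 then ((logGap p)⁻¹ : ℂ) else 1) *
      moment (setPair x j p) (pairMid p) s P Q) (collapse ξ)
      (𝓝 (collapsedMoment x j ξ s Q - collapsedMoment x j ξ s P))) ?_ ?_ ?_ hPQ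
  · intro P; simpa [moment] using tendsto_const_nhds
  · clear hPQ P Q
    intro P Q hPQ
    have hPQlt : P < Q := by rw [Fin.lt_def]; omega
    by_cases hQlo : Q < lo j
    · have hP1 : P ≠ lo j := (hPQlt.trans hQlo).ne
      have hlh : lo j < hi j := by simp [Fin.lt_def, lo, hi]
      have hP2 : P ≠ hi j := (hPQlt.trans (hQlo.trans hlh)).ne
      have hQ1 : Q ≠ lo j := hQlo.ne
      have hQ2 : Q ≠ hi j := (hQlo.trans hlh).ne
      have hle : x P ≤ x Q := (h.1 hPQlt).le
      have hξ : ξ ∉ Icc (x P) (x Q) := fun hm => absurd (h.2.1 Q hQlo) (not_lt.2 hm.2)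
      have heq : ∀ s, ∀ᶠ p in collapse ξ, moment (setPair x j p) (pairMid p) s P Q =
          -∫ u in (x P)..(x Q), (pairKernel p u : ℂ) *
            (((u : ℂ) - pairMid p) ^ s * weight (x ∘ skip j) u) := by
        intro s
        filter_upwards [eventually_lt_collapse ξ,
          (tendsto_fst_collapse ξ).eventually_const_lt (h.2.1 Q hQlo)] with p hp hp1
        have := moment_setPair_eq_left (j := j) x hp s (P := P) (Q := Q)
          (by rw [setPair_of_ne x p hQ1 hQ2]; exact hp1.le)
          (by rwa [setPair_of_ne x p hQ1 hQ2, setPair_of_ne x p hP1 hP2])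
        rwa [setPair_of_ne x p hQ1 hQ2, setPair_of_ne x p hP1 hP2] at this
      rcases s with _ | s
      · simp only [if_true, collapsedMoment, hP1, hP2, hQ1, hQ2, or_self, if_false, sub_zero]
        have := (hfar_zero hle hξ).neg
        rw [neg_zero] at this
        refine this.congr' ?_
        filter_upwards [heq 0] with p hp
        rw [hp]; ring
      · rw [hdiff, setPair_of_ne x _ hQ1 hQ2, setPair_of_ne x _ hP1 hP2]
        have := (IsRegularAt.tendsto_far (hδ.integrable (x P) (x Q)) hle hξ (s + 1)).neg
        rw [integral_left_eq (h.2.1 Q hQlo) hle, neg_neg] at this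
        refine this.congr' ?_
        filter_upwards [heq (s + 1)] with p hp
        rw [hp]; simp
    by_cases hQ : Q = lo j
    · subst hQ
      have hP1 : P ≠ lo j := hPQlt.ne
      have hlh : lo j < hi j := by simp [Fin.lt_def, lo, hi]
      have hP2 : P ≠ hi j := (hPQlt.trans hlh).ne
      have hA : x P ≤ ξ - δ := by
        obtain ⟨i, rfl⟩ := exists_skip j hP1 hP2
        have h1 := hδx i
        have h2 : x (skip j i) < ξ := h.2.1 _ hPQlt
        rw [Function.comp_apply, abs_of_neg (by linarith)] at h1
        linarith
      have heq : ∀ s, ∀ᶠ p in collapse ξ, moment (setPair x j p) (pairMid p) s P (lo j) =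
          -∫ u in (x P)..p.1, (pairKernel p u : ℂ) *
            (((u : ℂ) - pairMid p) ^ s * weight (x ∘ skip j) u) := by
        intro s
        filter_upwards [eventually_lt_collapse ξ,
          (tendsto_fst_collapse ξ).eventually_const_lt (h.2.1 P hPQlt)] with p hp hp1
        have := moment_setPair_eq_left (j := j) x hp s (P := P) (Q := lo j)
          (by rw [setPair_lo]) (by rw [setPair_lo, setPair_of_ne x p hP1 hP2]; exact hp1.le)
        rwa [setPair_lo, setPair_of_ne x p hP1 hP2] at this
      rcases s with _ | s
      · simp only [if_true, collapsedMoment, hP1, hP2, true_or, or_self, if_false, sub_zero]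
        refine (hδ.tendsto_left_zero hA).neg.congr' ?_
        filter_upwards [heq 0] with p hp
        rw [hp]; ring
      · rw [hdiff, setPair_lo, setPair_of_ne x _ hP1 hP2]
        have := (hδ.tendsto_left_succ hA s).neg
        rw [neg_neg] at this
        refine this.congr' ?_
        filter_upwards [heq (s + 1)] with p hp
        rw [hp]; simp
    by_cases hP : P = lo j
    · subst hP
      have hQ' : Q = hi j := Fin.ext (by simpa [lo, hi] using hPQ)
      subst hQ'
      rcases s with _ | s
      · simp only [if_true, collapsedMoment, true_or, or_true, sub_self]
        have := (tendsto_inv_logGap_ofReal ξ).mul h.tendsto_moment_middle_zero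
        rwa [zero_mul] at this
      · rw [hdiff, setPair_lo, setPair_hi, intervalIntegral.integral_same]
        have := (tendsto_inv_logGap_ofReal ξ).mul (h.tendsto_logGap_mul_moment_middle s)
        rw [zero_mul] at this
        refine this.congr' ?_
        filter_upwards [eventually_logGap_eq ξ] with p hp
        rw [← mul_assoc, inv_mul_cancel₀ (Complex.ofReal_ne_zero.2 hp.2.ne')]
        simp
    have hPge : hi j ≤ P := by
      simp only [Fin.le_def, Fin.lt_def, Fin.ext_iff, lo, hi] at hQlo hQ hP ⊢
      omega
    have hQ2 : hi j < Q := hPge.trans_lt hPQlt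
    have hQ1 : Q ≠ lo j := hQ
    by_cases hP2 : P = hi j
    · subst hP2
      have hB : ξ + δ ≤ x Q := by
        obtain ⟨i, rfl⟩ := exists_skip j hQ1 hQ2.ne'
        have h1 := hδx i
        have h2 : ξ < x (skip j i) := h.2.2 _ hPQlt
        rw [Function.comp_apply, abs_of_pos (by linarith)] at h1
        linarith
      have heq : ∀ s, ∀ᶠ p in collapse ξ, moment (setPair x j p) (pairMid p) s (hi j) Q =
          ∫ u in p.2..(x Q), (pairKernel p u : ℂ) *
            (((u : ℂ) - pairMid p) ^ s * weight (x ∘ skip j) u) := by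
        intro s
        filter_upwards [eventually_lt_collapse ξ,
          (tendsto_snd_collapse ξ).eventually_lt_const (h.2.2 Q hPQlt)] with p hp hp1
        have := moment_setPair_eq_right (j := j) x hp s (P := hi j) (Q := Q)
          (by rw [setPair_hi]) (by rw [setPair_hi, setPair_of_ne x p hQ1 hQ2.ne']; exact hp1.le)
        rwa [setPair_hi, setPair_of_ne x p hQ1 hQ2.ne'] at this
      rcases s with _ | s
      · simp only [if_true, collapsedMoment, hQ1, hQ2.ne', or_true, or_self, if_false, zero_sub,
          neg_neg]
        refine (hδ.tendsto_right_zero hB).congr' ?_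
        filter_upwards [heq 0] with p hp
        rw [hp]
      · rw [hdiff, setPair_hi, setPair_of_ne x _ hQ1 hQ2.ne']
        refine (hδ.tendsto_right_succ hB s).congr' ?_
        filter_upwards [heq (s + 1)] with p hp
        rw [hp]; simp
    · have hP2' : hi j < P := lt_of_le_of_ne hPge (Ne.symm hP2)
      have hle : x P ≤ x Q := (h.1 hPQlt).le
      have hξ : ξ ∉ Icc (x P) (x Q) := fun hm => absurd (h.2.2 P hP2') (not_lt.2 hm.1)
      have heq : ∀ s, ∀ᶠ p in collapse ξ, moment (setPair x j p) (pairMid p) s P Q =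
          ∫ u in (x P)..(x Q), (pairKernel p u : ℂ) *
            (((u : ℂ) - pairMid p) ^ s * weight (x ∘ skip j) u) := by
        intro s
        filter_upwards [eventually_lt_collapse ξ,
          (tendsto_snd_collapse ξ).eventually_lt_const (h.2.2 P hP2')] with p hp hp1
        have := moment_setPair_eq_right (j := j) x hp s (P := P) (Q := Q)
          (by rw [setPair_of_ne x p hP hP2]; exact hp1.le)
          (by rwa [setPair_of_ne x p hQ1 hQ2.ne', setPair_of_ne x p hP hP2])
        rwa [setPair_of_ne x p hQ1 hQ2.ne', setPair_of_ne x p hP hP2] at this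
      rcases s with _ | s
      · simp only [if_true, collapsedMoment, hP, hP2, hQ1, hQ2.ne', or_self, if_false, sub_zero]
        refine (hfar_zero hle hξ).congr' ?_
        filter_upwards [heq 0] with p hp
        rw [hp]
      · rw [hdiff, setPair_of_ne x _ hQ1 hQ2.ne', setPair_of_ne x _ hP hP2]
        have := IsRegularAt.tendsto_far (hδ.integrable (x P) (x Q)) hle hξ (s + 1)
        rw [integral_right_eq (h.2.2 P hP2') hle] at this
        refine this.congr' ?_
        filter_upwards [heq (s + 1)] with p hp
        rw [hp]; simp
  · intro P Q R h1 h2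
    have := h1.add h2
    rw [sub_add_sub_cancel'] at this
    refine this.congr' ?_
    filter_upwards [h.eventually_strictMono] with p hp
    rw [← moment_add hp.injective (pairMid p) s P Q R]; ring

end CollapsingPair

section Asymptotics

variable {n : ℕ} {x : Fin (2 * (n + 1)) → ℝ} {j : Fin (2 * n + 1)} {ξ : ℝ}

lemma logVdm_setPair (x : Fin (2 * (n + 1)) → ℝ) (j : Fin (2 * n + 1)) (p : ℝ × ℝ) :
    logVdm (setPair x j p) = 1 / 4 * Real.log (p.2 - p.1) +
      1 / 4 * ∑ i, (Real.log (p.1 - x (skip j i)) + Real.log (p.2 - x (skip j i))) +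
        logVdm (x ∘ skip j) := by
  have hs : ∀ a b : ℝ, Real.log (a - b) = Real.log (b - a) := fun a b => by
    rw [← Real.log_neg_eq_log, neg_sub]
  simp only [logVdm, sum_lo_hi_skip j (fun i => ∑ k, _), sum_lo_hi_skip j (fun k => Real.log _),
    setPair_lo, setPair_hi, setPair_skip, Function.comp_apply, Finset.sum_add_distrib, sub_self,
    Real.log_zero]
  simp only [hs (x (skip j _)) p.1, hs (x (skip j _)) p.2, hs p.1 p.2]
  ring

lemma absWeight_eq_exp {m : ℕ} {x : Fin m → ℝ} (h : ∀ i, x i ≠ ξ) :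
    absWeight x ξ = Real.exp (-(1 / 2 * ∑ i, Real.log (ξ - x i))) := by
  rw [absWeight, Finset.mul_sum, ← Finset.sum_neg_distrib, Real.exp_sum]
  refine Finset.prod_congr rfl fun i _ => ?_
  rw [Real.rpow_def_of_pos (abs_pos.2 (sub_ne_zero.2 (h i).symm)), Real.log_abs]
  congr 1; ring

lemma IsBetween.tendsto_vdmQuarter (h : IsBetween x j ξ) :
    Tendsto (fun p => vdmQuarter (setPair x j p) / (p.2 - p.1) ^ (1 / 4 : ℝ)) (collapse ξ)
      (𝓝 (vdmQuarter (x ∘ skip j) * (absWeight (x ∘ skip j) ξ)⁻¹)) := by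
  have hlim : Tendsto (fun p : ℝ × ℝ => Real.exp (1 / 4 * ∑ i,
      (Real.log (p.1 - x (skip j i)) + Real.log (p.2 - x (skip j i))) + logVdm (x ∘ skip j)))
      (collapse ξ) (𝓝 (Real.exp (1 / 4 * ∑ i, (Real.log (ξ - x (skip j i)) +
        Real.log (ξ - x (skip j i))) + logVdm (x ∘ skip j)))) := by
    refine (Real.continuous_exp.tendsto _).comp (Tendsto.add_const _ (Tendsto.const_mul _
      (tendsto_finsetSum _ fun i _ => ?_)))
    have hi : ξ - x (skip j i) ≠ 0 := sub_ne_zero.2 (h.ne i).symm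
    exact (((tendsto_fst_collapse ξ).sub_const _).log hi).add
      (((tendsto_snd_collapse ξ).sub_const _).log hi)
  convert hlim.congr' ?_ using 2
  · rw [vdmQuarter_eq_exp h.strictMono_skip, absWeight_eq_exp h.ne, ← Real.exp_neg, ← Real.exp_add]
    congr 1
    simp only [Function.comp_apply, Finset.sum_add_distrib]
    ring
  · filter_upwards [h.eventually_strictMono, eventually_lt_collapse ξ] with p hp hlt
    rw [vdmQuarter_eq_exp hp, logVdm_setPair, Real.rpow_def_of_pos (sub_pos.2 hlt), ← Real.exp_sub]
    congr 1; ring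

lemma collapsedMoment_skip_sub (h : IsBetween x j ξ) (s : ℕ) (i k : Fin (2 * n)) :
    collapsedMoment x j ξ (s + 1) (skip j k) - collapsedMoment x j ξ (s + 1) (skip j i) =
      moment (x ∘ skip j) ξ s i k := by
  have hint := fun a b => intervalIntegrable_mul_weight h.strictMono_skip.injective
    (continuous_sub_pow ξ s) a b
  simp only [collapsedMoment, setPair_skip]
  exact intervalIntegral.integral_interval_sub_left (hint _ _) (hint _ _)

lemma collapsedMoment_zero_skip (x : Fin (2 * (n + 1)) → ℝ) (j : Fin (2 * n + 1)) (ξ : ℝ)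
    (i : Fin (2 * n)) : collapsedMoment x j ξ 0 (skip j i) = 0 := by
  rw [collapsedMoment, if_neg]
  rintro (h | h)
  · exact skip_ne_lo j i h
  · exact skip_ne_hi j i h

lemma collapsedMoment_lo_eq_hi (x : Fin (2 * (n + 1)) → ℝ) (j : Fin (2 * n + 1)) (ξ : ℝ) (s : ℕ) :
    collapsedMoment x j ξ s (lo j) = collapsedMoment x j ξ s (hi j) := by
  rcases s with _ | s
  · simp [collapsedMoment]
  · simp only [collapsedMoment, setPair_lo, setPair_hi]

lemma prod_phase {N : ℕ} (β : LinkPattern N) : (∏ r, Complex.I ^ (Finset.Ioi (β.a r)).card) =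
    (Complex.I ^ (2 * N - 1)) ^ N * ∏ r, (-Complex.I) ^ (β.a r : ℕ) := by
  have h : ∀ r, Complex.I ^ (Finset.Ioi (β.a r)).card =
      Complex.I ^ (2 * N - 1) * (-Complex.I) ^ (β.a r : ℕ) := by
    intro r
    have := (β.a r).isLt
    rw [Fin.card_Ioi]
    obtain ⟨d, hd⟩ : ∃ d, 2 * N - 1 = d + β.a r := ⟨2 * N - 1 - β.a r, by omega⟩
    rw [hd, Nat.add_sub_cancel, pow_add, mul_assoc, ← mul_pow]
    simp
  simp only [h, Finset.prod_mul_distrib, Finset.prod_const, Finset.card_univ, Fintype.card_fin]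

lemma phase_succ (n : ℕ) : (Complex.I ^ (2 * (n + 1) - 1)) ^ (n + 1) =
    Complex.I * (Complex.I ^ (2 * n - 1)) ^ n := by
  rcases n with _ | n
  · simp
  · rw [← pow_mul, ← pow_mul, ← pow_succ', show (2 * (n + 1 + 1) - 1) * (n + 1 + 1) =
      4 * (n + 1) + ((2 * (n + 1) - 1) * (n + 1) + 1) by
        rw [show 2 * (n + 1 + 1) - 1 = 2 * n + 3 by omega, show 2 * (n + 1) - 1 = 2 * n + 1 by omega]
        ring, pow_add, pow_mul, Complex.I_pow_four, one_pow, one_mul]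

lemma IsBetween.weight_eq (h : IsBetween x j ξ) : (-Complex.I) ^ (j : ℕ) * weight (x ∘ skip j) ξ =
    (-1) ^ n * (absWeight (x ∘ skip j) ξ : ℂ) := by
  have hcard : (Finset.univ.filter fun i => ξ < (x ∘ skip j) i).card = 2 * n - j := by
    have h1 : (Finset.univ.filter fun i => ξ < (x ∘ skip j) i) =
        (Finset.univ.filter fun i : Fin (2 * n) => (i : ℕ) < j)ᶜ := by
      ext i
      simp only [Finset.mem_filter, Finset.mem_univ, true_and, Finset.mem_compl, not_lt,
        Function.comp_apply]
      rcases lt_or_ge (i : ℕ) j with hi | hi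
      · have : x (skip j i) < ξ := h.2.1 _ (by
          rw [Fin.lt_def]; simp only [skip, lo, if_pos hi]; exact hi)
        exact iff_of_false (by linarith) (by omega)
      · have : ξ < x (skip j i) := h.2.2 _ (by
          rw [Fin.lt_def]; simp only [skip, _root_.hi, if_neg (not_lt.2 hi)]; omega)
        exact iff_of_true this hi
    have hj := j.isLt
    rw [h1, Finset.card_compl, Fintype.card_fin, Fin.card_filter_val_lt]
    omega
  have hj := j.isLt
  rw [_root_.weight_eq, hcard, ← mul_assoc, ← pow_add, show (j : ℕ) + (2 * n - j) = 2 * n by omega,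
    pow_mul]
  simp

/-- The phases of a link pattern and of the pattern with a short link removed. -/
lemma prod_phase_removeLink (β : LinkPattern (n + 1)) (hβ : β.pair (lo j) = hi j) (ρ : Fin (n + 1))
    (hρ : β.a ρ = lo j) : (-1) ^ (ρ : ℕ) * ∏ r, (-Complex.I) ^ (β.a r : ℕ) =
      (-1) ^ n * (-Complex.I) ^ (j : ℕ) * ∏ r, (-Complex.I) ^ ((β.removeLink j hβ).a r : ℕ) := by
  rw [Fin.prod_univ_succAbove _ ρ, hρ]
  have hlt : ∀ r : Fin n, ((β.removeLink j hβ).a r : ℕ) < j ↔ (r : ℕ) < ρ := by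
    intro r
    have h1 : β.a (ρ.succAbove r) < lo j ↔ (r : ℕ) < ρ := by
      rw [← hρ, β.a_strictMono.lt_iff_lt, Fin.succAbove_lt_iff_castSucc_lt]
      rfl
    rw [← h1, LinkPattern.a_removeLink β j hβ ρ hρ, Fin.lt_def]
    simp only [skip, lo]
    split_ifs <;> omega
  have hterm : ∀ r : Fin n, (-Complex.I) ^ (β.a (ρ.succAbove r) : ℕ) =
      (if (r : ℕ) < ρ then 1 else -1) * (-Complex.I) ^ ((β.removeLink j hβ).a r : ℕ) := by
    intro r
    rw [LinkPattern.a_removeLink β j hβ ρ hρ]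
    simp only [skip, hlt]
    split_ifs
    · rw [one_mul]
    · rw [pow_add]; simp
  have hsign : (-1 : ℂ) ^ (ρ : ℕ) * ∏ r : Fin n, (if (r : ℕ) < ρ then (1 : ℂ) else -1) =
      (-1) ^ n := by
    have h1 : ∏ r : Fin n, (if (r : ℕ) < ρ then (-1 : ℂ) else 1) = (-1) ^ (ρ : ℕ) := by
      have := ρ.isLt
      rw [Finset.prod_ite, Finset.prod_const, Finset.prod_const_one, mul_one,
        Fin.card_filter_val_lt]
      congr 1; omega
    rw [← h1, ← Finset.prod_mul_distrib]
    have h2 : ∀ r : Fin n, (if (r : ℕ) < ρ then (-1 : ℂ) else 1) *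
        (if (r : ℕ) < ρ then (1 : ℂ) else -1) = -1 := by
      intro r; split_ifs <;> simp
    simp [h2]
  simp only [hterm, Finset.prod_mul_distrib, ← hsign, lo]
  ring

lemma tendsto_det {m : ℕ} {l : Filter (ℝ × ℝ)} {A : ℝ × ℝ → Fin m → Fin m → ℂ}
    {B : Fin m → Fin m → ℂ} (h : ∀ r s, Tendsto (fun p => A p r s) l (𝓝 (B r s))) :
    Tendsto (fun p => (Matrix.of (A p)).det) l (𝓝 (Matrix.of B).det) :=
  ((Continuous.matrix_det continuous_id).tendsto (Matrix.of B)).comp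
    (tendsto_pi_nhds.2 fun r => tendsto_pi_nhds.2 fun s => h r s)

/-- The factor rescaling the zeroth column. -/
def columnScale (n : ℕ) (p : ℝ × ℝ) (s : Fin (n + 1)) : ℂ :=
  if (s : ℕ) = 0 then ((logGap p)⁻¹ : ℂ) else 1

lemma prod_columnScale (n : ℕ) (p : ℝ × ℝ) : ∏ s, columnScale n p s = ((logGap p)⁻¹ : ℂ) := by
  rw [Fin.prod_univ_succ]
  simp [columnScale]

theorem IsBetween.tendsto_coulombGas_linked (h : IsBetween x j ξ) (β : LinkPattern (n + 1))
    (hβ : β.pair (lo j) = hi j) :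
    Tendsto (fun p : ℝ × ℝ =>
        coulombGas β (setPair x j p) / (((p.2 - p.1) ^ (1 / 4 : ℝ) : ℝ) : ℂ))
      (collapse ξ) (𝓝 (Real.pi * coulombGas (β.removeLink j hβ) (x ∘ skip j))) := by
  obtain ⟨ρ, hρ⟩ := β.exists_a_eq (i := lo j) (by rw [hβ]; simp [Fin.lt_def, lo, hi])
  have hρb : β.b ρ = hi j := by rw [LinkPattern.b, hρ, hβ]
  set β' := β.removeLink j hβ with hβ'
  set rowScale : ℝ × ℝ → Fin (n + 1) → ℂ := fun p r => if r = ρ then (logGap p : ℂ) else 1 with hrow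
  set B : Fin (n + 1) → Fin (n + 1) → ℂ := fun r s => if r = ρ then
    (if (s : ℕ) = 0 then -Complex.I * (Real.pi * weight (x ∘ skip j) ξ) else 0) else
    collapsedMoment x j ξ s (β.b r) - collapsedMoment x j ξ s (β.a r) with hB
  have hentry : ∀ r s, Tendsto (fun p => rowScale p r * (columnScale n p s *
      moment (setPair x j p) (pairMid p) s (β.a r) (β.b r))) (collapse ξ) (𝓝 (B r s)) := by
    intro r s
    by_cases hr : r = ρ
    · subst hr
      simp only [hrow, hB, if_true, hρ, hρb, columnScale]
      split_ifs with hs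
      · rw [hs]
        refine h.tendsto_moment_middle_zero.congr' ?_
        filter_upwards [eventually_logGap_eq ξ] with p hp
        rw [← mul_assoc, mul_inv_cancel₀ (Complex.ofReal_ne_zero.2 hp.2.ne'), one_mul]
      · obtain ⟨t, ht⟩ := Nat.exists_eq_succ_of_ne_zero hs
        rw [ht]
        simpa using h.tendsto_logGap_mul_moment_middle t
    · simp only [hrow, hB, hr, if_false, one_mul, columnScale]
      exact h.tendsto_moment s (β.a_lt_b r).le
  have hdet := tendsto_det hentry
  have hBdet : (Matrix.of B).det = (-1) ^ (ρ : ℕ) * (-Complex.I * (Real.pi * weight (x ∘ skip j) ξ)) *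
      (Matrix.of fun r s : Fin n => moment (x ∘ skip j) ξ s (β'.a r) (β'.b r)).det := by
    rw [Matrix.det_succ_row _ ρ, Fin.sum_univ_succ, Finset.sum_eq_zero, add_zero]
    · congr 1
      · simp [hB]
      · congr 1
        ext r s
        simp only [Matrix.submatrix_apply, Matrix.of_apply, hB, Fin.succAbove_ne, if_false,
          Fin.succAbove_zero, Fin.val_succ, LinkPattern.a_removeLink β j hβ ρ hρ,
          LinkPattern.b_removeLink β j hβ ρ hρ]
        exact collapsedMoment_skip_sub h s _ _
    · intro s _
      simp [hB]
  have hphase : (∏ r, Complex.I ^ (Finset.Ioi (β.a r)).card) *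
      ((-1) ^ (ρ : ℕ) * (-Complex.I * (Real.pi * weight (x ∘ skip j) ξ))) =
      Real.pi * (absWeight (x ∘ skip j) ξ : ℂ) *
        ∏ r, Complex.I ^ (Finset.Ioi (β'.a r)).card := by
    have h1 := prod_phase_removeLink β hβ ρ hρ
    have h2 := h.weight_eq
    have h3 : ((-1 : ℂ) ^ n) ^ 2 = 1 := by rw [← pow_mul, mul_comm, pow_mul]; simp
    rw [prod_phase, prod_phase, phase_succ]
    linear_combination (Complex.I * (Complex.I ^ (2 * n - 1)) ^ n) *
      (-Complex.I * (Real.pi * weight (x ∘ skip j) ξ)) * h1 +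
      (Complex.I * (Complex.I ^ (2 * n - 1)) ^ n) * (-Complex.I * Real.pi) * (-1) ^ n *
        (∏ r, (-Complex.I) ^ (β'.a r : ℕ)) * h2 +
      (Complex.I ^ (2 * n - 1)) ^ n * Real.pi * (absWeight (x ∘ skip j) ξ : ℂ) *
        (∏ r, (-Complex.I) ^ (β'.a r : ℕ)) * h3 -
      (Complex.I ^ (2 * n - 1)) ^ n * Real.pi * ((-1) ^ n) ^ 2 * (absWeight (x ∘ skip j) ξ : ℂ) *
        (∏ r, (-Complex.I) ^ (β'.a r : ℕ)) * Complex.I_sq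
  have habs : (absWeight (x ∘ skip j) ξ : ℂ) ≠ 0 := by
    rw [absWeight_eq_exp h.ne]
    exact Complex.ofReal_ne_zero.2 (Real.exp_pos _).ne'
  have hlim := ((Complex.continuous_ofReal.tendsto _).comp h.tendsto_vdmQuarter).const_mul
    (∏ r, Complex.I ^ (Finset.Ioi (β.a r)).card) |>.mul hdet
  have hval : (∏ r, Complex.I ^ (Finset.Ioi (β.a r)).card) *
      ((vdmQuarter (x ∘ skip j) * (absWeight (x ∘ skip j) ξ)⁻¹ : ℝ) : ℂ) * (Matrix.of B).det =
      Real.pi * coulombGas β' (x ∘ skip j) := by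
    rw [coulombGas_eq_det β' h.strictMono_skip ξ, hBdet]
    push_cast
    set D := (Matrix.of fun r s : Fin n => moment (x ∘ skip j) ξ s (β'.a r) (β'.b r)).det
    linear_combination (vdmQuarter (x ∘ skip j) : ℂ) * D * (absWeight (x ∘ skip j) ξ : ℂ)⁻¹ * hphase +
      Real.pi * (∏ r, Complex.I ^ (Finset.Ioi (β'.a r)).card) * (vdmQuarter (x ∘ skip j) : ℂ) * D *
        mul_inv_cancel₀ habs
  rw [← hval]
  refine hlim.congr' ?_
  filter_upwards [h.eventually_strictMono, eventually_logGap_eq ξ] with p hp hL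
  have hL0 : (logGap p : ℂ) ≠ 0 := Complex.ofReal_ne_zero.2 hL.2.ne'
  have hprod : ∏ r, rowScale p r = (logGap p : ℂ) := by
    simp [hrow]
  have hd : (Matrix.of fun r s => rowScale p r * (columnScale n p s *
      moment (setPair x j p) (pairMid p) s (β.a r) (β.b r))).det =
      (Matrix.of fun r s : Fin (n + 1) =>
        moment (setPair x j p) (pairMid p) s (β.a r) (β.b r)).det := by
    have h1 := Matrix.det_mul_column (rowScale p) (Matrix.of fun r s => columnScale n p s *
      moment (setPair x j p) (pairMid p) s (β.a r) (β.b r))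
    have h2 := Matrix.det_mul_row (columnScale n p) (Matrix.of fun r s : Fin (n + 1) =>
      moment (setPair x j p) (pairMid p) s (β.a r) (β.b r))
    simp only [Matrix.of_apply] at h1 h2
    rw [h1, h2, hprod, prod_columnScale, ← mul_assoc, mul_inv_cancel₀ hL0, one_mul]
  rw [coulombGas_eq_det β hp (pairMid p), hd]
  simp only [Function.comp_apply]
  push_cast
  ring

theorem IsBetween.tendsto_coulombGas_unlinked (h : IsBetween x j ξ) (β : LinkPattern (n + 1))
    (hβ : β.pair (lo j) ≠ hi j) :
    Tendsto (fun p : ℝ × ℝ => coulombGas β (setPair x j p) /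
        (((p.2 - p.1) ^ (1 / 4 : ℝ) * |Real.log (p.2 - p.1)| : ℝ) : ℂ))
      (collapse ξ) (𝓝 (coulombGas ((β.tie j).removeLink j (β.tie_pair_lo j)) (x ∘ skip j))) := by
  set β' := (β.tie j).removeLink j (β.tie_pair_lo j) with hβ'
  set V : Fin (2 * (n + 1)) → Fin (n + 1) → ℂ := fun k s => collapsedMoment x j ξ s k with hV
  set Φ := Matrix.detRowAlternating (n := Fin (n + 1)) (R := ℂ) with hΦ
  have hentry : ∀ r s, Tendsto (fun p => columnScale n p s *
      moment (setPair x j p) (pairMid p) s (β.a r) (β.b r)) (collapse ξ)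
      (𝓝 ((V (β.b r) - V (β.a r)) s)) := fun r s => h.tendsto_moment s (β.a_lt_b r).le
  have hdet := tendsto_det hentry
  have hzero : ∀ i, V (skip j i) 0 = 0 := fun i => collapsedMoment_zero_skip x j ξ i
  have htie := LinkPattern.alternating_tie Φ V β j hβ
    (funext fun s => collapsedMoment_lo_eq_hi x j ξ s)
    (fun κ => Matrix.det_eq_zero_of_column_eq_zero 0 fun r => hzero (κ r))
  have hcurry : Φ.curryLeft (V (lo j)) (fun r => V (skip j (β'.b r)) - V (skip j (β'.a r))) =
      -weight (x ∘ skip j) ξ *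
        (Matrix.of fun r s : Fin n => moment (x ∘ skip j) ξ s (β'.a r) (β'.b r)).det := by
    have hof : ∀ w : Fin (n + 1) → Fin (n + 1) → ℂ, Φ w = (Matrix.of w).det := fun _ => rfl
    rw [AlternatingMap.curryLeft_apply_apply, hof, Matrix.det_succ_column_zero, Fin.sum_univ_succ, Finset.sum_eq_zero, add_zero]
    · congr 1
      · simp only [Fin.val_zero, pow_zero, one_mul, Matrix.of_apply, Matrix.cons_val_zero, hV,
          collapsedMoment, true_or, if_true]
      · congr 1
        ext r s
        simp only [Matrix.submatrix_apply, Matrix.of_apply, Fin.succAbove_zero,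
          Matrix.cons_val_succ, Pi.sub_apply, hV, Fin.val_succ]
        exact collapsedMoment_skip_sub h s _ _
    · intro r _
      rw [Matrix.of_apply, Matrix.cons_val_succ, Pi.sub_apply, hzero, hzero, sub_zero, mul_zero,
        zero_mul]
  rw [hcurry] at htie
  have hphase : (∏ r, Complex.I ^ (Finset.Ioi (β.a r)).card) * Φ (fun r => V (β.b r) - V (β.a r)) =
      (absWeight (x ∘ skip j) ξ : ℂ) * ((∏ r, Complex.I ^ (Finset.Ioi (β'.a r)).card) *
      (Matrix.of fun r s : Fin n => moment (x ∘ skip j) ξ s (β'.a r) (β'.b r)).det) := by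
    have h2 := h.weight_eq
    have h3 : ((-1 : ℂ) ^ n) ^ 2 = 1 := by rw [← pow_mul, mul_comm, pow_mul]; simp
    rw [prod_phase, prod_phase, phase_succ, mul_assoc, htie]
    set D := (Matrix.of fun r s : Fin n => moment (x ∘ skip j) ξ s (β'.a r) (β'.b r)).det
    set K := (Complex.I ^ (2 * n - 1)) ^ n
    set Q := ∏ r, (-Complex.I) ^ (β'.a r : ℕ)
    linear_combination (-(K * Complex.I ^ 2 * (-1) ^ n * Q * D)) * h2 -
      K * Q * D * (absWeight (x ∘ skip j) ξ : ℂ) * Complex.I ^ 2 * h3 -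
      K * Q * D * (absWeight (x ∘ skip j) ξ : ℂ) * Complex.I_sq
  have habs : (absWeight (x ∘ skip j) ξ : ℂ) ≠ 0 := by
    rw [absWeight_eq_exp h.ne]
    exact Complex.ofReal_ne_zero.2 (Real.exp_pos _).ne'
  have hlim := ((Complex.continuous_ofReal.tendsto _).comp h.tendsto_vdmQuarter).const_mul
    (∏ r, Complex.I ^ (Finset.Ioi (β.a r)).card) |>.mul hdet
  have hval : (∏ r, Complex.I ^ (Finset.Ioi (β.a r)).card) *
      ((vdmQuarter (x ∘ skip j) * (absWeight (x ∘ skip j) ξ)⁻¹ : ℝ) : ℂ) *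
        (Matrix.of fun r s => (V (β.b r) - V (β.a r)) s).det =
      coulombGas β' (x ∘ skip j) := by
    change _ * Φ (fun r => V (β.b r) - V (β.a r)) = _
    rw [coulombGas_eq_det β' h.strictMono_skip ξ, mul_right_comm, hphase]
    push_cast
    field_simp
  rw [← hval]
  refine hlim.congr' ?_
  filter_upwards [h.eventually_strictMono] with p hp
  have h2 := Matrix.det_mul_row (columnScale n p) (Matrix.of fun r s : Fin (n + 1) =>
      moment (setPair x j p) (pairMid p) s (β.a r) (β.b r))
  simp only [Matrix.of_apply] at h2
  rw [coulombGas_eq_det β hp (pairMid p), h2, prod_columnScale]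
  simp only [Function.comp_apply, logGap]
  push_cast
  ring

end Asymptotics

section Independence

variable {n : ℕ}

lemma exists_isBetween {y : Fin (2 * n) → ℝ} (hy : StrictMono y) (j : Fin (2 * n + 1)) :
    ∃ x ξ, IsBetween x j ξ ∧ x ∘ skip j = y := by
  set A : Finset ℝ := (Finset.univ.filter fun i : Fin (2 * n) => (i : ℕ) < j).image y with hA
  set B : Finset ℝ := (Finset.univ.filter fun i : Fin (2 * n) => ¬ (i : ℕ) < j).image y with hB
  have hmA : ∀ i : Fin (2 * n), (i : ℕ) < j → y i ∈ A := fun i hi =>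
    Finset.mem_image_of_mem y (by simpa using hi)
  have hmB : ∀ i : Fin (2 * n), ¬ (i : ℕ) < j → y i ∈ B := fun i hi =>
    Finset.mem_image_of_mem y (by simpa using hi)
  obtain ⟨ξ, hξA, hξB⟩ := Order.exists_between_finsets A B (by
    intro s hs t ht
    simp only [hA, hB, Finset.mem_image, Finset.mem_filter, Finset.mem_univ, true_and] at hs ht
    obtain ⟨i, hi, rfl⟩ := hs
    obtain ⟨k, hk, rfl⟩ := ht
    exact hy (by rw [Fin.lt_def]; omega))
  obtain ⟨a, haA, haξ⟩ := Order.exists_between_finsets A {ξ} (by simpa using hξA)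
  obtain ⟨b, hbξ, hbB⟩ := Order.exists_between_finsets {ξ} B (by simpa using hξB)
  have haξ' : a < ξ := by simpa using haξ
  have hbξ' : ξ < b := by simpa using hbξ
  set x : Fin (2 * (n + 1)) → ℝ := fun k =>
    if h₁ : k = lo j then a else if h₂ : k = hi j then b else y (unskip j k h₁ h₂) with hx
  have hlh := LinkPattern.lo_ne_hi j
  have xlo : x (lo j) = a := by simp [hx]
  have xhi : x (hi j) = b := by simp [hx, hlh.symm]
  have xskip : ∀ i, x (skip j i) = y i := fun i => by
    simp only [hx, skip_ne_lo, skip_ne_hi, dif_neg, not_false_eq_true]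
    congr 1
    exact skip_injective j (skip_unskip j _ _ _)
  have s1 : ∀ i, skip j i < lo j → y i ∈ A := fun i h => hmA i (by
    simp only [Fin.lt_def, skip, lo] at h; split_ifs at h <;> omega)
  have s2 : ∀ i, lo j < skip j i → y i ∈ B := fun i h => hmB i (by
    simp only [Fin.lt_def, skip, lo] at h; split_ifs at h <;> omega)
  have hlh' : lo j < hi j := by simp [Fin.lt_def, lo, hi]
  have s3 : ∀ i, skip j i < hi j → y i ∈ A := fun i h =>
    s1 i ((lt_lo_or_hi_lt (skip_ne_lo j i) (skip_ne_hi j i)).resolve_right h.asymm)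
  have cases : ∀ k, k = lo j ∨ k = hi j ∨ ∃ i, k = skip j i := fun k => by
    by_cases h₁ : k = lo j
    · exact Or.inl h₁
    by_cases h₂ : k = hi j
    · exact Or.inr (Or.inl h₂)
    exact Or.inr (Or.inr (exists_skip j h₁ h₂))
  refine ⟨x, ξ, ⟨fun k l hkl => ?_, fun k hk => ?_, fun k hk => ?_⟩, funext xskip⟩
  · rcases cases k with rfl | rfl | ⟨i, rfl⟩ <;> rcases cases l with rfl | rfl | ⟨i', rfl⟩
    · exact absurd hkl (lt_irrefl _)
    · rw [xlo, xhi]; linarith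
    · rw [xlo, xskip]; exact haξ'.trans (hξB _ (s2 i' hkl))
    · exact absurd hkl hlh'.asymm
    · exact absurd hkl (lt_irrefl _)
    · rw [xhi, xskip]; exact hbB _ (s2 i' (hlh'.trans hkl))
    · rw [xlo, xskip]; exact haA _ (s1 i hkl)
    · rw [xhi, xskip]; exact (hξA _ (s3 i hkl)).trans hbξ'
    · rw [xskip, xskip]; exact hy ((skip_lt_skip j _ _).1 hkl)
  · obtain ⟨i, rfl⟩ := exists_skip j hk.ne (hk.trans hlh').ne
    rw [xskip]; exact hξA _ (s1 i hk)
  · obtain ⟨i, rfl⟩ := exists_skip j (hlh'.trans hk).ne' hk.ne'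
    rw [xskip]; exact hξB _ (s2 i (hlh'.trans hk))

open Classical in
/-- The leading logarithmic terms of a linear relation form a linear relation. -/
lemma relation_collapse {c : LinkPattern (n + 1) → ℂ}
    (hc : ∀ x ∈ chamber (n + 1), ∑ β, c β * coulombGas β x = 0) (j : Fin (2 * n + 1))
    {y : Fin (2 * n) → ℝ} (hy : y ∈ chamber n) :
    ∑ β : LinkPattern (n + 1), (if β.pair (lo j) = hi j then 0 else
      c β * coulombGas ((β.tie j).removeLink j (β.tie_pair_lo j)) y) = 0 := by
  obtain ⟨x, ξ, h, rfl⟩ := exists_isBetween hy j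
  have hterm : ∀ β : LinkPattern (n + 1), Tendsto (fun p : ℝ × ℝ => c β *
      (coulombGas β (setPair x j p) /
        (((p.2 - p.1) ^ (1 / 4 : ℝ) * |Real.log (p.2 - p.1)| : ℝ) : ℂ))) (collapse ξ)
      (𝓝 (if β.pair (lo j) = hi j then 0 else
        c β * coulombGas ((β.tie j).removeLink j (β.tie_pair_lo j)) (x ∘ skip j))) := by
    intro β
    split_ifs with hβ
    · have := ((tendsto_inv_logGap_ofReal ξ).mul (h.tendsto_coulombGas_linked β hβ)).const_mul (c β)
      rw [zero_mul, mul_zero] at this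
      refine this.congr fun p => ?_
      rw [logGap]
      push_cast
      rw [div_mul_eq_div_div, inv_mul_eq_div]
    · exact (h.tendsto_coulombGas_unlinked β hβ).const_mul (c β)
  have hne : (collapse ξ).NeBot := by
    rw [collapse, ← mem_closure_iff_nhdsWithin_neBot, Metric.mem_closure_iff]
    intro ε hε
    refine ⟨(ξ, ξ + ε / 2), by simpa using hε, ?_⟩
    rw [Prod.dist_eq, dist_self, Real.dist_eq, max_lt_iff]
    refine ⟨hε, ?_⟩
    rw [abs_lt]; constructor <;> linarith
  refine tendsto_nhds_unique (tendsto_finsetSum _ fun β _ => hterm β)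
    (tendsto_const_nhds.congr' ?_)
  filter_upwards [h.eventually_strictMono] with p hp
  have := hc _ hp
  simp only [← mul_div_assoc, ← Finset.sum_div, this, zero_div]

open scoped ComplexOrder in
lemma coulombGas_ne_zero {N : ℕ} (β : LinkPattern N) {x : Fin (2 * N) → ℝ} (hx : x ∈ chamber N) :
    coulombGas β x ≠ 0 := (coulombGas_pos β hx).ne'

lemma exists_mem_chamber (N : ℕ) : ∃ x, x ∈ chamber N :=
  ⟨fun i => (i : ℕ), fun _ _ h => Nat.cast_lt.2 h⟩

lemma subsingleton_linkPattern_zero : Subsingleton (LinkPattern 0) :=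
  ⟨fun _ _ => LinkPattern.ext (funext fun i => i.elim0)⟩

lemma subsingleton_linkPattern_one : Subsingleton (LinkPattern 1) :=
  ⟨fun β γ => LinkPattern.ext (funext fun i => by
    have h1 := β.pair_ne i
    have h2 := γ.pair_ne i
    have := i.isLt
    have := (β.pair i).isLt
    have := (γ.pair i).isLt
    rw [Ne, Fin.ext_iff] at h1 h2
    rw [Fin.ext_iff]
    omega)⟩

/-- Linear independence of the Coulomb gas functions. -/
theorem coulombGas_independent : ∀ (N : ℕ) (c : LinkPattern N → ℂ),
    (∀ x ∈ chamber N, ∑ β, c β * coulombGas β x = 0) → c = 0 := by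
  have hsub : ∀ (N : ℕ), Subsingleton (LinkPattern N) → ∀ c : LinkPattern N → ℂ,
      (∀ x ∈ chamber N, ∑ β, c β * coulombGas β x = 0) → c = 0 := by
    intro N hN c hc
    funext β
    obtain ⟨x, hx⟩ := exists_mem_chamber N
    have := hc x hx
    rw [Fintype.sum_subsingleton _ β] at this
    exact (mul_eq_zero.1 this).resolve_right (coulombGas_ne_zero β hx)
  intro N
  induction N with
  | zero => exact hsub 0 subsingleton_linkPattern_zero
  | succ n ih =>
    intro c hc
    rcases n with _ | n
    · exact hsub 1 subsingleton_linkPattern_one c hc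
    classical
    refine LinkPattern.eq_zero_of_exchange (Nat.succ_pos n) c fun j A => ?_
    set red : LinkPattern (n + 1 + 1) → LinkPattern (n + 1) := fun β =>
      (β.tie j).removeLink j (β.tie_pair_lo j) with hred
    have hfib : ∀ w : LinkPattern (n + 1) → ℂ,
        ∑ β, (if β.pair (lo j) = hi j then 0 else c β * w (red β)) =
        ∑ γ, (∑ β, if red β = γ then (if β.pair (lo j) = hi j then 0 else c β) else 0) * w γ := by
      intro w
      simp only [Finset.sum_mul]
      rw [Finset.sum_comm]
      refine Finset.sum_congr rfl fun β _ => ?_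
      rw [Finset.sum_eq_single (red β)]
      · split_ifs <;> simp_all
      · intro γ _ hγ
        rw [if_neg (Ne.symm hγ), zero_mul]
      · simp
    have hzero := ih (fun γ => ∑ β, if red β = γ then
      (if β.pair (lo j) = hi j then 0 else c β) else 0) (fun y hy => by
        rw [← hfib fun γ => coulombGas γ y]
        exact relation_collapse hc j hy)
    have hspin := hfib fun γ => γ.spin A
    simp only [fun γ => congrFun hzero γ, Pi.zero_apply, zero_mul, Finset.sum_const_zero] at hspin
    rw [Finset.mul_sum, ← sub_eq_zero, ← Finset.sum_sub_distrib]
    have hkey : ∀ β : LinkPattern (n + 1 + 1),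
        c β * β.spin (insert (lo j) (skipSet j A)) -
          Complex.I * (c β * β.spin (insert (hi j) (skipSet j A))) =
        -Complex.I * (if β.pair (lo j) = hi j then 0 else c β * (red β).spin A) := by
      intro β
      split_ifs with hβ
      · rw [LinkPattern.spin_insert_lo β j hβ, LinkPattern.spin_insert_hi β j hβ]
        linear_combination (c β * (β.removeLink j hβ).spin A) * Complex.I_sq
      · linear_combination c β * LinkPattern.spin_exchange β j hβ A
    simp only [hkey, ← Finset.mul_sum, hspin, mul_zero]

end Independence

section Contour

variable {m : ℕ}

/-- The moment integrand, extended to the upper half-plane. -/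
def weightExt (x : Fin m → ℝ) (s : ℕ) (z : ℂ) : ℂ := z ^ s * ∏ i, (z - x i) ^ (-1 / 2 : ℂ)

lemma differentiableAt_weightExt (x : Fin m → ℝ) (s : ℕ) {z : ℂ} (hz : 0 < z.im) :
    DifferentiableAt ℂ (weightExt x s) z := by
  refine (differentiableAt_id.pow s).mul (DifferentiableAt.fun_finsetProd fun i _ => ?_)
  refine DifferentiableAt.cpow_const (by fun_prop) (Or.inr ?_)
  simpa using hz.ne'

lemma norm_weightExt (x : Fin m → ℝ) (s : ℕ) (z : ℂ) :
    ‖weightExt x s z‖ = ‖z‖ ^ s * ∏ i, ‖z - x i‖ ^ (-1 / 2 : ℝ) := by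
  rw [weightExt, norm_mul, norm_pow, norm_prod]
  congr 1
  refine Finset.prod_congr rfl fun i _ => ?_
  rw [← Complex.norm_cpow_real]
  norm_num

lemma tendsto_cpow_neg_half {t : ℝ} (ht : t ≠ 0) :
    Tendsto (fun ε : ℝ => ((t : ℂ) + ε * Complex.I) ^ (-1 / 2 : ℂ)) (𝓝[>] 0)
      (𝓝 ((t : ℂ) ^ (-1 / 2 : ℂ))) := by
  have hne : (t : ℂ) ≠ 0 := Complex.ofReal_ne_zero.2 ht
  have hpath : Tendsto (fun ε : ℝ => (t : ℂ) + ε * Complex.I) (𝓝[>] 0)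
      (𝓝[{z : ℂ | 0 ≤ z.im}] (t : ℂ)) := by
    refine tendsto_nhdsWithin_iff.2 ⟨?_, ?_⟩
    · have : Continuous fun ε : ℝ => (t : ℂ) + ε * Complex.I := by fun_prop
      have := (this.tendsto 0).mono_left (nhdsWithin_le_nhds (s := Ioi 0))
      simpa using this
    · filter_upwards [self_mem_nhdsWithin] with ε hε
      simpa using (mem_Ioi.1 hε).le
  have hlog : Tendsto (fun ε : ℝ => Complex.log ((t : ℂ) + ε * Complex.I)) (𝓝[>] 0)
      (𝓝 (Complex.log t)) := by
    rcases ht.lt_or_gt with h | h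
    · exact (Complex.continuousWithinAt_log_of_re_neg_of_im_zero (by simpa using h)
        (by simp)).tendsto.comp hpath
    · exact ((continuousAt_clog (Complex.ofReal_mem_slitPlane.2 h)).tendsto.mono_left
        nhdsWithin_le_nhds).comp hpath
  rw [Complex.cpow_def_of_ne_zero hne]
  refine ((Complex.continuous_exp.tendsto _).comp (hlog.mul_const _)).congr' ?_
  filter_upwards [self_mem_nhdsWithin] with ε hε
  rw [Function.comp_apply, Complex.cpow_def_of_ne_zero]
  intro h
  have := congrArg Complex.im h
  simp only [Complex.add_im, Complex.ofReal_im, Complex.mul_im, Complex.ofReal_re, Complex.I_im,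
    mul_one, Complex.I_re, mul_zero, add_zero, zero_add, Complex.zero_im] at this
  exact (mem_Ioi.1 hε).ne' this

lemma tendsto_integral_weightExt {x : Fin m → ℝ} (hx : Function.Injective x) (s : ℕ) {R : ℝ}
    (hR : 0 ≤ R) :
    Tendsto (fun ε : ℝ => ∫ u in (-R)..R, weightExt x s ((u : ℂ) + ε * Complex.I)) (𝓝[>] 0)
      (𝓝 (∫ u in (-R)..R, (u : ℂ) ^ s * weight x u)) := by
  have hle : -R ≤ R := by linarith
  have hae : ∀ᵐ u : ℝ, ∀ i, u ≠ x i :=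
    ae_all_iff.2 fun i => by simp [ae_iff, measure_singleton]
  refine intervalIntegral.tendsto_integral_filter_of_dominated_convergence
    (fun u => (R + 1) ^ s * ‖weight x u‖) ?_ ?_
    ((intervalIntegrable_weight hx _ _).norm.const_mul _) ?_
  · refine Eventually.of_forall fun ε => Measurable.aestronglyMeasurable ?_
    unfold weightExt
    fun_prop
  · filter_upwards [self_mem_nhdsWithin, nhdsWithin_le_nhds (Iio_mem_nhds one_pos)] with ε hε hε1
    filter_upwards [hae] with u hu huR
    rw [uIoc_of_le hle] at huR
    rw [norm_weightExt, norm_weight, absWeight]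
    have hε0 : 0 < ε := hε
    have hε1' : ε < 1 := hε1
    refine mul_le_mul (pow_le_pow_left₀ (norm_nonneg _) ?_ s)
      (Finset.prod_le_prod (fun i _ => by positivity) fun i _ => ?_)
      (Finset.prod_nonneg fun i _ => by positivity) (by positivity)
    · refine (norm_add_le _ _).trans ?_
      rw [norm_mul, Complex.norm_I, mul_one, Complex.norm_real, Complex.norm_real,
        Real.norm_eq_abs, Real.norm_eq_abs, abs_of_pos hε0]
      have : |u| ≤ R := abs_le.2 ⟨huR.1.le, huR.2⟩
      linarith
    · refine Real.rpow_le_rpow_of_nonpos (abs_pos.2 (sub_ne_zero.2 (hu i))) ?_ (by norm_num)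
      have := Complex.abs_re_le_norm ((u : ℂ) + ε * Complex.I - x i)
      simpa using this
  · filter_upwards [hae] with u hu _
    unfold weightExt weight
    refine Tendsto.mul ?_ (tendsto_finsetProd _ fun i _ => ?_)
    · have : Continuous fun ε : ℝ => ((u : ℂ) + ε * Complex.I) ^ s := by fun_prop
      have := (this.tendsto 0).mono_left (nhdsWithin_le_nhds (s := Ioi 0))
      simpa using this
    · have := tendsto_cpow_neg_half (sub_ne_zero.2 (hu i))
      push_cast at this
      refine this.congr fun ε => ?_
      congr 1; ring

/-- The integral over a large interval is small, by Cauchy's theorem in the upper half-plane. -/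
lemma norm_integral_weight_le {N : ℕ} {x : Fin (2 * N) → ℝ} (hx : Function.Injective x) {s : ℕ}
    (hs : s + 2 ≤ N) {R : ℝ} (hR : 1 ≤ R) (hxR : ∀ i, |x i| ≤ R / 2) :
    ‖∫ u in (-R)..R, (u : ℂ) ^ s * weight x u‖ ≤ 4 * (4 ^ s * 2 ^ N) / R := by
  have hR0 : 0 < R := by linarith
  refine le_of_tendsto (tendsto_integral_weightExt hx s hR0.le).norm ?_
  filter_upwards [self_mem_nhdsWithin, nhdsWithin_le_nhds (Iio_mem_nhds one_pos)] with ε hε hε1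
  have hε0 : 0 < ε := hε
  have hε1' : ε < 1 := hε1
  set M : ℝ := 4 ^ s * 2 ^ N / R ^ 2 with hM
  have hbound : ∀ z : ℂ, R ≤ ‖z‖ → ‖z‖ ≤ 4 * R → ‖weightExt x s z‖ ≤ M := by
    intro z h1 h2
    have hprod : ∏ i, ‖z - x i‖ ^ (-1 / 2 : ℝ) ≤ (2 / R) ^ N := by
      have hterm : ∀ i, ‖z - x i‖ ^ (-1 / 2 : ℝ) ≤ (R / 2) ^ (-1 / 2 : ℝ) := by
        intro i
        refine Real.rpow_le_rpow_of_nonpos (by positivity) ?_ (by norm_num)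
        have h3 := norm_sub_norm_le z (x i : ℂ)
        rw [Complex.norm_real, Real.norm_eq_abs] at h3
        linarith [hxR i]
      refine (Finset.prod_le_prod (fun i _ => by positivity) fun i _ => hterm i).trans
        (le_of_eq ?_)
      rw [Finset.prod_const, Finset.card_univ, Fintype.card_fin, pow_mul,
        ← Real.rpow_natCast ((R / 2) ^ (-1 / 2 : ℝ)) 2,
        ← Real.rpow_mul (by positivity), show (-1 / 2 : ℝ) * ((2 : ℕ) : ℝ) = -1 by norm_num,
        Real.rpow_neg_one, inv_div]
    rw [norm_weightExt]
    calc ‖z‖ ^ s * ∏ i, ‖z - x i‖ ^ (-1 / 2 : ℝ) ≤ (4 * R) ^ s * (2 / R) ^ N :=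
          mul_le_mul (pow_le_pow_left₀ (norm_nonneg _) h2 s) hprod
            (Finset.prod_nonneg fun i _ => by positivity) (by positivity)
      _ = 4 ^ s * 2 ^ N * (R ^ s / R ^ N) := by rw [mul_pow, div_pow]; ring
      _ ≤ 4 ^ s * 2 ^ N * (1 / R ^ 2) := by
          refine mul_le_mul_of_nonneg_left ?_ (by positivity)
          rw [div_le_div_iff₀ (by positivity) (by positivity), one_mul, ← pow_add]
          exact pow_le_pow_right₀ hR hs
      _ = M := by rw [hM]; ring
  have hrect := Complex.integral_boundary_rect_eq_zero_of_differentiableOn (weightExt x s)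
    (⟨-R, ε⟩ : ℂ) (⟨R, ε + R⟩ : ℂ) (fun z hz => by
      refine (differentiableAt_weightExt x s ?_).differentiableWithinAt
      have := hz.2
      simp only [mem_preimage] at this
      rw [uIcc_of_le (by linarith)] at this
      exact hε0.trans_le this.1)
  simp only at hrect
  have htop : ‖∫ u in (-R)..R, weightExt x s ((u : ℂ) + ((ε + R : ℝ) : ℂ) * Complex.I)‖ ≤
      M * |R - -R| := by
    refine intervalIntegral.norm_integral_le_of_norm_le_const fun u hu => ?_
    rw [uIoc_of_le (by linarith)] at hu
    refine hbound _ ?_ ?_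
    · have := Complex.abs_im_le_norm ((u : ℂ) + ((ε + R : ℝ) : ℂ) * Complex.I)
      simp only [Complex.add_im, Complex.ofReal_im, Complex.mul_im, Complex.ofReal_re,
        Complex.I_im, mul_one, Complex.I_re, mul_zero, add_zero, zero_add] at this
      rw [abs_of_pos (by linarith)] at this
      linarith
    · refine (norm_add_le _ _).trans ?_
      rw [norm_mul, Complex.norm_I, mul_one, Complex.norm_real, Complex.norm_real,
        Real.norm_eq_abs, Real.norm_eq_abs, abs_of_pos (by linarith : 0 < ε + R)]
      have : |u| ≤ R := abs_le.2 ⟨hu.1.le, hu.2⟩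
      linarith
  have hside : ∀ t : ℝ, |t| = R →
      ‖∫ y in ε..(ε + R), weightExt x s ((t : ℂ) + (y : ℂ) * Complex.I)‖ ≤ M * |ε + R - ε| := by
    intro t ht
    refine intervalIntegral.norm_integral_le_of_norm_le_const fun y hy => ?_
    rw [uIoc_of_le (by linarith)] at hy
    refine hbound _ ?_ ?_
    · have := Complex.abs_re_le_norm ((t : ℂ) + (y : ℂ) * Complex.I)
      simp only [Complex.add_re, Complex.ofReal_re, Complex.mul_re, Complex.I_re, mul_zero,
        Complex.ofReal_im, Complex.I_im, zero_mul, sub_zero, add_zero] at this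
      linarith
    · refine (norm_add_le _ _).trans ?_
      rw [norm_mul, Complex.norm_I, mul_one, Complex.norm_real, Complex.norm_real,
        Real.norm_eq_abs, Real.norm_eq_abs, ht, abs_of_pos (hε0.trans hy.1)]
      linarith [hy.2]
  have hr := hside R (abs_of_pos hR0)
  have hl := hside (-R) (by rw [abs_neg, abs_of_pos hR0])
  have hMR : M * R = 4 ^ s * 2 ^ N / R := by rw [hM]; field_simp
  rw [add_sub_cancel_left, abs_of_pos hR0, hMR] at hr hl
  rw [sub_neg_eq_add, abs_of_pos (by linarith), mul_add, hMR] at htop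
  have heq : ∫ u in (-R)..R, weightExt x s ((u : ℂ) + (ε : ℂ) * Complex.I) =
      (∫ u in (-R)..R, weightExt x s ((u : ℂ) + ((ε + R : ℝ) : ℂ) * Complex.I)) -
      Complex.I • (∫ y in ε..(ε + R), weightExt x s ((R : ℂ) + (y : ℂ) * Complex.I)) +
      Complex.I • ∫ y in ε..(ε + R), weightExt x s (((-R : ℝ) : ℂ) + (y : ℂ) * Complex.I) := by
    linear_combination hrect
  rw [heq]
  refine (norm_add_le _ _).trans ((add_le_add (norm_sub_le _ _) le_rfl).trans ?_)
  rw [norm_smul, norm_smul, Complex.norm_I, one_mul, one_mul]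
  calc _ ≤ (4 ^ s * 2 ^ N / R + 4 ^ s * 2 ^ N / R) + 4 ^ s * 2 ^ N / R + 4 ^ s * 2 ^ N / R := by
        gcongr
    _ = _ := by ring

end Contour

section AlternatingMoment

variable {N : ℕ}

/-- The alternating sum of the moments along the links. -/
def alternatingMoment (β : LinkPattern N) (s : ℕ) (x : Fin (2 * N) → ℝ) : ℂ :=
  ∑ r, (-1) ^ (β.a r : ℕ) * moment x 0 s (β.a r) (β.b r)

lemma sum_Ico_neg_one_pow {m n : ℕ} (h : m ≤ n) :
    ∑ k ∈ Finset.Ico m n, (-1 : ℂ) ^ k = ((-1) ^ m - (-1) ^ n) / 2 := by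
  induction n, h using Nat.le_induction with
  | base => simp
  | succ n h ih => rw [Finset.sum_Ico_succ_top h, ih, pow_succ]; ring

lemma sum_neg_one_pow_mul_weight {x : Fin (2 * N) → ℝ} (hx : StrictMono x) (u : ℝ) :
    ∑ k : Fin (2 * N), (if u < x k then (-1 : ℂ) ^ (k : ℕ) * weight x u else 0) =
      -(weight x u - (starRingEnd ℂ) (weight x u)) / 2 := by
  set t := (Finset.univ.filter fun i => u < x i).card with ht
  have ht2 : t ≤ 2 * N := by simpa using Finset.card_le_univ (Finset.univ.filter fun i => u < x i)
  have hiff : ∀ k : Fin (2 * N), u < x k ↔ 2 * N - t ≤ k := by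
    intro k
    have hk := k.isLt
    constructor
    · intro h
      have : Finset.Ici k ⊆ Finset.univ.filter fun i => u < x i := fun i hi => by
        simpa using h.trans_le (hx.monotone (Finset.mem_Ici.1 hi))
      have := Finset.card_le_card this
      rw [Fin.card_Ici] at this
      omega
    · intro h
      by_contra hu
      have : (Finset.univ.filter fun i => u < x i) ⊆ Finset.Ioi k := fun i hi => by
        simp only [Finset.mem_filter, Finset.mem_univ, true_and] at hi
        exact Finset.mem_Ioi.2 (hx.lt_iff_lt.1 ((not_lt.1 hu).trans_lt hi))
      have := Finset.card_le_card this
      rw [Fin.card_Ioi] at this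
      omega
  have hsum : ∑ k : Fin (2 * N), (if u < x k then (-1 : ℂ) ^ (k : ℕ) else 0) =
      ((-1) ^ t - 1) / 2 := by
    simp only [hiff]
    rw [Fin.sum_univ_eq_sum_range (fun k => if 2 * N - t ≤ k then (-1 : ℂ) ^ k else 0),
      ← Finset.sum_filter]
    have : (Finset.range (2 * N)).filter (fun k => 2 * N - t ≤ k) =
        Finset.Ico (2 * N - t) (2 * N) := by
      ext k; simp only [Finset.mem_filter, Finset.mem_range, Finset.mem_Ico]; omega
    rw [this, sum_Ico_neg_one_pow (by omega)]
    have h1 : (-1 : ℂ) ^ (2 * N) = 1 := by rw [pow_mul]; simp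
    have h2 : (-1 : ℂ) ^ (2 * N - t) * (-1) ^ t = 1 := by
      rw [← pow_add, Nat.sub_add_cancel ht2, h1]
    have h3 : ((-1 : ℂ) ^ t) * (-1) ^ t = 1 := by rw [← mul_pow]; simp
    rw [h1]
    linear_combination (1 / 2 * (-1) ^ t) * h2 - (1 / 2 * (-1) ^ (2 * N - t)) * h3
  have hconj : (starRingEnd ℂ) (weight x u) = (-1) ^ t * weight x u := by
    rw [weight_eq, map_mul, map_pow, map_neg, Complex.conj_I, neg_neg, Complex.conj_ofReal, ← ht,
      ← mul_assoc, ← mul_pow]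
    simp
  have hmul : ∀ k : Fin (2 * N), (if u < x k then (-1 : ℂ) ^ (k : ℕ) * weight x u else 0) =
      (if u < x k then (-1 : ℂ) ^ (k : ℕ) else 0) * weight x u := by
    intro k; split_ifs <;> simp
  simp only [hmul]
  rw [← Finset.sum_mul, hsum, hconj]
  ring

lemma alternatingMoment_eq (β : LinkPattern N) {x : Fin (2 * N) → ℝ} (hx : StrictMono x) (s : ℕ)
    {R : ℝ} (hR : ∀ k, |x k| ≤ R) (hR0 : 0 ≤ R) :
    alternatingMoment β s x = ((∫ u in (-R)..R, (u : ℂ) ^ s * weight x u) -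
      (starRingEnd ℂ) (∫ u in (-R)..R, (u : ℂ) ^ s * weight x u)) / 2 := by
  have hint : ∀ a b, IntervalIntegrable (fun u : ℝ => (u : ℂ) ^ s * weight x u) volume a b := by
    intro a b
    have := intervalIntegrable_mul_weight hx.injective (continuous_sub_pow 0 s) a b
    simpa using this
  have hle : -R ≤ R := by linarith
  set V : Fin (2 * N) → ℂ := fun k => ∫ u in (-R)..(x k), (u : ℂ) ^ s * weight x u with hV
  have h1 : alternatingMoment β s x = -∑ k : Fin (2 * N), (-1) ^ (k : ℕ) * V k := by
    rw [β.sum_eq_sum_links, ← Finset.sum_neg_distrib]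
    refine Finset.sum_congr rfl fun r _ => ?_
    have hpar : (-1 : ℂ) ^ (β.b r : ℕ) = -(-1) ^ (β.a r : ℕ) := by
      have := β.pair_mod_two (β.a r)
      rcases Nat.even_or_odd (β.a r : ℕ) with h | h
      · rw [h.neg_one_pow, Odd.neg_one_pow]
        rw [Nat.odd_iff]
        rw [Nat.even_iff] at h
        rw [LinkPattern.b]; omega
      · rw [h.neg_one_pow, Even.neg_one_pow, neg_neg]
        rw [Nat.even_iff]
        rw [Nat.odd_iff] at h
        rw [LinkPattern.b]; omega
    have hm : moment x 0 s (β.a r) (β.b r) = V (β.b r) - V (β.a r) := by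
      simp only [hV, moment, Complex.ofReal_zero, sub_zero]
      exact (intervalIntegral.integral_interval_sub_left (hint _ _) (hint _ _)).symm
    rw [hm, hpar]; ring
  have h2 : ∀ k, V k = ∫ u in (-R)..R, (if u < x k then (u : ℂ) ^ s * weight x u else 0) := by
    intro k
    have hk := abs_le.1 (hR k)
    have hi1 : ∫ u in (-R)..(x k), (if u < x k then (u : ℂ) ^ s * weight x u else 0) = V k := by
      refine intervalIntegral.integral_congr_ae ?_
      have : ∀ᵐ u : ℝ, u ≠ x k := by simp [ae_iff, measure_singleton]
      filter_upwards [this] with u hu hu'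
      rw [uIoc_of_le hk.1] at hu'
      rw [if_pos (lt_of_le_of_ne hu'.2 hu)]
    have hi2 : ∫ u in (x k)..R, (if u < x k then (u : ℂ) ^ s * weight x u else 0) = 0 := by
      rw [intervalIntegral.integral_congr (g := fun _ => 0), intervalIntegral.integral_zero]
      intro u hu
      rw [uIcc_of_le hk.2] at hu
      exact if_neg (not_lt.2 hu.1)
    have hii : ∀ a b, IntervalIntegrable
        (fun u => if u < x k then (u : ℂ) ^ s * weight x u else 0) volume a b := by
      intro a b
      have hm : MeasurableSet {u : ℝ | u < x k} := measurableSet_Iio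
      exact ⟨(hint a b).1.indicator hm, (hint a b).2.indicator hm⟩
    rw [← intervalIntegral.integral_add_adjacent_intervals (hii (-R) (x k)) (hii (x k) R), hi1, hi2,
      add_zero]
  have hii : ∀ k a b, IntervalIntegrable
      (fun u => (-1 : ℂ) ^ (k : Fin (2 * N)).val *
        (if u < x k then (u : ℂ) ^ s * weight x u else 0)) volume a b := by
    intro k a b
    have hm : MeasurableSet {u : ℝ | u < x k} := measurableSet_Iio
    exact IntervalIntegrable.const_mul
      ⟨(hint a b).1.indicator hm, (hint a b).2.indicator hm⟩ _
  have hconj : (starRingEnd ℂ) (∫ u in (-R)..R, (u : ℂ) ^ s * weight x u) =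
      ∫ u in (-R)..R, (starRingEnd ℂ) ((u : ℂ) ^ s * weight x u) := by
    rw [intervalIntegral.integral_of_le hle, intervalIntegral.integral_of_le hle, integral_conj]
  have hci : IntervalIntegrable (fun u : ℝ => (starRingEnd ℂ) ((u : ℂ) ^ s * weight x u)) volume
      (-R) R := by
    have h := hint (-R) R
    exact ⟨(Complex.conjLIE.integrable_comp_iff).2 h.1, (Complex.conjLIE.integrable_comp_iff).2 h.2⟩
  rw [h1, hconj, ← intervalIntegral.integral_sub (hint _ _) hci]
  simp only [h2, ← intervalIntegral.integral_const_mul]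
  rw [← intervalIntegral.integral_finsetSum fun k _ => hii k _ _, ← intervalIntegral.integral_neg,
    ← intervalIntegral.integral_div]
  refine intervalIntegral.integral_congr fun u _ => ?_
  have h := sum_neg_one_pow_mul_weight hx u
  have hs : ∑ k : Fin (2 * N), (-1 : ℂ) ^ (k : ℕ) *
      (if u < x k then (u : ℂ) ^ s * weight x u else 0) = (u : ℂ) ^ s *
      ∑ k : Fin (2 * N), (if u < x k then (-1 : ℂ) ^ (k : ℕ) * weight x u else 0) := by
    rw [Finset.mul_sum]
    refine Finset.sum_congr rfl fun k _ => ?_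
    split_ifs <;> ring
  simp only [hs, h, map_mul, map_pow, Complex.conj_ofReal]
  ring

lemma alternatingMoment_eq_zero (β : LinkPattern N) {x : Fin (2 * N) → ℝ} (hx : StrictMono x)
    {s : ℕ} (hs : s + 2 ≤ N) : alternatingMoment β s x = 0 := by
  set C : ℝ := 4 * (4 ^ s * 2 ^ N) with hC
  have hlim : Tendsto (fun R : ℝ => C / R) atTop (𝓝 0) := tendsto_const_nhds.div_atTop tendsto_id
  have hev : ∀ᶠ R : ℝ in atTop, ‖alternatingMoment β s x‖ ≤ C / R := by
    have h1 : ∀ᶠ R : ℝ in atTop, ∀ i, |x i| ≤ R / 2 := eventually_all.2 fun i => by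
      filter_upwards [eventually_ge_atTop (2 * |x i|)] with R hR
      linarith
    filter_upwards [h1, eventually_ge_atTop 1] with R hR hR1
    rw [alternatingMoment_eq β hx s (R := R) (fun k => (hR k).trans (by linarith)) (by linarith),
      norm_div]
    have hb := norm_integral_weight_le hx.injective hs hR1 hR
    refine (div_le_div_of_nonneg_right (norm_sub_le _ _) (norm_nonneg _)).trans ?_
    rw [RCLike.norm_conj, Complex.norm_ofNat]
    linarith
  have := ge_of_tendsto hlim hev
  exact norm_le_zero_iff.1 this

lemma isPeriodFamily_alternatingMoment (β : LinkPattern N) :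
    IsPeriodFamily 0 (alternatingMoment β) :=
  IsPeriodFamily.sum _ fun r _ => (β.isPeriodFamily 0 r).const_mul _

lemma convex_strictMono (m : ℕ) : Convex ℝ {x : Fin m → ℝ | StrictMono x} := by
  intro x hx y hy a b ha hb hab i j hij
  have h1 := hx hij
  have h2 := hy hij
  simp only [Pi.add_apply, Pi.smul_apply, smul_eq_mul]
  rcases ha.eq_or_lt with rfl | ha
  · have : b = 1 := by linarith
    subst this; linarith
  · nlinarith

lemma eq_of_partialDeriv_eq_zero {m : ℕ} {f : (Fin m → ℝ) → ℂ}
    (hf : ∀ x, StrictMono x → DifferentiableAt ℝ f x)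
    (h : ∀ x, StrictMono x → ∀ i, partialDeriv i f x = 0) {x y : Fin m → ℝ} (hx : StrictMono x)
    (hy : StrictMono y) : f x = f y := by
  refine (isOpen_strictMono m).is_const_of_fderiv_eq_zero (𝕜 := ℝ)
    (convex_strictMono m).isPreconnected (fun z hz => (hf z hz).differentiableWithinAt)
    (fun z hz => ?_) hx hy
  ext v
  rw [← Finset.univ_sum_single v, map_sum]
  simp only [Pi.zero_apply, zero_apply]
  refine Finset.sum_eq_zero fun i _ => ?_
  have h1 : (Pi.single i (v i) : Fin m → ℝ) = v i • Pi.single i 1 := by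
    ext k; simp [Pi.single_apply]
  have h2 := h z hz i
  rw [partialDeriv] at h2
  rw [h1, map_smul, h2, smul_zero]

/-- The alternating sum of the highest moments does not depend on the points. -/
lemma alternatingMoment_const {n : ℕ} (β : LinkPattern (n + 1)) {x y : Fin (2 * (n + 1)) → ℝ}
    (hx : StrictMono x) (hy : StrictMono y) :
    alternatingMoment β n x = alternatingMoment β n y := by
  rcases n with _ | n
  · have key : ∀ z : Fin (2 * (0 + 1)) → ℝ, StrictMono z →
        alternatingMoment β 0 z = (-Complex.I) * Real.pi := by
      intro z hz
      have hlt : (β.a 0 : ℕ) < β.b 0 := β.a_lt_b 0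
      have hb := (β.b 0).isLt
      have ha : β.a 0 = 0 := Fin.ext (by simp; omega)
      have hb' : β.b 0 = 1 := Fin.ext (by simp; omega)
      rw [alternatingMoment, Fin.sum_univ_one, ha, hb',
        moment_eq_gapMoment hz 0 0 (by simp)]
      have hcard : (Finset.Ioi (0 : Fin (2 * (0 + 1)))).card = 1 := by rw [Fin.card_Ioi]; simp
      have hempty : ((Finset.univ.erase (0 : Fin (2 * (0 + 1)))).erase 1) = ∅ := by decide
      rw [hcard, gapMoment]
      simp [restWeight, hempty]
    rw [key x hx, key y hy]
  · have hP := isPeriodFamily_alternatingMoment β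
    refine eq_of_partialDeriv_eq_zero (fun z hz => hP.differentiableAt _ hz) (fun z hz i => ?_) hx hy
    rw [hP.recurrence n i z hz, alternatingMoment_eq_zero β hz (by omega),
      partialDeriv_congr (isOpen_strictMono _) (g := fun _ => 0)
        (fun w hw => alternatingMoment_eq_zero β hw (by omega)) hz]
    simp [partialDeriv]

/-- Reduction of the period determinant by means of the vanishing alternating moments. -/
theorem det_moment_eq {n : ℕ} (β : LinkPattern (n + 1)) {x : Fin (2 * (n + 1)) → ℝ}
    (hx : StrictMono x) :
    (Matrix.of fun r s : Fin (n + 1) => moment x 0 s (β.a r) (β.b r)).det =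
      (-1) ^ (β.a 0 : ℕ) * (-1) ^ n * alternatingMoment β n x *
        (Matrix.of fun r s : Fin n => moment x 0 s (β.a r.succ) (β.b r.succ)).det := by
  set A : Matrix (Fin (n + 1)) (Fin (n + 1)) ℂ :=
    Matrix.of fun r s : Fin (n + 1) => moment x 0 s (β.a r) (β.b r) with hA
  have hrow : ∀ s : Fin (n + 1), (∑ r, (-1 : ℂ) ^ (β.a r : ℕ) • A r) s =
      alternatingMoment β s x := by
    intro s
    simp [Finset.sum_apply, hA, alternatingMoment]
  have h1 : (A.updateRow 0 (∑ r, (-1 : ℂ) ^ (β.a r : ℕ) • A r)).det =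
      (-1) ^ (β.a 0 : ℕ) * A.det := by
    rw [Matrix.det_updateRow_sum, smul_eq_mul]
  have h2 : (A.updateRow 0 (∑ r, (-1 : ℂ) ^ (β.a r : ℕ) • A r)).det =
      (-1) ^ n * alternatingMoment β n x *
        (Matrix.of fun r s : Fin n => moment x 0 s (β.a r.succ) (β.b r.succ)).det := by
    rw [Matrix.det_succ_row_zero, Finset.sum_eq_single (Fin.last n)]
    · rw [Matrix.updateRow_self, hrow, Fin.val_last]
      congr 2
      ext r s
      simp [Matrix.submatrix_apply, hA]
    · intro s _ hs
      have : (s : ℕ) < n := Fin.val_lt_last hs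
      rw [Matrix.updateRow_self, hrow, alternatingMoment_eq_zero β hx (by omega), mul_zero, zero_mul]
    · simp
  have h3 : ((-1 : ℂ) ^ (β.a 0 : ℕ)) * (-1) ^ (β.a 0 : ℕ) = 1 := by rw [← mul_pow]; simp
  rw [h2] at h1
  linear_combination (-A.det) * h3 - (-1) ^ (β.a 0 : ℕ) * h1

end AlternatingMoment

section Covariance

variable {a b c d : ℝ}

lemma mobius_neg (a b c d : ℝ) : mobius (-a) (-b) (-c) (-d) = mobius a b c d := by
  funext t
  rw [mobius, mobius, show -a * t + -b = -(a * t + b) by ring,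
    show -c * t + -d = -(c * t + d) by ring, neg_div_neg_eq]

lemma mobius_sub_mobius {t u : ℝ} (ht : c * t + d ≠ 0) (hu : c * u + d ≠ 0) :
    mobius a b c d u - mobius a b c d t =
      (a * d - b * c) * (u - t) / ((c * t + d) * (c * u + d)) := by
  rw [mobius, mobius, div_sub_div _ _ hu ht, div_eq_div_iff (mul_ne_zero hu ht) (mul_ne_zero ht hu)]
  ring

lemma hasDerivAt_mobius {t : ℝ} (ht : c * t + d ≠ 0) :
    HasDerivAt (mobius a b c d) ((a * d - b * c) / (c * t + d) ^ 2) t := by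
  have h1 : HasDerivAt (fun t => a * t + b) a t := by
    simpa using ((hasDerivAt_id t).const_mul a).add_const b
  have h2 : HasDerivAt (fun t => c * t + d) c t := by
    simpa using ((hasDerivAt_id t).const_mul c).add_const d
  exact (h1.div h2 ht).congr_deriv (by ring)

lemma mobius_denom_pos {p q u : ℝ} (hp : 0 < c * p + d) (hq : 0 < c * q + d) (h : u ∈ Icc p q) :
    0 < c * u + d := by
  rcases le_total 0 c with hc | hc
  · nlinarith [mul_le_mul_of_nonneg_left h.1 hc]
  · nlinarith [mul_le_mul_of_nonpos_left h.2 hc]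

lemma mobius_lt_mobius (hD : 0 < a * d - b * c) {t u : ℝ} (ht : 0 < c * t + d)
    (hu : 0 < c * u + d) (h : t < u) : mobius a b c d t < mobius a b c d u := by
  rw [← sub_pos, mobius_sub_mobius ht.ne' hu.ne']
  have := sub_pos.2 h
  positivity

lemma image_mobius_Ioo (hD : 0 < a * d - b * c) {p q : ℝ} (hpq : p ≤ q) (hp : 0 < c * p + d)
    (hq : 0 < c * q + d) :
    mobius a b c d '' Ioo p q = Ioo (mobius a b c d p) (mobius a b c d q) := by
  refine Subset.antisymm ?_ (intermediate_value_Ioo hpq fun u hu =>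
    (hasDerivAt_mobius (mobius_denom_pos hp hq hu).ne').continuousAt.continuousWithinAt)
  rintro _ ⟨u, hu, rfl⟩
  have := mobius_denom_pos hp hq (Ioo_subset_Icc_self hu)
  exact ⟨mobius_lt_mobius hD hp this hu.1, mobius_lt_mobius hD this hq hu.2⟩

lemma logVdm_mobius {m : ℕ} (hD : 0 < a * d - b * c) {x : Fin m → ℝ} (hx : StrictMono x)
    (hw : ∀ i, 0 < c * x i + d) :
    logVdm (mobius a b c d ∘ x) = logVdm x + m * (m - 1) / 8 * Real.log (a * d - b * c) -
      (m - 1) / 4 * ∑ i, Real.log (c * x i + d) := by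
  have key : ∀ i j, Real.log ((mobius a b c d ∘ x) j - (mobius a b c d ∘ x) i) =
      Real.log (x j - x i) + (Real.log (a * d - b * c) - Real.log (c * x i + d) -
        Real.log (c * x j + d)) - if i = j then (Real.log (a * d - b * c) -
          2 * Real.log (c * x i + d)) else 0 := by
    intro i j
    split_ifs with h
    · subst h; simp; ring
    · have hne : x j - x i ≠ 0 := sub_ne_zero.2 fun e => h (hx.injective e).symm
      simp only [Function.comp]
      rw [mobius_sub_mobius (hw i).ne' (hw j).ne', Real.log_div (mul_ne_zero hD.ne' hne)
        (mul_pos (hw i) (hw j)).ne', Real.log_mul hD.ne' hne, Real.log_mul (hw i).ne' (hw j).ne']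
      ring
  simp only [logVdm, key, Finset.sum_sub_distrib, Finset.sum_add_distrib, Finset.sum_const,
    Finset.sum_ite_eq, Finset.mem_univ, if_true, Finset.card_univ, Fintype.card_fin,
    nsmul_eq_mul, ← Finset.mul_sum]
  ring

lemma prod_deriv_mobius {m : ℕ} (hD : 0 < a * d - b * c) {x : Fin m → ℝ}
    (hw : ∀ i, 0 < c * x i + d) :
    ∏ i, deriv (mobius a b c d) (x i) ^ (-1 / 8 : ℝ) =
      Real.exp (-m / 8 * Real.log (a * d - b * c) + 1 / 4 * ∑ i, Real.log (c * x i + d)) := by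
  have key : ∀ i, deriv (mobius a b c d) (x i) ^ (-1 / 8 : ℝ) =
      Real.exp (-1 / 8 * Real.log (a * d - b * c) + 1 / 4 * Real.log (c * x i + d)) := by
    intro i
    have hi := hw i
    rw [(hasDerivAt_mobius hi.ne').deriv, Real.rpow_def_of_pos (by positivity),
      Real.log_div hD.ne' (by positivity), Real.log_pow]
    congr 1
    push_cast; ring
  simp only [key]
  rw [← Real.exp_sum, Finset.sum_add_distrib, Finset.sum_const, ← Finset.mul_sum]
  congr 1
  simp; ring

lemma weight_mobius {N : ℕ} (hD : 0 < a * d - b * c) {x : Fin (2 * N) → ℝ}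
    (hw : ∀ i, 0 < c * x i + d) {u : ℝ} (hu : 0 < c * u + d) :
    weight (mobius a b c d ∘ x) (mobius a b c d u) =
      ((Real.exp (-N * Real.log (a * d - b * c) + 1 / 2 * ∑ i, Real.log (c * x i + d)) : ℝ) : ℂ) *
        ((c * u + d : ℝ) : ℂ) ^ N * weight x u := by
  have key : ∀ i, ((mobius a b c d u : ℂ) - (mobius a b c d (x i) : ℂ)) ^ (-1 / 2 : ℂ) =
      ((Real.exp (-1 / 2 * Real.log (a * d - b * c) + 1 / 2 * Real.log (c * x i + d)) : ℝ) : ℂ) *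
        ((Real.exp (1 / 2 * Real.log (c * u + d)) : ℝ) : ℂ) *
        ((u : ℂ) - (x i : ℂ)) ^ (-1 / 2 : ℂ) := by
    intro i
    have hi := hw i
    have hpos : 0 < (a * d - b * c) / ((c * x i + d) * (c * u + d)) := by positivity
    have hneg : (a * d - b * c) / ((c * x i + d) * (c * u + d)) * (u - x i) < 0 ↔ u - x i < 0 := by
      rw [← not_le, ← not_le, mul_nonneg_iff_of_pos_left hpos]
    rw [← Complex.ofReal_sub, ← Complex.ofReal_sub, ofReal_cpow_neg_half, ofReal_cpow_neg_half,
      mobius_sub_mobius hi.ne' hu.ne', mul_div_right_comm, abs_mul, abs_of_pos hpos,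
      Real.mul_rpow hpos.le (abs_nonneg _), if_congr hneg rfl rfl]
    have : ((a * d - b * c) / ((c * x i + d) * (c * u + d))) ^ (-1 / 2 : ℝ) =
        Real.exp (-1 / 2 * Real.log (a * d - b * c) + 1 / 2 * Real.log (c * x i + d)) *
          Real.exp (1 / 2 * Real.log (c * u + d)) := by
      rw [Real.rpow_def_of_pos hpos, Real.log_div hD.ne' (by positivity), Real.log_mul hi.ne' hu.ne',
        ← Real.exp_add]
      congr 1; ring
    rw [this]
    push_cast; ring
  have hN : (Real.exp (1 / 2 * Real.log (c * u + d)) : ℝ) ^ (2 * N) = (c * u + d) ^ N := by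
    rw [pow_mul, ← Real.exp_nat_mul]
    congr 1
    rw [show ((2 : ℕ) : ℝ) * (1 / 2 * Real.log (c * u + d)) = Real.log (c * u + d) by
      push_cast; ring, Real.exp_log hu]
  simp only [weight, Function.comp, key, Finset.prod_mul_distrib, Finset.prod_const,
    Finset.card_univ, Fintype.card_fin]
  rw [← Complex.ofReal_prod, ← Complex.ofReal_pow, hN, ← Real.exp_sum, Finset.sum_add_distrib,
    Finset.sum_const, ← Finset.mul_sum, Complex.ofReal_pow]
  congr 5
  simp; ring

lemma moment_mobius {n : ℕ} (hD : 0 < a * d - b * c) {x : Fin (2 * (n + 1)) → ℝ}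
    (hw : ∀ i, 0 < c * x i + d) {s : ℕ} (hs : s < n) {p q : Fin (2 * (n + 1))} (hpq : x p < x q) :
    moment (mobius a b c d ∘ x) 0 s p q =
      ((Real.exp (-n * Real.log (a * d - b * c) + 1 / 2 * ∑ i, Real.log (c * x i + d)) : ℝ) : ℂ) *
        ∫ u in Ioo (x p) (x q), ((a * u + b : ℝ) : ℂ) ^ s * ((c * u + d : ℝ) : ℂ) ^ (n - 1 - s) *
          weight x u := by
  rw [moment, Function.comp_apply, Function.comp_apply,
    intervalIntegral.integral_of_le (mobius_lt_mobius hD (hw p) (hw q) hpq).le,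
    integral_Ioc_eq_integral_Ioo,
    ← image_mobius_Ioo hD hpq.le (hw p) (hw q),
    integral_image_eq_integral_deriv_smul_of_monotoneOn measurableSet_Ioo
      (f' := fun u => (a * d - b * c) / (c * u + d) ^ 2)
      (fun u hu => (hasDerivAt_mobius
        (mobius_denom_pos (hw p) (hw q) (Ioo_subset_Icc_self hu)).ne').hasDerivWithinAt)
      (StrictMonoOn.monotoneOn fun u hu v hv h => mobius_lt_mobius hD
        (mobius_denom_pos (hw p) (hw q) (Ioo_subset_Icc_self hu))
        (mobius_denom_pos (hw p) (hw q) (Ioo_subset_Icc_self hv)) h),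
    ← integral_const_mul]
  refine setIntegral_congr_fun measurableSet_Ioo fun u hu => ?_
  have hu := mobius_denom_pos (hw p) (hw q) (Ioo_subset_Icc_self hu)
  have hu' : ((c * u + d : ℝ) : ℂ) ≠ 0 := Complex.ofReal_ne_zero.2 hu.ne'
  have hexp : (a * d - b * c) * Real.exp (-((n + 1 : ℕ) : ℝ) * Real.log (a * d - b * c) +
      1 / 2 * ∑ i, Real.log (c * x i + d)) =
      Real.exp (-n * Real.log (a * d - b * c) + 1 / 2 * ∑ i, Real.log (c * x i + d)) := by
    nth_rw 1 [← Real.exp_log hD]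
    rw [← Real.exp_add]
    congr 1
    push_cast; ring
  have hpow : ((c * u + d : ℝ) : ℂ) ^ (n + 1) =
      ((c * u + d : ℝ) : ℂ) ^ (n - 1 - s) * ((c * u + d : ℝ) : ℂ) ^ 2 *
        ((c * u + d : ℝ) : ℂ) ^ s := by
    rw [← pow_add, ← pow_add]; congr 1; omega
  simp only [Complex.real_smul, Complex.ofReal_zero, sub_zero]
  rw [weight_mobius hD hw hu, ← hexp, hpow, mobius, Complex.ofReal_div, Complex.ofReal_mul, Complex.ofReal_div,
    Complex.ofReal_pow, div_pow]
  field_simp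

lemma sum_card_Ioi (n : ℕ) : ((∑ i : Fin n, (Finset.Ioi i).card : ℕ) : ℝ) = n * (n - 1) / 2 := by
  simp only [Fin.card_Ioi]
  rw [Fin.sum_univ_eq_sum_range (fun i => n - 1 - i), Finset.sum_range_reflect (fun i => i)]
  have h := Finset.sum_range_id_mul_two n
  rcases n with _ | n
  · simp
  · have : (((∑ i ∈ Finset.range (n + 1), i : ℕ) : ℝ)) * 2 = (n + 1) * n := by
      exact_mod_cast h
    rw [eq_div_iff two_ne_zero, this]
    push_cast; ring

/-- The determinant of Möbius-transformed powers is a multiple of a Vandermonde determinant. -/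
lemma det_mobius_powers {n : ℕ} (a b c d : ℝ) (u : Fin n → ℝ) (k : ℝ → ℂ) :
    (Matrix.of fun r s : Fin n => ((a * u r + b : ℝ) : ℂ) ^ (s : ℕ) *
      ((c * u r + d : ℝ) : ℂ) ^ (n - 1 - s) * k (u r)).det =
    (((a * d - b * c) ^ (∑ i : Fin n, (Finset.Ioi i).card) : ℝ) : ℂ) *
      (Matrix.of fun r s : Fin n => (u r : ℂ) ^ (s : ℕ) * k (u r)).det := by
  have h1 : (Matrix.of fun r s : Fin n => ((a * u r + b : ℝ) : ℂ) ^ (s : ℕ) *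
      ((c * u r + d : ℝ) : ℂ) ^ (n - 1 - s) * k (u r)) = Matrix.of fun r s : Fin n => k (u r) *
        Matrix.projVandermonde (fun r => ((a * u r + b : ℝ) : ℂ))
          (fun r => ((c * u r + d : ℝ) : ℂ)) r s := by
    ext r s
    rw [Matrix.of_apply, Matrix.of_apply, Matrix.projVandermonde_apply, Fin.val_rev,
      show n - (s + 1) = n - 1 - (s : ℕ) by omega]
    ring
  have h2 : (Matrix.of fun r s : Fin n => (u r : ℂ) ^ (s : ℕ) * k (u r)) =
      Matrix.of fun r s : Fin n => k (u r) * Matrix.vandermonde (fun r => (u r : ℂ)) r s := by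
    ext r s; simp [Matrix.vandermonde_apply, mul_comm]
  have h3 : ∀ i j, ((a * u j + b : ℝ) : ℂ) * ((c * u i + d : ℝ) : ℂ) -
      ((a * u i + b : ℝ) : ℂ) * ((c * u j + d : ℝ) : ℂ) =
      ((a * d - b * c : ℝ) : ℂ) * ((u j : ℂ) - u i) := by
    intro i j; push_cast; ring
  rw [h1, h2, Matrix.det_mul_column, Matrix.det_mul_column, Matrix.det_projVandermonde,
    Matrix.det_vandermonde]
  simp only [h3, Finset.prod_mul_distrib, Finset.prod_const]
  rw [Finset.prod_pow_eq_pow_sum, Complex.ofReal_pow]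
  ring

lemma det_moment_mobius {n : ℕ} (β : LinkPattern (n + 1)) (hD : 0 < a * d - b * c)
    {x : Fin (2 * (n + 1)) → ℝ} (hx : StrictMono x) (hw : ∀ i, 0 < c * x i + d) :
    (Matrix.of fun r s : Fin n =>
      moment (mobius a b c d ∘ x) 0 s (β.a r.succ) (β.b r.succ)).det =
    ((Real.exp (-(n * (n + 1)) / 2 * Real.log (a * d - b * c) +
      n / 2 * ∑ i, Real.log (c * x i + d)) : ℝ) : ℂ) *
      (Matrix.of fun r s : Fin n => moment x 0 s (β.a r.succ) (β.b r.succ)).det := by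
  have hlt : ∀ r, x (β.a r) < x (β.b r) := fun r => hx (β.a_lt_b r)
  have hint : ∀ g : ℝ → ℂ, Continuous g → ∀ r,
      IntegrableOn (fun u => g u * weight x u) (Ioo (x (β.a r)) (x (β.b r))) := fun g hg r =>
    (intervalIntegrable_iff_integrableOn_Ioo_of_le (hlt r).le).1
      (intervalIntegrable_mul_weight hx.injective hg _ _)
  have h1 : (Matrix.of fun r s : Fin n => moment x 0 s (β.a r.succ) (β.b r.succ)) =
      Matrix.of fun r s : Fin n => ∫ u in Ioo (x (β.a r.succ)) (x (β.b r.succ)),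
        (u : ℂ) ^ (s : ℕ) * weight x u := by
    ext r s
    simp only [Matrix.of_apply, moment, Complex.ofReal_zero, sub_zero]
    rw [intervalIntegral.integral_of_le (hlt _).le, integral_Ioc_eq_integral_Ioo]
  have h2 : (Matrix.of fun r s : Fin n =>
      moment (mobius a b c d ∘ x) 0 s (β.a r.succ) (β.b r.succ)) =
      ((Real.exp (-n * Real.log (a * d - b * c) + 1 / 2 * ∑ i, Real.log (c * x i + d)) : ℝ) : ℂ) •
      Matrix.of fun r s : Fin n => ∫ u in Ioo (x (β.a r.succ)) (x (β.b r.succ)),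
        ((a * u + b : ℝ) : ℂ) ^ (s : ℕ) * ((c * u + d : ℝ) : ℂ) ^ (n - 1 - s) * weight x u := by
    ext r s
    simp only [Matrix.of_apply, Matrix.smul_apply, smul_eq_mul]
    exact moment_mobius hD hw s.isLt (hlt _)
  rw [h1, h2, Matrix.det_smul, Fintype.card_fin,
    ← integral_pi_det _ (fun (s : Fin n) u => (u : ℂ) ^ (s : ℕ) * weight x u)
      (fun r s => hint _ (by fun_prop) r.succ),
    ← integral_pi_det _ (fun (s : Fin n) u => ((a * u + b : ℝ) : ℂ) ^ (s : ℕ) *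
      ((c * u + d : ℝ) : ℂ) ^ (n - 1 - s) * weight x u) (fun r s => hint _ (by fun_prop) r.succ)]
  simp only [det_mobius_powers a b c d _ (weight x)]
  rw [integral_const_mul, ← mul_assoc, ← Complex.ofReal_pow, ← Complex.ofReal_mul]
  congr 2
  rw [← Real.rpow_natCast (a * d - b * c), sum_card_Ioi, Real.rpow_def_of_pos hD,
    ← Real.exp_nat_mul, ← Real.exp_add]
  congr 1
  ring

lemma coulombGas_mobius_of_pos {N : ℕ} (β : LinkPattern N) (hD : 0 < a * d - b * c)
    {x : Fin (2 * N) → ℝ} (hx : x ∈ chamber N) (hw : ∀ i, 0 < c * x i + d)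
    (hφ : mobius a b c d ∘ x ∈ chamber N) :
    coulombGas β x = ((∏ i, deriv (mobius a b c d) (x i) ^ (-1 / 8 : ℝ) : ℝ) : ℂ) *
      coulombGas β (mobius a b c d ∘ x) := by
  rcases N with _ | n
  · have : IsEmpty (Fin (2 * 0)) := inferInstanceAs (IsEmpty (Fin 0))
    simp [coulombGas_zero]
  have hx' : StrictMono x := hx
  have hφ' : StrictMono (mobius a b c d ∘ x) := hφ
  rw [coulombGas_eq_det β hx 0, coulombGas_eq_det β hφ 0, det_moment_eq β hx', det_moment_eq β hφ',
    alternatingMoment_const β hφ' hx', det_moment_mobius β hD hx' hw, prod_deriv_mobius hD hw,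
    vdmQuarter_eq_exp hφ', vdmQuarter_eq_exp hx', logVdm_mobius hD hx' hw]
  set L := Real.log (a * d - b * c)
  set S := ∑ i, Real.log (c * x i + d)
  have h : Real.exp (logVdm x) =
      Real.exp (-((2 * (n + 1) : ℕ) : ℝ) / 8 * L + 1 / 4 * S) *
      Real.exp (logVdm x + ((2 * (n + 1) : ℕ) : ℝ) * (((2 * (n + 1) : ℕ) : ℝ) - 1) / 8 * L -
        (((2 * (n + 1) : ℕ) : ℝ) - 1) / 4 * S) *
      Real.exp (-(n * (n + 1)) / 2 * L + n / 2 * S) := by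
    rw [← Real.exp_add, ← Real.exp_add]
    congr 1
    push_cast; ring
  rw [h]
  push_cast
  ring

/-- Möbius covariance of the Coulomb gas functions. -/
theorem coulombGas_mobius {N : ℕ} (β : LinkPattern N) {x : Fin (2 * N) → ℝ} (hx : x ∈ chamber N)
    (hD : 0 < a * d - b * c) (hw : ∀ i, c * x i + d ≠ 0) (hφ : mobius a b c d ∘ x ∈ chamber N) :
    coulombGas β x = ((∏ i, deriv (mobius a b c d) (x i) ^ (-1 / 8 : ℝ) : ℝ) : ℂ) *
      coulombGas β (mobius a b c d ∘ x) := by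
  have hx' : StrictMono x := hx
  have hφ' : StrictMono (mobius a b c d ∘ x) := hφ
  have hsign : ∀ i j, i < j → 0 < (c * x i + d) * (c * x j + d) := by
    intro i j hij
    have h1 := sub_pos.2 (hφ' hij)
    simp only [Function.comp] at h1
    rw [mobius_sub_mobius (hw i) (hw j)] at h1
    exact (div_pos_iff_of_pos_left (mul_pos hD (sub_pos.2 (hx' hij)))).1 h1
  by_cases hpos : ∀ i, 0 < c * x i + d
  · exact coulombGas_mobius_of_pos β hD hx hpos hφ
  · push Not at hpos
    obtain ⟨i, hi⟩ := hpos
    have hi := lt_of_le_of_ne hi (hw i)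
    have hneg : ∀ j, 0 < -c * x j + -d := by
      intro j
      suffices c * x j + d < 0 by linarith
      rcases lt_trichotomy i j with h | rfl | h
      · exact neg_of_mul_pos_right (hsign i j h) hi.le
      · exact hi
      · exact neg_of_mul_pos_left (hsign j i h) hi.le
    rw [← mobius_neg] at hφ ⊢
    exact coulombGas_mobius_of_pos β (by linarith) hx hneg hφ

end Covariance

end

theorem theorem1p1 :
    -- regularity and the second-order BPZ PDE system
    (∀ (N : ℕ) (β : LinkPattern N),
      ContDiffOn ℝ 2 (coulombGas β) (chamber N) ∧
      ∀ x ∈ chamber N, ∀ j : Fin (2 * N),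
        4 * partialDeriv j (partialDeriv j (coulombGas β)) x +
          ∑ i ∈ Finset.univ.erase j,
            ((2 / (x i - x j) : ℝ) * partialDeriv i (coulombGas β) x +
              ((1 / 4) / (x i - x j) ^ 2 : ℝ) * coulombGas β x) = 0) ∧
    -- Möbius covariance
    (∀ (N : ℕ) (β : LinkPattern N), ∀ x ∈ chamber N, ∀ a b c d : ℝ,
      0 < a * d - b * c → (∀ i, c * x i + d ≠ 0) → (mobius a b c d ∘ x) ∈ chamber N →
        coulombGas β x =
          ((∏ i, deriv (mobius a b c d) (x i) ^ (-1 / 8 : ℝ) : ℝ) : ℂ) *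
            coulombGas β (mobius a b c d ∘ x)) ∧
    -- positivity
    (∀ (N : ℕ) (β : LinkPattern N), ∀ x ∈ chamber N,
      (coulombGas β x).im = 0 ∧ 0 < (coulombGas β x).re) ∧
    -- asymptotics
    (∀ (n : ℕ) (β : LinkPattern (n + 1)) (j : Fin (2 * n + 1)), ∀ x ∈ chamber (n + 1), ∀ ξ : ℝ,
      (∀ i, i < lo j → x i < ξ) → (∀ i, hi j < i → ξ < x i) →
        (∀ h : β.pair (lo j) = hi j,
          Tendsto (fun p : ℝ × ℝ =>
              coulombGas β (setPair x j p) / (((p.2 - p.1) ^ (1 / 4 : ℝ) : ℝ) : ℂ))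
            (𝓝[{p | p.1 < p.2}] (ξ, ξ))
            (𝓝 (Real.pi * coulombGas (β.removeLink j h) (x ∘ skip j)))) ∧
        (β.pair (lo j) ≠ hi j →
          Tendsto (fun p : ℝ × ℝ =>
              coulombGas β (setPair x j p) /
                (((p.2 - p.1) ^ (1 / 4 : ℝ) * |Real.log (p.2 - p.1)| : ℝ) : ℂ))
            (𝓝[{p | p.1 < p.2}] (ξ, ξ))
            (𝓝 (coulombGas ((β.tie j).removeLink j (β.tie_pair_lo j)) (x ∘ skip j))))) ∧
    -- linear independence
    (∀ N : ℕ, LinearIndependent ℂ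
      fun (β : LinkPattern N) (x : chamber N) => coulombGas β x) := by
  refine ⟨fun N β => coulombGas_pde β, fun N β x hx a b c d hD hw hφ =>
    coulombGas_mobius β hx hD hw hφ, fun N β x hx => ?_, fun n β j x hx ξ hl hr => ?_, fun N => ?_⟩
  · have h := Complex.pos_iff.1 (coulombGas_pos β hx)
    exact ⟨h.2.symm, h.1⟩
  · have h : IsBetween x j ξ := ⟨hx, hl, hr⟩
    exact ⟨fun hβ => h.tendsto_coulombGas_linked β hβ,
      fun hβ => h.tendsto_coulombGas_unlinked β hβ⟩
  · rw [Fintype.linearIndependent_iff]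
    intro c hc
    refine congrFun (coulombGas_independent N c fun x hx => ?_)
    simpa using congrFun hc ⟨x, hx⟩
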